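/- Let $k$ be a field of characteristic zero. All $A_\infty$-algebras and dg algebras over $k$ are $\mathbb{Z}$-graded (cohomologically), unital and augmented. An $A_\infty$-algebra $A$ has operations $m_n : A^{\otimes n}\to A$ of degree $2-n$ ($n\ge 1$, with $m_1=d$ the differential) satisfying $\sum_{r+s+t=n}(-1)^{rs+t}m_{r+1+t}(1^{\otimes r}\otimes m_s\otimes 1^{\otimes t})=0$, a strict unit, and an augmentation $A\to k$ (a strict morphism) with kernel $\overline A$. It is minimal if $d=0$. Its bar construction $BA=T^{co}(s\overline A)$ is the tensor coalgebra on the suspension, $(s\overline A)^n=\overline A^{n+1}$, with the coderivation $b$ whose components are $b_n=-s\,m_n\,(s^{-1})^{\otimes n}$. The reduced Hochschild complex $C^*(A,A)=\mathrm{Hom}^\pi(BA,A)$ consists of the homogeneous linear maps $f:BA\to A$, with the differential $\partial_\pi$ given by $$s\,\partial_\pi f=-\Big(\sum_{r,t\ge 0} b_{r+1+t}\,(1^{\otimes r}\otimes sf\otimes 1^{\otimes t})\,\Delta^{(r+1+t)}-(-1)^{|f|-1}\,sf\circ b\Big),$$ where $\Delta^{(r+1+t)}$ is the iterated coproduct of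 $BA$ projected to $(s\overline A)^{\otimes r}\otimes BA\otimes(s\overline A)^{\otimes t}$ and $b_n$ also denotes the extension of $b_n$ to $sA$. Its cohomology is $HH^*(A,A)$, and $f\mapsto f(1)$ induces the projection $\Pi: HH^*(A,A)\to H(A)$. A minimal $A_\infty$-algebra $A$ (so that $H(A)=A$) is called $A_\infty$-commutative if $\Pi:HH^*(A,A)\to A$ is surjective. An $L_\infty$-algebra $L$ is a graded vector space with a codifferential $b$ (a coderivation of degree $1$ with $b^2=0$) on the coalgebra $\mathrm{Sym}^{co}(sL)\subseteq T^{co}(sL)$ of (signed) symmetric tensors, vanishing on $k$; its $n$-ary operation is the component $\mathrm{Sym}^{co}_n(sL)\to sL$ of $b$ on tensors of weight $n$, and the unary one is the differential. A morphism $L\to L'$ is a morphism of coaugmented dg coalgebras $\mathrm{Sym}^{co}(sL)\to\mathrm{Sym}^{co}(sL')$; it is a quasi-isomorphism if its weight one part is a quasi-isomorphism of complexes. $L$ is completely abelian if all its $n$-ary operations with $n\ge 2$ vanish, quasi-abelian if there is a quasi-isomorphism $L'\to L$ from a completely abelian $L_\infty$-algebra $L'$, and formal if there is a quasi-isomorphism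 $L'\to L$ from an $L_\infty$-algebra $L'$ all of whose operations except possibly the binary one vanish, that is, from a graded Lie algebra (necessarily isomorphic to $H(L)$). The $L_\infty$-algebra $A^{\mathrm{Lie}}$ associated with an $A_\infty$-algebra $A$ is $\overline A$, with the codifferential on $\mathrm{Sym}^{co}(s\overline A)\subseteq BA$ obtained by restricting the bar differential $b$. A dg algebra is an $A_\infty$-algebra with $m_n=0$ for $n\ge 3$, and in that case $A^{\mathrm{Lie}}$ is $\overline A$ with the graded commutator as a dg Lie algebra. Then: 1. If a minimal $A_\infty$-algebra $A$ over $k$ is $A_\infty$-commutative, then the $L_\infty$-algebra $A^{\mathrm{Lie}}$ is completely abelian. 2. If $A$ is a dg algebra over $k$ such that $\Pi:HH^*(A,A)\to H(A)$ is surjective, then the dg Lie algebra $A^{\mathrm{Lie}}$ is quasi-abelian, and it is formal (so it is formal and quasi-isomorphic to an abelian Lie algebra). -/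

import Mathlib

open scoped TensorProduct DirectSum

universe u v w

namespace AInf

noncomputable section

/-! ### Graded vector spaces -/

/-- A `ℤ`-grading (cohomological degrees) on a vector space: a direct sum decomposition. -/
structure Grading (k : Type u) [Field k] (V : Type v) [AddCommGroup V] [Module k V] where
  /-- the subspace of elements of degree `p` -/
  gr : ℤ → Submodule k V
  internal : DirectSum.IsInternal gr

namespace Grading

variable {k : Type u} [Field k] {V : Type v} [AddCommGroup V] [Module k V]
variable {W : Type w} [AddCommGroup W] [Module k W]

/-- The endomorphism acting on degree `p` as multiplication by `c p`. -/
def scale (G : Grading k V) (c : ℤ → k) : V →ₗ[k] V :=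
  DirectSum.toModule k ℤ V (fun p => c p • (G.gr p).subtype) ∘ₗ
    (LinearEquiv.ofBijective (DirectSum.coeLinearMap G.gr) G.internal).symm.toLinearMap

theorem scale_of_mem (G : Grading k V) (c : ℤ → k) {p : ℤ} {v : V} (hv : v ∈ G.gr p) :
    G.scale c v = c p • v := by
  have h : (LinearEquiv.ofBijective (DirectSum.coeLinearMap G.gr) G.internal).symm v
      = DirectSum.lof k ℤ (fun p => G.gr p) p ⟨v, hv⟩ := by
    rw [LinearEquiv.symm_apply_eq]
    exact (DirectSum.coeLinearMap_lof G.gr p ⟨v, hv⟩).symm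
  simp only [scale, LinearMap.comp_apply, LinearEquiv.coe_coe, h, DirectSum.toModule_lof]
  simp

theorem multilinear_ext (G : Grading k V) {n : ℕ} {f g : MultilinearMap k (fun _ : Fin n => V) W}
    (h : ∀ (p : Fin n → ℤ) (v : Fin n → V), (∀ i, v i ∈ G.gr (p i)) → f v = g v) : f = g := by
  classical
  let B := G.internal.collectedBasis (fun p => Module.Free.chooseBasis k (G.gr p))
  refine Module.Basis.ext_multilinear (fun _ => B) fun v => ?_
  refine h (fun i => (v i).1) _ fun i => ?_
  exact G.internal.collectedBasis_mem _ _

theorem linear_ext (G : Grading k V) {f g : V →ₗ[k] W}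
    (h : ∀ (p : ℤ) (v : V), v ∈ G.gr p → f v = g v) : f = g := by
  classical
  let B := G.internal.collectedBasis (fun p => Module.Free.chooseBasis k (G.gr p))
  refine B.ext fun i => h i.1 _ (G.internal.collectedBasis_mem _ _)

theorem scale_scale (G : Grading k V) (c c' : ℤ → k) (v : V) :
    G.scale c (G.scale c' v) = G.scale (fun p => c p * c' p) v := by
  refine LinearMap.congr_fun (G.linear_ext (f := G.scale c ∘ₗ G.scale c') fun p v hv => ?_) v
  rw [LinearMap.comp_apply, scale_of_mem _ _ hv, map_smul, scale_of_mem _ _ hv,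
    scale_of_mem _ _ hv, smul_smul, mul_comm]

theorem scale_one (G : Grading k V) (v : V) : G.scale (fun _ => 1) v = v := by
  refine LinearMap.congr_fun (G.linear_ext (g := LinearMap.id) fun p v hv => ?_) v
  simp [scale_of_mem _ _ hv]

/-- The Koszul sign for moving something of degree `n` past `v`:
`sgn n v = (-1) ^ (n * |v|) • v` on homogeneous `v`. -/
def sgn (G : Grading k V) (n : ℤ) : V →ₗ[k] V := G.scale fun p => (-1 : k) ^ (n * p)

theorem sgn_of_mem (G : Grading k V) (n : ℤ) {p : ℤ} {v : V} (hv : v ∈ G.gr p) :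
    G.sgn n v = (-1 : k) ^ (n * p) • v := G.scale_of_mem _ hv

theorem sgn_sgn (G : Grading k V) (m n : ℤ) (v : V) : G.sgn m (G.sgn n v) = G.sgn (m + n) v := by
  rw [sgn, sgn, scale_scale, sgn]
  congr 1
  congr 1
  ext p
  rw [add_mul, zpow_add₀ (by simp)]

theorem sgn_even (G : Grading k V) {n : ℤ} (hn : Even n) (v : V) : G.sgn n v = v := by
  rw [sgn]
  conv_rhs => rw [← G.scale_one v]
  congr 1
  congr 1
  ext p
  rw [Even.neg_one_zpow (hn.mul_right p)]

/-- The suspension `sV`: the same space, with `(sV)^n = V^(n+1)`. The regrading operator `s` is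
the identity on elements. -/
def shift (G : Grading k V) : Grading k V where
  gr n := G.gr (n + 1)
  internal := by
    have h := (DirectSum.isInternal_submodule_iff_iSupIndep_and_iSup_eq_top _).1 G.internal
    refine (DirectSum.isInternal_submodule_iff_iSupIndep_and_iSup_eq_top _).2 ⟨?_, ?_⟩
    · exact h.1.comp (f := fun n : ℤ => n + 1) (add_left_injective 1)
    · rw [← h.2]
      exact (Equiv.addRight (1 : ℤ)).iSup_comp (g := G.gr)

theorem mem_shift (G : Grading k V) {n : ℤ} {v : V} : v ∈ G.shift.gr n ↔ v ∈ G.gr (n + 1) :=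
  Iff.rfl

theorem sgn_shift (G : Grading k V) (n : ℤ) (v : V) :
    G.shift.sgn n v = (-1 : k) ^ n • G.sgn n v := by
  refine LinearMap.congr_fun (G.linear_ext (f := G.shift.sgn n) (g := (-1 : k) ^ n • G.sgn n)
    fun p v hv => ?_) v
  have hv' : v ∈ G.shift.gr (p - 1) := by simpa [mem_shift] using hv
  rw [sgn_of_mem _ _ hv', LinearMap.smul_apply, sgn_of_mem _ _ hv, smul_smul,
    ← zpow_add₀ (by simp)]
  congr 1
  rw [show n + n * p = n * (p - 1) + 2 * n by ring, zpow_add₀ (by simp)]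
  simp [zpow_mul]

theorem induction_gr (G : Grading k V) {P : V → Prop} (h0 : P 0) (ha : ∀ x y, P x → P y → P (x + y))
    (h : ∀ p, ∀ v ∈ G.gr p, P v) (v : V) : P v := by
  have hs := ((DirectSum.isInternal_submodule_iff_iSupIndep_and_iSup_eq_top _).1 G.internal).2
  have hv : v ∈ ⨆ p, G.gr p := hs ▸ Submodule.mem_top
  exact Submodule.iSup_induction G.gr (motive := P) hv h h0 ha

/-- The grading induced on the kernel of a functional that vanishes outside degree `0`. -/
def kerFunctional (G : Grading k V) (e : V →ₗ[k] k) (he : ∀ p, p ≠ 0 → ∀ v ∈ G.gr p, e v = 0) :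
    Grading k (LinearMap.ker e) where
  gr p := (G.gr p).comap (LinearMap.ker e).subtype
  internal := by
    have h := (DirectSum.isInternal_submodule_iff_iSupIndep_and_iSup_eq_top _).1 G.internal
    refine (DirectSum.isInternal_submodule_iff_iSupIndep_and_iSup_eq_top _).2 ⟨?_, ?_⟩
    · intro p
      rw [Submodule.disjoint_def]
      intro x hx hx'
      have h1 := Submodule.disjoint_def.1 (h.1 p) (x : V) hx
      refine Subtype.ext (h1 ?_)
      have h2 := Submodule.mem_map_of_mem (f := (LinearMap.ker e).subtype) hx'
      simp only [Submodule.map_iSup] at h2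
      exact (iSup₂_mono fun j _ => Submodule.map_comap_le _ _ :
        (⨆ j, ⨆ (_ : j ≠ p), Submodule.map (LinearMap.ker e).subtype
          ((G.gr j).comap (LinearMap.ker e).subtype)) ≤ _) h2
    · rw [eq_top_iff]
      rintro ⟨x, hx⟩ -
      -- correct the degree zero part of a decomposition by its value under `e`
      have key : ∀ v : V, ∃ y : V, y ∈ G.gr 0 ∧ e v = e y ∧
          ∃ z ∈ ⨆ p, (G.gr p).comap (LinearMap.ker e).subtype, v = y + (z : V) := by
        refine G.induction_gr ⟨0, zero_mem _, by simp, 0, zero_mem _, by simp⟩ ?_ ?_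
        · rintro a b ⟨y, hy, hey, z, hz, hab⟩ ⟨y', hy', hey', z', hz', hab'⟩
          refine ⟨y + y', add_mem hy hy', by rw [map_add, map_add, hey, hey'], z + z',
            add_mem hz hz', ?_⟩
          rw [hab, hab', Submodule.coe_add]
          abel
        · intro p v hv
          by_cases hp : p = 0
          · subst hp
            exact ⟨v, hv, rfl, 0, zero_mem _, by simp⟩
          · have hev := he p hp v hv
            refine ⟨0, zero_mem _, by simp [hev], ⟨v, hev⟩, ?_, by simp⟩
            exact Submodule.mem_iSup_of_mem p (by simpa using hv)
      obtain ⟨y, hy, hey, z, hz, hxyz⟩ := key x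
      have hy0 : e y = 0 := by rw [← hey]; exact hx
      have : (⟨x, hx⟩ : LinearMap.ker e) = ⟨y, hy0⟩ + z := Subtype.ext hxyz
      rw [this]
      exact add_mem (Submodule.mem_iSup_of_mem 0 (by simpa using hy)) hz

end Grading

/-! ### The tensor coalgebra -/

section TensorCoalgebra

variable {k : Type u} [Field k] {V : Type v} [AddCommGroup V] [Module k V]
variable {W : Type w} [AddCommGroup W] [Module k W]

open TensorAlgebra

/-- The underlying vector space `⨁ n, V^{⊗ n}` of the tensor coalgebra `T^{co}(V)`. The product of
`TensorAlgebra` (concatenation of words) is used below only as a notation for words. -/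
abbrev TCo (k : Type u) [Field k] (V : Type v) [AddCommGroup V] [Module k V] := TensorAlgebra k V

/-- The word `v 0 ⊗ v 1 ⊗ ⋯ ⊗ v (n - 1)`. -/
def word (k : Type u) [Field k] {V : Type v} [AddCommGroup V] [Module k V] (n : ℕ) (v : ℕ → V) :
    TCo k V :=
  TensorAlgebra.tprod k V n fun i => v i

theorem word_zero (v : ℕ → V) : word k 0 v = 1 := by simp [word, tprod_apply]

theorem word_succ (n : ℕ) (v : ℕ → V) :
    word k (n + 1) v = ι k (v 0) * word k n (fun i => v (i + 1)) := by
  simp [word, tprod_apply, List.ofFn_succ]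

theorem word_congr {n : ℕ} {v v' : ℕ → V} (h : ∀ i < n, v i = v' i) : word k n v = word k n v' := by
  unfold word
  congr 1
  ext i
  exact h i i.2

theorem word_one (v : ℕ → V) : word k 1 v = ι k (v 0) := by simp [word_succ, word_zero]

theorem word_mul_word (m n : ℕ) (v w : ℕ → V) :
    word k m v * word k n w = word k (m + n) (fun i => if i < m then v i else w (i - m)) := by
  induction m generalizing v with
  | zero => simp [word_zero]
  | succ m ih =>
    rw [word_succ, mul_assoc, ih, show m + 1 + n = (m + n) + 1 by ring, word_succ]
    simp

theorem exists_seq {n : ℕ} (v : Fin n → V) : ∃ v' : ℕ → V, v = fun i : Fin n => v' i :=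
  ⟨fun i => if h : i < n then v ⟨i, h⟩ else 0, by ext i; simp⟩

theorem tco_ext {f g : TCo k V →ₗ[k] W} (h : ∀ n v, f (word k n v) = g (word k n v)) : f = g := by
  have : f ∘ₗ (equivDirectSum (R := k) (M := V)).symm.toLinearMap
      = g ∘ₗ (equivDirectSum (R := k) (M := V)).symm.toLinearMap := by
    refine DirectSum.linearMap_ext k fun n => ?_
    refine PiTensorProduct.ext ?_
    ext v
    obtain ⟨v, rfl⟩ := exists_seq v
    have := h n v
    simpa [equivDirectSum, DirectSum.lof_eq_of, ofDirectSum_of_tprod, word] using this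
  ext x
  have h2 := LinearMap.congr_fun this (equivDirectSum x)
  simpa using h2

theorem tco_rec_ext {f g : TCo k V →ₗ[k] W} (h1 : f 1 = g 1)
    (h : ∀ v x, f x = g x → f (ι k v * x) = g (ι k v * x)) : f = g := by
  refine tco_ext fun n => ?_
  induction n with
  | zero => intro v; simpa [word_zero] using h1
  | succ n ih => intro v; rw [word_succ]; exact h _ _ (ih _)

/-- The linear map on `T^{co}(V)` assembled from its components `V^{⊗ n} → W`. -/
def ofFamily (f : ∀ n : ℕ, MultilinearMap k (fun _ : Fin n => V) W) : TCo k V →ₗ[k] W :=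
  DirectSum.toModule k ℕ W (fun n => PiTensorProduct.lift (f n)) ∘ₗ
    (equivDirectSum (R := k) (M := V)).toLinearMap

theorem ofFamily_word (f : ∀ n : ℕ, MultilinearMap k (fun _ : Fin n => V) W) (n : ℕ) (v : ℕ → V) :
    ofFamily f (word k n v) = f n (fun i => v i) := by
  simp only [ofFamily, word, LinearMap.comp_apply, AlgEquiv.toLinearMap_apply, equivDirectSum,
    AlgEquiv.ofAlgHom_apply]
  rw [TensorAlgebra.toDirectSum_tensorPower_tprod, ← DirectSum.lof_eq_of k, DirectSum.toModule_lof,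
    PiTensorProduct.lift.tprod]

/-- Auxiliary to `decon`: `v` acts by `(x, z) ↦ (v ⊗ x, 1 ⊗ (v ⊗ x) + (v · ) z)`. -/
def deconStep : V →ₗ[k] Module.End k (TCo k V × (TCo k V ⊗[k] TCo k V)) where
  toFun v :=
    { toFun := fun p => (ι k v * p.1, 1 ⊗ₜ[k] (ι k v * p.1) +
        TensorProduct.map (LinearMap.mulLeft k (ι k v)) LinearMap.id p.2)
      map_add' := fun p q => by
        ext1 <;> simp [mul_add, TensorProduct.tmul_add]
        abel
      map_smul' := fun c p => by ext1 <;> simp }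
  map_add' v w := by
    refine LinearMap.ext fun p => Prod.ext ?_ ?_
    · simp [add_mul]
    · have : LinearMap.mulLeft k (ι k v + ι k w) = LinearMap.mulLeft k (ι k v)
        + LinearMap.mulLeft k (ι k w) := by ext; simp [add_mul]
      simp [add_mul, TensorProduct.tmul_add, this, TensorProduct.map_add_left]
      abel
  map_smul' c v := by
    refine LinearMap.ext fun p => Prod.ext ?_ ?_
    · simp
    · have : LinearMap.mulLeft k (c • ι k v) = c • LinearMap.mulLeft k (ι k v) := by ext; simp
      simp [this, TensorProduct.map_smul_left]

theorem deconStep_apply (v : V) (p : TCo k V × (TCo k V ⊗[k] TCo k V)) :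
    deconStep v p = (ι k v * p.1, 1 ⊗ₜ[k] (ι k v * p.1) +
        TensorProduct.map (LinearMap.mulLeft k (ι k v)) LinearMap.id p.2) := rfl

/-- The deconcatenation coproduct `Δ (v₁ ⊗ ⋯ ⊗ vₙ) = ∑ᵢ (v₁ ⊗ ⋯ ⊗ vᵢ) ⊗ (vᵢ₊₁ ⊗ ⋯ ⊗ vₙ)`,
see `decon_word`. -/
def decon : TCo k V →ₗ[k] TCo k V ⊗[k] TCo k V :=
  LinearMap.snd k _ _ ∘ₗ LinearMap.applyₗ (1, 1 ⊗ₜ[k] 1) ∘ₗ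
    (TensorAlgebra.lift k (deconStep (k := k) (V := V))).toLinearMap

theorem decon_aux (x : TCo k V) :
    (TensorAlgebra.lift k (deconStep (k := k) (V := V)) x (1, 1 ⊗ₜ[k] 1)).1 = x := by
  have : LinearMap.fst k _ _ ∘ₗ LinearMap.applyₗ (1, 1 ⊗ₜ[k] 1) ∘ₗ
    (TensorAlgebra.lift k (deconStep (k := k) (V := V))).toLinearMap = LinearMap.id := by
    refine tco_rec_ext ?_ ?_
    · simp
    · intro v x h
      simp only [LinearMap.comp_apply, AlgHom.toLinearMap_apply, map_mul, lift_ι_apply,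
        LinearMap.applyₗ_apply_apply, Module.End.mul_apply, deconStep_apply, LinearMap.id_apply,
        LinearMap.fst_apply] at h ⊢
      rw [h]
  exact LinearMap.congr_fun this x

theorem decon_one : decon (1 : TCo k V) = 1 ⊗ₜ[k] 1 := by simp [decon]

theorem decon_ι_mul (v : V) (x : TCo k V) :
    decon (ι k v * x) = 1 ⊗ₜ[k] (ι k v * x) +
      TensorProduct.map (LinearMap.mulLeft k (ι k v)) LinearMap.id (decon x) := by
  have := decon_aux (k := k) x
  simp only [decon, LinearMap.comp_apply, AlgHom.toLinearMap_apply, map_mul, lift_ι_apply,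
    LinearMap.applyₗ_apply_apply, Module.End.mul_apply, deconStep_apply, LinearMap.snd_apply, this]

theorem decon_ι (v : V) : decon (ι k v) = 1 ⊗ₜ[k] ι k v + ι k v ⊗ₜ[k] 1 := by
  have := decon_ι_mul (k := k) v 1
  simpa [decon_one] using this

theorem decon_word (n : ℕ) (v : ℕ → V) :
    decon (word k n v) = ∑ p ∈ Finset.HasAntidiagonal.antidiagonal n,
      word k p.1 v ⊗ₜ[k] word k p.2 (fun i => v (p.1 + i)) := by
  induction n generalizing v with
  | zero => simp [word_zero, decon_one]
  | succ n ih =>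
    rw [word_succ, decon_ι_mul, ih, Finset.Nat.sum_antidiagonal_succ, map_sum]
    simp only [word_zero, word_succ, zero_add, TensorProduct.map_tmul, LinearMap.mulLeft_apply,
      LinearMap.id_apply]
    congr 1
    refine Finset.sum_congr rfl fun p _ => ?_
    congr 2
    ext i
    congr 1
    ring

/-- The counit of `T^{co}(V)`. -/
def counit : TCo k V →ₗ[k] k := (algebraMapInv (R := k) (M := V)).toLinearMap

theorem counit_one : counit (1 : TCo k V) = 1 := by simp [counit]

theorem counit_ι_mul (v : V) (x : TCo k V) : counit (ι k v * x) = 0 := by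
  simp [counit, algebraMapInv]

/-- The components of `proj`. -/
def projFamily : ∀ n : ℕ, MultilinearMap k (fun _ : Fin n => V) V
  | 1 => MultilinearMap.ofSubsingleton k V V (0 : Fin 1) LinearMap.id
  | _ => 0

/-- The projection `π₁ : T^{co}(V) → V` onto the words of weight one. -/
def proj : TCo k V →ₗ[k] V := ofFamily projFamily

theorem proj_one : proj (1 : TCo k V) = 0 := by
  rw [← word_zero (k := k) (fun _ => (0 : V)), proj, ofFamily_word]
  rfl

theorem proj_ι_mul (v : V) (x : TCo k V) : proj (ι k v * x) = counit x • v := by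
  have : (proj : TCo k V →ₗ[k] V) ∘ₗ LinearMap.mulLeft k (ι k v)
      = (counit : TCo k V →ₗ[k] k).smulRight v := by
    refine tco_ext fun n u => ?_
    have h := word_succ (k := k) n (fun i => if i = 0 then v else u (i - 1))
    simp only [LinearMap.comp_apply, LinearMap.mulLeft_apply, LinearMap.smulRight_apply]
    simp only [if_true, Nat.add_eq_zero_iff, one_ne_zero, and_false, if_false,
      Nat.add_sub_cancel] at h
    rw [← h, proj, ofFamily_word]
    cases n with
    | zero => simp [word_zero, counit_one, projFamily]
    | succ n => rw [word_succ, counit_ι_mul, zero_smul]; rfl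
  exact LinearMap.congr_fun this x

theorem proj_ι (v : V) : proj (ι k v) = v := by
  have := proj_ι_mul (k := k) v 1
  rwa [mul_one, counit_one, one_smul] at this

/-- The map `T(g)` applying `g` to each letter of a word. -/
def tmap (g : V →ₗ[k] W) : TCo k V →ₐ[k] TCo k W := TensorAlgebra.lift k (ι k ∘ₗ g)

theorem tmap_ι (g : V →ₗ[k] W) (v : V) : tmap g (ι k v) = ι k (g v) := by simp [tmap]

/-- The words of weight `n`, that is, `V^{⊗ n}` inside `T^{co}(V)`. -/
def weight (k : Type u) [Field k] (V : Type v) [AddCommGroup V] [Module k V] (n : ℕ) :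
    Submodule k (TCo k V) := Submodule.span k (Set.range (word k n))

/-- Auxiliary to `coext`: the map `(α ⊗ T(g)) Δ`, applying `α` to a prefix of a word. -/
def prefixExt (g : V →ₗ[k] W) (α : TCo k V →ₗ[k] W) : TCo k V →ₗ[k] TCo k W :=
  LinearMap.mul' k (TCo k W) ∘ₗ
    TensorProduct.map (ι k ∘ₗ α) (tmap g).toLinearMap ∘ₗ decon

/-- Coextension of `α : T^{co}(V) → W` along `g : V → W`:
`v₁ ⊗ ⋯ ⊗ vₙ ↦ ∑ (g v₁ ⊗ ⋯ ⊗ g vᵢ₋₁) ⊗ α(⋯) ⊗ (g vⱼ ⊗ ⋯ ⊗ g vₙ)`, with the Koszul sign for moving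
`α`, of degree `n`, past the elements to its left; that is,
`(T(g) ⊗ α ⊗ T(g)) Δ^{(3)}`, see `coext_word`. For `g = id` it is the coderivation `D_α`. -/
def coext (G : Grading k V) (g : V →ₗ[k] W) (n : ℤ) (α : TCo k V →ₗ[k] W) :
    TCo k V →ₗ[k] TCo k W :=
  LinearMap.mul' k (TCo k W) ∘ₗ
    TensorProduct.map (tmap (g ∘ₗ G.sgn n)).toLinearMap (prefixExt g α) ∘ₗ decon

theorem map_word (g : V →ₗ[k] W) (n : ℕ) (v : ℕ → V) :
    tmap g (word k n v) = word k n (fun i => g (v i)) := by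
  induction n generalizing v with
  | zero => simp [word_zero]
  | succ n ih => rw [word_succ, word_succ, map_mul, ih, tmap_ι]

theorem coext_word' (G : Grading k V) (g : V →ₗ[k] W) (n : ℤ) (α : TCo k V →ₗ[k] W)
    (N : ℕ) (v : ℕ → V) :
    coext G g n α (word k N v) = ∑ p ∈ Finset.HasAntidiagonal.antidiagonal N, ∑ q ∈ Finset.HasAntidiagonal.antidiagonal p.2,
      word k p.1 (fun i => g (G.sgn n (v i))) * (ι k (α (word k q.1 (fun i => v (p.1 + i)))) *
        word k q.2 (fun i => g (v (p.1 + (q.1 + i))))) := by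
  simp only [coext, prefixExt, LinearMap.comp_apply, decon_word, map_sum, TensorProduct.map_tmul,
    LinearMap.mul'_apply, AlgHom.toLinearMap_apply, map_word, Finset.mul_sum]

theorem coext_word (G : Grading k V) (g : V →ₗ[k] W) (n : ℤ) (α : TCo k V →ₗ[k] W)
    (N : ℕ) (v : ℕ → V) :
    coext G g n α (word k N v) = ∑ p ∈ Finset.HasAntidiagonal.antidiagonal N, ∑ q ∈ Finset.HasAntidiagonal.antidiagonal p.2,
      word k (p.1 + 1 + q.2) (fun i => if i < p.1 then g (G.sgn n (v i)) else
        if i = p.1 then α (word k q.1 (fun j => v (p.1 + j))) else g (v (i + q.1 - 1))) := by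
  rw [coext_word']
  refine Finset.sum_congr rfl fun p _ => Finset.sum_congr rfl fun q _ => ?_
  have h1 := word_one (k := k) (fun _ : ℕ => α (word k q.1 (fun i => v (p.1 + i))))
  rw [← h1, word_mul_word, word_mul_word, add_assoc]
  refine word_congr fun i hi => ?_
  split_ifs with h h' h'' <;> first | rfl | omega | skip
  congr 2
  omega

theorem coext_one (G : Grading k V) (g : V →ₗ[k] W) (n : ℤ) (α : TCo k V →ₗ[k] W) :
    coext G g n α 1 = ι k (α 1) := by
  simp [coext, prefixExt, decon_one]

theorem coext_ι_mul (G : Grading k V) (g : V →ₗ[k] W) (n : ℤ) (α : TCo k V →ₗ[k] W)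
    (v : V) (x : TCo k V) :
    coext G g n α (ι k v * x) = prefixExt g α (ι k v * x) +
      ι k (g (G.sgn n v)) * coext G g n α x := by
  have h : LinearMap.mul' k (TCo k W) ∘ₗ
      TensorProduct.map (tmap (g ∘ₗ G.sgn n)).toLinearMap (prefixExt g α) ∘ₗ
      TensorProduct.map (LinearMap.mulLeft k (ι k v)) LinearMap.id
      = LinearMap.mulLeft k (ι k (g (G.sgn n v))) ∘ₗ LinearMap.mul' k (TCo k W) ∘ₗ
      TensorProduct.map (tmap (g ∘ₗ G.sgn n)).toLinearMap (prefixExt g α) := by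
    ext x y
    simp [mul_assoc, tmap_ι]
  simp only [coext, LinearMap.comp_apply, decon_ι_mul, map_add]
  congr 1
  · simp
  · exact LinearMap.congr_fun h (decon x)

end TensorCoalgebra

/-! ### Coderivations of the tensor coalgebra -/

section Coderivations

variable {k : Type u} [Field k] {V : Type v} [AddCommGroup V] [Module k V]

open TensorAlgebra

theorem decon_counit (x : TCo k V) :
    TensorProduct.map (counit : TCo k V →ₗ[k] k) LinearMap.id (decon x) = 1 ⊗ₜ[k] x := by
  have : TensorProduct.map (counit : TCo k V →ₗ[k] k) LinearMap.id ∘ₗ decon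
      = TensorProduct.mk k k (TCo k V) 1 := by
    refine tco_rec_ext ?_ fun v x _ => ?_
    · simp [decon_one, counit_one]
    · simp only [LinearMap.comp_apply, decon_ι_mul, map_add, TensorProduct.map_tmul, counit_one,
        LinearMap.id_apply, TensorProduct.mk_apply, add_eq_left]
      have h : TensorProduct.map (counit : TCo k V →ₗ[k] k) (LinearMap.id : TCo k V →ₗ[k] TCo k V) ∘ₗ
          TensorProduct.map (LinearMap.mulLeft k (ι k v)) LinearMap.id = 0 := by
        ext x y
        simp [counit_ι_mul]
      exact LinearMap.congr_fun h (decon x)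
  exact LinearMap.congr_fun this x

theorem decon_coassoc (x : TCo k V) :
    TensorProduct.assoc k (TCo k V) (TCo k V) (TCo k V)
      (TensorProduct.map decon LinearMap.id (decon x))
      = TensorProduct.map LinearMap.id decon (decon x) := by
  have : (TensorProduct.assoc k (TCo k V) (TCo k V) (TCo k V)).toLinearMap ∘ₗ
      TensorProduct.map decon LinearMap.id ∘ₗ decon
      = TensorProduct.map LinearMap.id decon ∘ₗ decon := by
    refine tco_rec_ext ?_ fun v x h => ?_
    · simp [decon_one]
    · simp only [LinearMap.comp_apply, decon_ι_mul, map_add, TensorProduct.map_tmul, decon_one,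
        LinearMap.id_apply, TensorProduct.tmul_add, LinearEquiv.coe_coe,
        TensorProduct.assoc_tmul] at h ⊢
      have h1 : (TensorProduct.assoc k (TCo k V) (TCo k V) (TCo k V)).toLinearMap ∘ₗ
          TensorProduct.map decon LinearMap.id ∘ₗ
          TensorProduct.map (LinearMap.mulLeft k (ι k v)) LinearMap.id
          = TensorProduct.mk k _ _ 1 ∘ₗ
              TensorProduct.map (LinearMap.mulLeft k (ι k v)) LinearMap.id
            + TensorProduct.map (LinearMap.mulLeft k (ι k v)) LinearMap.id ∘ₗ
              (TensorProduct.assoc k (TCo k V) (TCo k V) (TCo k V)).toLinearMap ∘ₗ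
              TensorProduct.map decon LinearMap.id := by
        ext x y
        simp only [TensorProduct.AlgebraTensorModule.curry_apply, LinearMap.restrictScalars_self,
          TensorProduct.curry_apply, LinearMap.comp_apply, TensorProduct.map_tmul,
          LinearMap.mulLeft_apply, LinearMap.id_apply, decon_ι_mul, TensorProduct.add_tmul,
          LinearEquiv.coe_coe, map_add, TensorProduct.assoc_tmul, LinearMap.add_apply,
          TensorProduct.mk_apply, add_right_inj]
        generalize decon x = z
        induction z using TensorProduct.induction_on with
        | zero => simp
        | tmul a b => simp
        | add a b ha hb => simp only [map_add, TensorProduct.add_tmul, ha, hb]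
      have h2 : TensorProduct.map LinearMap.id decon ∘ₗ
          TensorProduct.map (LinearMap.mulLeft k (ι k v)) (LinearMap.id : TCo k V →ₗ[k] TCo k V)
          = TensorProduct.map (LinearMap.mulLeft k (ι k v)) LinearMap.id ∘ₗ
            TensorProduct.map (LinearMap.id : TCo k V →ₗ[k] TCo k V) decon := by
        rw [← TensorProduct.map_comp, ← TensorProduct.map_comp]
        rfl
      have h1' := LinearMap.congr_fun h1 (decon x)
      have h2' := LinearMap.congr_fun h2 (decon x)
      simp only [LinearMap.comp_apply, LinearMap.add_apply, LinearEquiv.coe_coe,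
        TensorProduct.mk_apply] at h1' h2'
      rw [h1', h2', h, add_assoc]
  exact LinearMap.congr_fun this x

theorem decon_prefixExt (α : TCo k V →ₗ[k] V) (x : TCo k V) :
    decon (prefixExt LinearMap.id α x) = 1 ⊗ₜ[k] prefixExt LinearMap.id α x +
      TensorProduct.map (prefixExt LinearMap.id α) LinearMap.id (decon x) := by
  have hid : (tmap (LinearMap.id : V →ₗ[k] V)).toLinearMap = LinearMap.id :=
    tco_ext fun n v => by simp [map_word]
  have h1 : decon ∘ₗ LinearMap.mul' k (TCo k V) ∘ₗ
      TensorProduct.map (ι k ∘ₗ α) (LinearMap.id : TCo k V →ₗ[k] TCo k V)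
      = TensorProduct.mk k _ _ 1 ∘ₗ LinearMap.mul' k (TCo k V) ∘ₗ
          TensorProduct.map (ι k ∘ₗ α) (LinearMap.id : TCo k V →ₗ[k] TCo k V)
        + TensorProduct.map (LinearMap.mul' k (TCo k V)) LinearMap.id ∘ₗ
          (TensorProduct.assoc k (TCo k V) (TCo k V) (TCo k V)).symm.toLinearMap ∘ₗ
          TensorProduct.map (ι k ∘ₗ α) decon := by
    ext x y
    simp only [TensorProduct.AlgebraTensorModule.curry_apply, LinearMap.restrictScalars_self,
      TensorProduct.curry_apply, LinearMap.comp_apply, TensorProduct.map_tmul,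
      LinearMap.id_apply, LinearMap.mul'_apply, decon_ι_mul, LinearMap.add_apply,
      TensorProduct.mk_apply, add_right_inj, LinearEquiv.coe_coe]
    generalize decon y = z
    induction z using TensorProduct.induction_on with
    | zero => simp
    | tmul a b => simp
    | add a b ha hb => simp only [map_add, TensorProduct.tmul_add, ha, hb]
  have h2 : TensorProduct.map (LinearMap.mul' k (TCo k V)) LinearMap.id ∘ₗ
          (TensorProduct.assoc k (TCo k V) (TCo k V) (TCo k V)).symm.toLinearMap ∘ₗ
          TensorProduct.map (ι k ∘ₗ α) (LinearMap.id : (TCo k V ⊗[k] TCo k V) →ₗ[k] _) ∘ₗ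
          (TensorProduct.assoc k (TCo k V) (TCo k V) (TCo k V)).toLinearMap ∘ₗ
          TensorProduct.map decon LinearMap.id
      = TensorProduct.map (prefixExt LinearMap.id α) (LinearMap.id : TCo k V →ₗ[k] TCo k V) := by
    ext x y
    simp only [TensorProduct.AlgebraTensorModule.curry_apply, LinearMap.restrictScalars_self,
      TensorProduct.curry_apply, LinearMap.comp_apply, TensorProduct.map_tmul,
      LinearMap.id_apply, prefixExt, LinearEquiv.coe_coe, hid]
    generalize decon x = z
    induction z using TensorProduct.induction_on with
    | zero => simp
    | tmul a b => simp
    | add a b ha hb => simp only [map_add, TensorProduct.add_tmul, ha, hb]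
  have h3 := LinearMap.congr_fun h1 (decon x)
  have h4 := LinearMap.congr_fun h2 (decon x)
  simp only [LinearMap.comp_apply, LinearMap.add_apply, LinearEquiv.coe_coe,
    TensorProduct.mk_apply, decon_coassoc] at h3 h4
  rw [← h4]
  simp only [prefixExt, LinearMap.comp_apply, hid]
  rw [h3, TensorProduct.map_map, LinearMap.comp_id, LinearMap.id_comp]

/-- `D : T^{co}(V) → T^{co}(V)` satisfies the co-Leibniz rule of a coderivation of degree `n`:
`Δ D = (1 ⊗ D + D ⊗ 1) Δ`, with the Koszul sign `(1 ⊗ D)(x ⊗ y) = (-1)^{n |x|} x ⊗ D y`. -/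
def IsCoderivation (G : Grading k V) (n : ℤ) (D : TCo k V →ₗ[k] TCo k V) : Prop :=
  ∀ x, decon (D x) = TensorProduct.map (tmap (G.sgn n)).toLinearMap D (decon x) +
    TensorProduct.map D LinearMap.id (decon x)

theorem coext_isCoderivation (G : Grading k V) (n : ℤ) (α : TCo k V →ₗ[k] V) :
    IsCoderivation G n (coext G LinearMap.id n α) := by
  set D := coext G LinearMap.id n α with hD
  have : decon ∘ₗ D = TensorProduct.map (tmap (G.sgn n)).toLinearMap D ∘ₗ decon +
      TensorProduct.map D LinearMap.id ∘ₗ decon := by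
    refine tco_rec_ext ?_ fun v x h => ?_
    · simp [hD, coext_one, decon_one, decon_ι]
    · simp only [LinearMap.comp_apply, LinearMap.add_apply] at h ⊢
      have e1 : TensorProduct.map (tmap (G.sgn n)).toLinearMap D ∘ₗ
          TensorProduct.map (LinearMap.mulLeft k (ι k v)) LinearMap.id
          = TensorProduct.map (LinearMap.mulLeft k (ι k (G.sgn n v))) LinearMap.id ∘ₗ
            TensorProduct.map (tmap (G.sgn n)).toLinearMap D := by
        ext x y
        simp [tmap_ι]
      have e2 : TensorProduct.map D LinearMap.id ∘ₗ
          TensorProduct.map (LinearMap.mulLeft k (ι k v)) LinearMap.id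
          = TensorProduct.map (prefixExt LinearMap.id α) LinearMap.id ∘ₗ
              TensorProduct.map (LinearMap.mulLeft k (ι k v))
              (LinearMap.id : TCo k V →ₗ[k] TCo k V)
            + TensorProduct.map (LinearMap.mulLeft k (ι k (G.sgn n v))) LinearMap.id ∘ₗ
            TensorProduct.map D LinearMap.id := by
        ext x y
        simp [hD, coext_ι_mul, TensorProduct.add_tmul]
      have e1' := LinearMap.congr_fun e1 (decon x)
      have e2' := LinearMap.congr_fun e2 (decon x)
      simp only [LinearMap.comp_apply, LinearMap.add_apply] at e1' e2'
      have hp1 : prefixExt LinearMap.id α (1 : TCo k V) = ι k (α 1) := by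
        simp [prefixExt, decon_one]
      rw [hD, coext_ι_mul, ← hD, map_add, decon_prefixExt, LinearMap.id_apply, decon_ι_mul,
        decon_ι_mul, h]
      simp only [map_add, TensorProduct.map_tmul, map_one, LinearMap.id_apply, e1', e2',
        AlgHom.toLinearMap_apply, hp1]
      have hD1 : D 1 = ι k (α 1) := coext_one _ _ _ _
      have hDv : D (ι k v * x) = prefixExt LinearMap.id α (ι k v * x)
        + ι k (G.sgn n v) * D x := coext_ι_mul _ _ _ _ _ _
      rw [hD1, hDv, TensorProduct.tmul_add]
      abel
  exact LinearMap.congr_fun this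

theorem prefixExt_proj (x : TCo k V) :
    x = counit x • 1 + prefixExt LinearMap.id proj x := by
  have : (LinearMap.id : TCo k V →ₗ[k] TCo k V) = (counit : TCo k V →ₗ[k] k).smulRight 1 +
      prefixExt LinearMap.id proj := by
    refine tco_rec_ext ?_ fun v x _ => ?_
    · simp [prefixExt, decon_one, counit_one, proj_one]
    · have hid : (tmap (LinearMap.id : V →ₗ[k] V)).toLinearMap = LinearMap.id :=
        tco_ext fun n v => by simp [map_word]
      have e : LinearMap.mul' k (TCo k V) ∘ₗ TensorProduct.map (ι k ∘ₗ proj) LinearMap.id ∘ₗ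
          TensorProduct.map (LinearMap.mulLeft k (ι k v)) LinearMap.id
          = LinearMap.mulLeft k (ι k v) ∘ₗ (TensorProduct.lid k (TCo k V)).toLinearMap ∘ₗ
            TensorProduct.map counit LinearMap.id := by
        ext x y
        simp [proj_ι_mul]
      have e' := LinearMap.congr_fun e (decon x)
      simp only [LinearMap.comp_apply, decon_counit, LinearEquiv.coe_coe, TensorProduct.lid_tmul,
        one_smul, LinearMap.mulLeft_apply] at e'
      simp [prefixExt, decon_ι_mul, counit_ι_mul, hid, proj_one, e']
  exact LinearMap.congr_fun this x

theorem decon_counit' (x : TCo k V) :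
    TensorProduct.map LinearMap.id (counit : TCo k V →ₗ[k] k) (decon x) = x ⊗ₜ[k] 1 := by
  have : TensorProduct.map LinearMap.id (counit : TCo k V →ₗ[k] k) ∘ₗ decon
      = (TensorProduct.mk k (TCo k V) k).flip 1 := by
    refine tco_rec_ext ?_ fun v x h => ?_
    · simp [decon_one, counit_one]
    · simp only [LinearMap.comp_apply, LinearMap.flip_apply, TensorProduct.mk_apply] at h ⊢
      have h' := congrArg (TensorProduct.map (LinearMap.mulLeft k (ι k v)) LinearMap.id) h
      simp only [TensorProduct.map_map, TensorProduct.map_tmul, LinearMap.comp_id,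
        LinearMap.id_comp, LinearMap.mulLeft_apply, LinearMap.id_apply] at h'
      simp [decon_ι_mul, counit_ι_mul, TensorProduct.map_map, h']
  exact LinearMap.congr_fun this x

theorem counit_tmap {W : Type w} [AddCommGroup W] [Module k W] (g : V →ₗ[k] W) :
    (counit : TCo k W →ₗ[k] k) ∘ₗ (tmap g).toLinearMap = counit := by
  refine tco_rec_ext (by simp [counit_one]) fun v x _ => ?_
  simp [tmap_ι, counit_ι_mul]

theorem IsCoderivation.counit_eq_zero {G : Grading k V} {n : ℤ} {D : TCo k V →ₗ[k] TCo k V}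
    (hD : IsCoderivation G n D) (x : TCo k V) : counit (D x) = 0 := by
  have h := congrArg (TensorProduct.map counit counit) (hD x)
  have e0 : ∀ z : TCo k V ⊗[k] TCo k V, TensorProduct.map (counit : TCo k V →ₗ[k] k)
      (counit : TCo k V →ₗ[k] k) z
      = TensorProduct.map LinearMap.id counit (TensorProduct.map counit LinearMap.id z) := by
    intro z
    rw [TensorProduct.map_map, LinearMap.comp_id, LinearMap.id_comp]
  have e1 : ∀ z : TCo k V ⊗[k] TCo k V, TensorProduct.map (counit : TCo k V →ₗ[k] k)
      ((counit : TCo k V →ₗ[k] k) ∘ₗ D) z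
      = TensorProduct.map LinearMap.id (counit ∘ₗ D)
        (TensorProduct.map counit LinearMap.id z) := by
    intro z
    rw [TensorProduct.map_map, LinearMap.comp_id, LinearMap.id_comp]
  have e2 : ∀ z : TCo k V ⊗[k] TCo k V, TensorProduct.map ((counit : TCo k V →ₗ[k] k) ∘ₗ D)
      (counit : TCo k V →ₗ[k] k) z
      = TensorProduct.map (counit ∘ₗ D) LinearMap.id
        (TensorProduct.map LinearMap.id counit z) := by
    intro z
    rw [TensorProduct.map_map, LinearMap.comp_id, LinearMap.id_comp]
  rw [map_add, e0, decon_counit, TensorProduct.map_map, TensorProduct.map_map, LinearMap.comp_id,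
    counit_tmap, e1, e2, decon_counit, decon_counit'] at h
  have h' := congrArg (TensorProduct.lid k k) h
  simpa using h'

theorem IsCoderivation.eq_zero {G : Grading k V} {n : ℤ} {D : TCo k V →ₗ[k] TCo k V}
    (hD : IsCoderivation G n D) (h : ∀ x, proj (D x) = 0) : D = 0 := by
  have key : ∀ x, D x = LinearMap.mul' k (TCo k V)
      (TensorProduct.map (ι k ∘ₗ proj ∘ₗ (tmap (G.sgn n)).toLinearMap) D (decon x)) := by
    intro x
    have hid : (tmap (LinearMap.id : V →ₗ[k] V)).toLinearMap = LinearMap.id :=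
        tco_ext fun n v => by simp [map_word]
    conv_lhs => rw [prefixExt_proj (D x), hD.counit_eq_zero, zero_smul, zero_add]
    simp only [prefixExt, LinearMap.comp_apply, hD x, map_add, hid]
    have e1 : (proj : TCo k V →ₗ[k] V) ∘ₗ D = 0 := LinearMap.ext h
    rw [TensorProduct.map_map, TensorProduct.map_map,
      LinearMap.comp_assoc, LinearMap.comp_assoc, e1]
    simp
  refine tco_rec_ext ?_ fun v x hx => ?_
  · rw [key]
    simp [decon_one, proj_one]
  · rw [key, decon_ι_mul]
    have e : LinearMap.mul' k (TCo k V) ∘ₗ TensorProduct.map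
          (ι k ∘ₗ proj ∘ₗ (tmap (G.sgn n)).toLinearMap) D ∘ₗ
          TensorProduct.map (LinearMap.mulLeft k (ι k v)) LinearMap.id
          = LinearMap.mulLeft k (ι k (G.sgn n v)) ∘ₗ
            (TensorProduct.lid k (TCo k V)).toLinearMap ∘ₗ
            TensorProduct.map LinearMap.id D ∘ₗ TensorProduct.map counit LinearMap.id := by
      ext x y
      have hcx := LinearMap.congr_fun (counit_tmap (G.sgn n)) x
      simp only [LinearMap.comp_apply, AlgHom.toLinearMap_apply] at hcx
      simp [tmap_ι, proj_ι_mul, hcx]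
    have e' := LinearMap.congr_fun e (decon x)
    simp only [LinearMap.comp_apply, decon_counit] at e'
    rw [map_add, map_add, e']
    simp [proj_one, hx]

theorem proj_prefixExt (α : TCo k V →ₗ[k] V) (x : TCo k V) :
    proj (prefixExt LinearMap.id α x) = α x := by
  have e : (proj : TCo k V →ₗ[k] V) ∘ₗ LinearMap.mul' k (TCo k V) ∘ₗ
      TensorProduct.map (ι k ∘ₗ α) (tmap (LinearMap.id : V →ₗ[k] V)).toLinearMap
      = (TensorProduct.rid k V).toLinearMap ∘ₗ TensorProduct.map α LinearMap.id ∘ₗ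
        TensorProduct.map LinearMap.id counit := by
    ext x y
    have := LinearMap.congr_fun (counit_tmap (LinearMap.id : V →ₗ[k] V)) y
    simp only [LinearMap.comp_apply, AlgHom.toLinearMap_apply] at this
    simp [proj_ι_mul, this]
  have e' := LinearMap.congr_fun e (decon x)
  simp only [LinearMap.comp_apply, decon_counit'] at e'
  simpa [prefixExt] using e'

theorem proj_coext (G : Grading k V) (n : ℤ) (α : TCo k V →ₗ[k] V) (x : TCo k V) :
    proj (coext G LinearMap.id n α x) = α x := by
  have : (proj : TCo k V →ₗ[k] V) ∘ₗ coext G LinearMap.id n α = α := by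
    refine tco_rec_ext ?_ fun v x _ => ?_
    · simp [coext_one, proj_ι]
    · simp only [LinearMap.comp_apply, coext_ι_mul, map_add, proj_prefixExt, proj_ι_mul,
        (coext_isCoderivation G n α).counit_eq_zero]
      simp
  exact LinearMap.congr_fun this x

theorem IsCoderivation.eq_coext {G : Grading k V} {n : ℤ} {D : TCo k V →ₗ[k] TCo k V}
    (hD : IsCoderivation G n D) : D = coext G LinearMap.id n (proj ∘ₗ D) := by
  set E := coext G LinearMap.id n (proj ∘ₗ D) with hE
  have h : IsCoderivation G n (D - E) := by
    intro x
    have h1 : ∀ z : TCo k V ⊗[k] TCo k V, TensorProduct.map (D - E) LinearMap.id z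
        = TensorProduct.map D LinearMap.id z - TensorProduct.map E LinearMap.id z := by
      intro z
      rw [eq_sub_iff_add_eq, ← LinearMap.add_apply, ← TensorProduct.map_add_left, sub_add_cancel]
    have h2 : ∀ z : TCo k V ⊗[k] TCo k V,
        TensorProduct.map (tmap (G.sgn n)).toLinearMap (D - E) z
        = TensorProduct.map (tmap (G.sgn n)).toLinearMap D z
          - TensorProduct.map (tmap (G.sgn n)).toLinearMap E z := by
      intro z
      rw [eq_sub_iff_add_eq, ← LinearMap.add_apply, ← TensorProduct.map_add_right, sub_add_cancel]
    rw [LinearMap.sub_apply, map_sub, hD x, coext_isCoderivation G n _ x, h1, h2]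
    abel
  exact sub_eq_zero.1 (h.eq_zero fun x => by simp [hE, proj_coext])

/-- A linear map out of the tensor coalgebra commutes, up to the Koszul sign, with the sign
operators: this holds for homogeneous maps of degree `n`. -/
def SgnComm (G : Grading k V) (n : ℤ) (D : TCo k V →ₗ[k] TCo k V) : Prop :=
  ∀ (m : ℤ) (x : TCo k V), tmap (G.sgn m) (D x) = (-1 : k) ^ (m * n) • D (tmap (G.sgn m) x)

theorem coext_sgnComm (G : Grading k V) {n : ℤ} {α : TCo k V →ₗ[k] V}
    (hα : ∀ (m : ℤ) (x : TCo k V), G.sgn m (α x) = (-1 : k) ^ (m * n) • α (tmap (G.sgn m) x)) :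
    SgnComm G n (coext G LinearMap.id n α) := by
  intro m x
  have : (tmap (G.sgn m)).toLinearMap ∘ₗ coext G LinearMap.id n α =
      ((-1 : k) ^ (m * n)) • (coext G LinearMap.id n α ∘ₗ (tmap (G.sgn m)).toLinearMap) := by
    refine tco_ext fun N v => ?_
    simp only [LinearMap.comp_apply, LinearMap.smul_apply, AlgHom.toLinearMap_apply, map_word,
      coext_word', map_sum, map_mul, tmap_ι, Finset.smul_sum, hα, LinearMap.id_apply, map_smul]
    refine Finset.sum_congr rfl fun p _ => Finset.sum_congr rfl fun q _ => ?_
    simp only [Grading.sgn_sgn, add_comm m n, smul_mul_assoc, mul_smul_comm]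
  exact LinearMap.congr_fun this x

theorem tmap_sgn_sgn (G : Grading k V) (m n : ℤ) :
    (tmap (G.sgn m)).toLinearMap ∘ₗ (tmap (G.sgn n)).toLinearMap
      = (tmap (G.sgn (m + n))).toLinearMap :=
  tco_ext fun N v => by simp [map_word, Grading.sgn_sgn]

/-- The graded commutator of two coderivations is a coderivation. -/
theorem IsCoderivation.commutator {G : Grading k V} {m n : ℤ} {D E : TCo k V →ₗ[k] TCo k V}
    (hD : IsCoderivation G m D) (hE : IsCoderivation G n E) (hD' : SgnComm G m D)
    (hE' : SgnComm G n E) :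
    IsCoderivation G (m + n) (D ∘ₗ E - (-1 : k) ^ (m * n) • (E ∘ₗ D)) := by
  intro x
  have c1 : (tmap (G.sgn n)).toLinearMap ∘ₗ D
      = (-1 : k) ^ (m * n) • (D ∘ₗ (tmap (G.sgn n)).toLinearMap) :=
    LinearMap.ext fun y => by
      have := hD' n y
      rw [mul_comm n m] at this
      exact this
  have c2 : (tmap (G.sgn m)).toLinearMap ∘ₗ E
      = (-1 : k) ^ (m * n) • (E ∘ₗ (tmap (G.sgn m)).toLinearMap) :=
    LinearMap.ext fun y => hE' m y
  have hsq : (-1 : k) ^ (m * n) * (-1 : k) ^ (m * n) = 1 := by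
    rw [← zpow_add₀ (by simp), Even.neg_one_zpow ⟨_, rfl⟩]
  have e1 : (TensorProduct.map (tmap (G.sgn (m + n))).toLinearMap
        (D ∘ₗ E - (-1 : k) ^ (m * n) • (E ∘ₗ D))
      + TensorProduct.map (D ∘ₗ E - (-1 : k) ^ (m * n) • (E ∘ₗ D)) LinearMap.id :
        (TCo k V ⊗[k] TCo k V) →ₗ[k] _)
      = (TensorProduct.map (tmap (G.sgn m)).toLinearMap D + TensorProduct.map D LinearMap.id) ∘ₗ
        (TensorProduct.map (tmap (G.sgn n)).toLinearMap E + TensorProduct.map E LinearMap.id)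
        - (-1 : k) ^ (m * n) •
        ((TensorProduct.map (tmap (G.sgn n)).toLinearMap E + TensorProduct.map E LinearMap.id) ∘ₗ
        (TensorProduct.map (tmap (G.sgn m)).toLinearMap D + TensorProduct.map D LinearMap.id)) := by
    refine TensorProduct.ext' fun a b => ?_
    have s1 := LinearMap.congr_fun (tmap_sgn_sgn G m n) a
    have s2 := LinearMap.congr_fun (tmap_sgn_sgn G n m) a
    rw [add_comm n m] at s2
    have c1' := LinearMap.congr_fun c1 a
    have c2' := LinearMap.congr_fun c2 a
    simp only [LinearMap.comp_apply, LinearMap.smul_apply, AlgHom.toLinearMap_apply] at s1 s2 c1' c2'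
    simp only [LinearMap.add_apply, LinearMap.sub_apply, LinearMap.smul_apply,
      LinearMap.comp_apply, TensorProduct.map_tmul, AlgHom.toLinearMap_apply, LinearMap.id_apply,
      map_add, s1, s2, c1', c2', TensorProduct.tmul_sub, TensorProduct.sub_tmul,
      TensorProduct.smul_tmul', TensorProduct.tmul_smul, smul_add, smul_smul, hsq, one_smul]
    abel
  have e1' := LinearMap.congr_fun e1 (decon x)
  simp only [LinearMap.add_apply, LinearMap.comp_apply, LinearMap.sub_apply,
    LinearMap.smul_apply] at e1'
  rw [e1']
  simp only [LinearMap.sub_apply, LinearMap.comp_apply, LinearMap.smul_apply, map_sub, map_smul]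
  rw [hD (E x), hE (D x), hE x, hD x]

theorem IsCoderivation.sq {G : Grading k V} {n : ℤ} {D : TCo k V →ₗ[k] TCo k V}
    (hn : Odd n) (hD : IsCoderivation G n D) (hD' : SgnComm G n D)
    (h : ∀ x, proj (D (D x)) = 0) : D ∘ₗ D = 0 := by
  have hs : IsCoderivation G (n + n) (D ∘ₗ D) := by
    intro x
    have c1 : (tmap (G.sgn n)).toLinearMap ∘ₗ D = - (D ∘ₗ (tmap (G.sgn n)).toLinearMap) :=
      LinearMap.ext fun y => by
        have := hD' n y
        rwa [Odd.neg_one_zpow (hn.mul hn), neg_one_smul] at this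
    have e1 : (TensorProduct.map (tmap (G.sgn (n + n))).toLinearMap (D ∘ₗ D)
        + TensorProduct.map (D ∘ₗ D) LinearMap.id : (TCo k V ⊗[k] TCo k V) →ₗ[k] _)
        = (TensorProduct.map (tmap (G.sgn n)).toLinearMap D + TensorProduct.map D LinearMap.id) ∘ₗ
          (TensorProduct.map (tmap (G.sgn n)).toLinearMap D
            + TensorProduct.map D LinearMap.id) := by
      refine TensorProduct.ext' fun a b => ?_
      have s1 := LinearMap.congr_fun (tmap_sgn_sgn G n n) a
      have c1' := LinearMap.congr_fun c1 a
      simp only [LinearMap.comp_apply, LinearMap.neg_apply, AlgHom.toLinearMap_apply] at s1 c1'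
      simp only [LinearMap.add_apply, LinearMap.comp_apply, TensorProduct.map_tmul,
        AlgHom.toLinearMap_apply, LinearMap.id_apply, map_add, s1, c1', TensorProduct.neg_tmul]
      abel
    have e1' := LinearMap.congr_fun e1 (decon x)
    simp only [LinearMap.add_apply, LinearMap.comp_apply] at e1'
    rw [e1', LinearMap.comp_apply, hD (D x), hD x, map_add, map_add]
  exact hs.eq_zero h

end Coderivations

/-! ### Augmented `A_∞`-algebras and the bar construction -/

/-- An augmented, strictly unital `A_∞`-algebra over `k`: a graded vector space with operations
`m n : A^{⊗ n} → A` of degree `2 - n` for `n ≥ 1`, where `m 1` is the differential, satisfying the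
Stasheff identities `∑_{r+s+t=n} (-1)^{rs+t} m_{r+1+t} (1^{⊗ r} ⊗ m_s ⊗ 1^{⊗ t}) = 0`, a strict
unit of degree `0`, and an augmentation compatible with all the operations. Sequences `ℕ → A` are
used to list the arguments (only the first `n` of them matter), and `m 0 = 0` by convention. -/
structure AInfinityAlgebra (k : Type u) [Field k] where
  carrier : Type v
  [addCommGroup : AddCommGroup carrier]
  [module : Module k carrier]
  grading : Grading k carrier
  m : ∀ n : ℕ, MultilinearMap k (fun _ : Fin n => carrier) carrier
  m_zero : m 0 = 0
  m_degree : ∀ (n : ℕ) (p : Fin n → ℤ) (a : Fin n → carrier), (∀ i, a i ∈ grading.gr (p i)) →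
    m n a ∈ grading.gr (∑ i, p i + 2 - n)
  /-- the sum is over `r = p.1`, `s = q.1`, `t = q.2`; `sgn` is the Koszul sign for moving `m_s`
  past the first `r` arguments -/
  stasheff : ∀ (n : ℕ) (a : ℕ → carrier),
    ∑ p ∈ Finset.HasAntidiagonal.antidiagonal n, ∑ q ∈ Finset.HasAntidiagonal.antidiagonal p.2,
      (-1 : k) ^ (p.1 * q.1 + q.2) • m (p.1 + 1 + q.2) (fun i =>
        if (i : ℕ) < p.1 then grading.sgn (2 - q.1) (a i)
        else if (i : ℕ) = p.1 then m q.1 (fun j => a (p.1 + j))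
        else a (i + q.1 - 1)) = 0
  one : carrier
  one_mem : one ∈ grading.gr 0
  one_m : ∀ a, m 2 ![one, a] = a
  m_one : ∀ a, m 2 ![a, one] = a
  m_unit : ∀ (n : ℕ), n ≠ 2 → ∀ a : Fin n → carrier, (∃ i, a i = one) → m n a = 0
  aug : carrier →ₗ[k] k
  aug_degree : ∀ p, p ≠ 0 → ∀ a ∈ grading.gr p, aug a = 0
  aug_one : aug one = 1
  aug_m_two : ∀ a b, aug (m 2 ![a, b]) = aug a * aug b
  aug_m : ∀ (n : ℕ), n ≠ 2 → ∀ a : Fin n → carrier, aug (m n a) = 0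

attribute [instance] AInfinityAlgebra.addCommGroup AInfinityAlgebra.module

namespace AInfinityAlgebra

variable {k : Type u} [Field k] (A : AInfinityAlgebra.{u, v} k)

/-- The differential `m 1`. -/
def d : A.carrier →ₗ[k] A.carrier :=
  (MultilinearMap.ofSubsingleton k A.carrier A.carrier (0 : Fin 1)).symm (A.m 1)

theorem d_apply (a : A.carrier) : A.d a = A.m 1 fun _ => a := rfl

/-- An `A_∞`-algebra is minimal if its differential vanishes. -/
def IsMinimal : Prop := A.d = 0

/-- The augmentation ideal `Ā`. -/
abbrev augIdeal : Submodule k A.carrier := LinearMap.ker A.aug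

/-- The grading of `Ā`. -/
def augGrading : Grading k A.augIdeal := A.grading.kerFunctional A.aug A.aug_degree

/-- The grading of the suspension `sĀ`. -/
def barGrading : Grading k A.augIdeal := A.augGrading.shift

/-- The maps `b_n = - s m_n (s⁻¹)^{⊗ n} : (sA)^{⊗ n} → sA`, assembled to a map `T^{co}(sA) → sA`.
Moving the `n` copies of `s⁻¹`, of degree one, into place produces the Koszul sign
`(-1)^{∑ᵢ (n - 1 - i) |s aᵢ|}`, where `i = 0, …, n - 1`. -/
def barOp : TCo k A.carrier →ₗ[k] A.carrier :=
  ofFamily fun n => -(A.m n).compLinearMap fun i : Fin n => A.grading.shift.sgn (n - 1 - i)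

theorem barOp_word (n : ℕ) (a : ℕ → A.carrier) :
    A.barOp (word k n a) = - A.m n fun i => A.grading.shift.sgn (n - 1 - i) (a i) := by
  rw [barOp, ofFamily_word]
  rfl

theorem aug_sgn (n : ℤ) (a : A.carrier) : A.aug (A.grading.sgn n a) = A.aug a := by
  refine LinearMap.congr_fun (A.grading.linear_ext (f := A.aug ∘ₗ A.grading.sgn n)
    fun p v hv => ?_) a
  rw [LinearMap.comp_apply, Grading.sgn_of_mem _ _ hv, map_smul]
  by_cases hp : p = 0
  · simp [hp]
  · simp [A.aug_degree p hp v hv]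

theorem aug_barOp (x : TCo k A.augIdeal) : A.aug (A.barOp (tmap A.augIdeal.subtype x)) = 0 := by
  have : A.aug ∘ₗ A.barOp ∘ₗ (tmap A.augIdeal.subtype).toLinearMap = 0 := by
    refine tco_ext fun n v => ?_
    simp only [LinearMap.comp_apply, AlgHom.toLinearMap_apply, map_word, barOp_word, map_neg,
      LinearMap.zero_apply, neg_eq_zero]
    by_cases hn : n = 2
    · subst hn
      have e : ∀ f : Fin 2 → A.carrier, f = ![f 0, f 1] := fun f => by
        ext i; fin_cases i <;> rfl
      rw [e (fun i : Fin 2 => _), aug_m_two]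
      simp only [Grading.sgn_shift, map_smul, aug_sgn]
      have := (v 0).2
      rw [LinearMap.mem_ker] at this
      simp [this]
    · exact A.aug_m n hn _
  exact LinearMap.congr_fun this x

/-- The restriction of `barOp` to `T^{co}(sĀ) → sĀ`. -/
def redBarOp : TCo k A.augIdeal →ₗ[k] A.augIdeal :=
  (A.barOp ∘ₗ (tmap A.augIdeal.subtype).toLinearMap).codRestrict A.augIdeal fun x =>
    LinearMap.mem_ker.2 (A.aug_barOp x)

/-- The differential `b` of the bar construction `BA = T^{co}(sĀ)`: the coderivation of degree `1`
cogenerated by the maps `b_n`. -/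
def barDiff : TCo k A.augIdeal →ₗ[k] TCo k A.augIdeal :=
  coext A.barGrading LinearMap.id 1 A.redBarOp

theorem coe_redBarOp (x : TCo k A.augIdeal) :
    (A.redBarOp x : A.carrier) = A.barOp (tmap A.augIdeal.subtype x) := rfl

theorem coe_barGrading_sgn (n : ℤ) (a : A.augIdeal) :
    (A.barGrading.sgn n a : A.carrier) = A.grading.shift.sgn n a := by
  refine LinearMap.congr_fun (A.barGrading.linear_ext
    (f := A.augIdeal.subtype ∘ₗ A.barGrading.sgn n)
    (g := A.grading.shift.sgn n ∘ₗ A.augIdeal.subtype) fun p v hv => ?_) a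
  have hv' : (v : A.carrier) ∈ A.grading.shift.gr p := hv
  simp only [LinearMap.comp_apply, Submodule.subtype_apply]
  rw [Grading.sgn_of_mem _ _ hv, Grading.sgn_of_mem _ _ hv']
  rfl

theorem m_shift_sgn (e : ℤ) (n : ℕ) (a : Fin n → A.carrier) :
    A.m n (fun i => A.grading.shift.sgn e (a i)) =
      (-1 : k) ^ e • A.grading.shift.sgn e (A.m n a) := by
  have : (A.m n).compLinearMap (fun _ => A.grading.shift.sgn e)
      = (-1 : k) ^ e • (A.grading.shift.sgn e).compMultilinearMap (A.m n) := by
    refine A.grading.shift.multilinear_ext fun p v hv => ?_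
    have h1 := A.m_degree n (fun i => p i + 1) v hv
    have h2 : A.m n v ∈ A.grading.shift.gr (∑ i, p i + 1) := by
      rw [Grading.mem_shift]
      convert h1 using 2
      simp [Finset.sum_add_distrib]
      ring
    simp only [MultilinearMap.compLinearMap_apply, smul_apply,
      LinearMap.compMultilinearMap_apply, fun i => Grading.sgn_of_mem _ e (hv i),
      Grading.sgn_of_mem _ e h2, MultilinearMap.map_smul_univ, smul_smul]
    congr 1
    rw [mul_add, mul_one, zpow_add₀ (by simp), mul_comm, mul_assoc, ← zpow_add₀ (by simp),
      Even.neg_one_zpow (show Even (e + e) from ⟨_, rfl⟩), mul_one, Finset.mul_sum]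
    induction (Finset.univ : Finset (Fin n)) using Finset.induction_on with
    | empty => simp
    | insert i s hi ih => rw [Finset.prod_insert hi, Finset.sum_insert hi, zpow_add₀ (by simp), ih]
  exact DFunLike.congr_fun this a

theorem barOp_sgn (e : ℤ) (x : TCo k A.carrier) :
    A.grading.shift.sgn e (A.barOp x) = (-1 : k) ^ e • A.barOp (tmap (A.grading.shift.sgn e) x) := by
  have : A.grading.shift.sgn e ∘ₗ A.barOp
      = (-1 : k) ^ e • (A.barOp ∘ₗ (tmap (A.grading.shift.sgn e)).toLinearMap) := by
    refine tco_ext fun n v => ?_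
    simp only [LinearMap.comp_apply, LinearMap.smul_apply, AlgHom.toLinearMap_apply, map_word,
      barOp_word, map_neg, Grading.sgn_sgn]
    have h := A.m_shift_sgn e n (fun i => A.grading.shift.sgn (n - 1 - i) (v i))
    simp only [Grading.sgn_sgn] at h
    simp only [fun i : Fin n => add_comm ((n : ℤ) - 1 - i) e, h, smul_neg, smul_smul]
    rw [← zpow_add₀ (by simp), Even.neg_one_zpow ⟨_, rfl⟩, one_smul]
  exact LinearMap.congr_fun this x

theorem redBarOp_sgn (e : ℤ) (x : TCo k A.augIdeal) :
    A.barGrading.sgn e (A.redBarOp x) =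
      (-1 : k) ^ (e * 1) • A.redBarOp (tmap (A.barGrading.sgn e) x) := by
  refine Subtype.ext ?_
  rw [coe_barGrading_sgn, coe_redBarOp, barOp_sgn, mul_one, Submodule.coe_smul, coe_redBarOp]
  congr 2
  have : (tmap (A.grading.shift.sgn e)).toLinearMap ∘ₗ (tmap A.augIdeal.subtype).toLinearMap
      = (tmap A.augIdeal.subtype).toLinearMap ∘ₗ (tmap (A.barGrading.sgn e)).toLinearMap :=
    tco_ext fun n v => by simp [map_word, coe_barGrading_sgn]
  exact LinearMap.congr_fun this x

theorem prod_fin_ite (r t : ℕ) (a b : k) :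
    ∏ i : Fin (r + 1 + t), (if (i : ℕ) < r then a else if (i : ℕ) = r then b else 1)
      = a ^ r * b := by
  rw [Fin.prod_univ_eq_prod_range (fun i => if i < r then a else if i = r then b else 1)]
  induction t with
  | zero =>
    rw [add_zero, Finset.prod_range_succ, Finset.prod_congr rfl
      (fun i hi => if_pos (Finset.mem_range.1 hi))]
    simp
  | succ t ih =>
    rw [← add_assoc, Finset.prod_range_succ, ih, if_neg (by omega), if_neg (by omega), mul_one]

theorem barOp_coext_word (N : ℕ) (v : ℕ → A.carrier) :
    A.barOp (coext A.grading.shift LinearMap.id 1 A.barOp (word k N v)) = 0 := by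
  rw [coext_word, map_sum]
  rw [← A.stasheff N (fun i => A.grading.shift.sgn (N - 1 - i) (v i))]
  refine Finset.sum_congr rfl fun p hp => ?_
  rw [map_sum]
  refine Finset.sum_congr rfl fun q hq => ?_
  obtain ⟨r, q'⟩ := p
  obtain ⟨s, t⟩ := q
  simp only [Finset.HasAntidiagonal.mem_antidiagonal] at hp hq
  subst hq
  subst hp
  simp only [barOp_word, LinearMap.id_apply]
  set L : Fin (r + 1 + t) → A.carrier := fun i =>
    A.grading.shift.sgn (((r + 1 + t : ℕ) : ℤ) - 1 - i)
      (if (i : ℕ) < r then A.grading.shift.sgn 1 (v i)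
        else if (i : ℕ) = r then
          - A.m s fun j : Fin s => A.grading.shift.sgn ((s : ℤ) - 1 - j) (v (r + j))
        else v (i + s - 1)) with hL
  have hR : (fun i : Fin (r + 1 + t) =>
      if (i : ℕ) < r then A.grading.sgn (2 - s)
        (A.grading.shift.sgn (((r + (s + t) : ℕ) : ℤ) - 1 - (i : ℕ)) (v i))
      else if (i : ℕ) = r then A.m s fun j : Fin s =>
        A.grading.shift.sgn (((r + (s + t) : ℕ) : ℤ) - 1 - ((r + j : ℕ) : ℤ)) (v (r + j))
      else A.grading.shift.sgn (((r + (s + t) : ℕ) : ℤ) - 1 - ((i + s - 1 : ℕ) : ℤ))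
        (v (i + s - 1)))
      = fun i : Fin (r + 1 + t) => (if (i : ℕ) < r then (-1 : k) ^ s else if (i : ℕ) = r then -(-1 : k) ^ t else 1)
        • L i := by
    ext i
    simp only [hL]
    have h2 : ∀ (a b : ℤ) (x : A.carrier), Even (a - b) →
        A.grading.shift.sgn a x = A.grading.shift.sgn b x := by
      intro a b x hab
      rw [show a = (a - b) + b by ring, ← Grading.sgn_sgn, Grading.sgn_even _ hab]
    split_ifs with h h'
    · have h3 : ∀ x, A.grading.sgn (2 - (s : ℤ)) x
          = (-1 : k) ^ s • A.grading.shift.sgn (2 - (s : ℤ)) x := by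
        intro x
        rw [Grading.sgn_shift, smul_smul, ← zpow_natCast, ← zpow_add₀ (by simp),
          Even.neg_one_zpow (by simp), one_smul]
      rw [h3, Grading.sgn_sgn, Grading.sgn_sgn]
      congr 1
      exact h2 _ _ _ (by push_cast; ring_nf; simp)
    · have h4 := A.m_shift_sgn t s fun j => A.grading.shift.sgn ((s : ℤ) - 1 - j) (v (r + j))
      simp only [Grading.sgn_sgn, zpow_natCast] at h4
      have h5 : (fun j : Fin s => A.grading.shift.sgn
          (((r + (s + t) : ℕ) : ℤ) - 1 - ((r + j : ℕ) : ℤ)) (v (r + j)))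
          = fun j : Fin s => A.grading.shift.sgn ((t : ℤ) + ((s : ℤ) - 1 - j)) (v (r + j)) := by
        ext j
        congr 2
        push_cast
        ring
      rw [h5, h4, h', map_neg, smul_neg, neg_smul, neg_neg]
      congr 3
      push_cast
      ring
    · rw [one_smul]
      congr 2
      have : 1 ≤ (i : ℕ) + s := by omega
      push_cast [Nat.cast_sub this]
      ring
  rw [hR, MultilinearMap.map_smul_univ, prod_fin_ite, smul_smul, ← neg_one_smul k]
  congr 1
  rw [← pow_mul, mul_neg, mul_comm s r, ← pow_add, mul_neg, ← pow_add,
    Even.neg_one_pow (show Even (r * s + t + (r * s + t)) from ⟨_, rfl⟩)]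

theorem barDiff_sgnComm : SgnComm A.barGrading 1 A.barDiff :=
  coext_sgnComm _ A.redBarOp_sgn

theorem barDiff_isCoderivation : IsCoderivation A.barGrading 1 A.barDiff :=
  coext_isCoderivation _ _ _

theorem barDiff_sq : A.barDiff ∘ₗ A.barDiff = 0 := by
  refine A.barDiff_isCoderivation.sq odd_one A.barDiff_sgnComm fun x => ?_
  rw [barDiff, proj_coext]
  refine Subtype.ext ?_
  have h : (tmap A.augIdeal.subtype).toLinearMap ∘ₗ
      coext A.barGrading LinearMap.id 1 A.redBarOp
      = coext A.grading.shift LinearMap.id 1 A.barOp ∘ₗ (tmap A.augIdeal.subtype).toLinearMap := by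
    refine tco_ext fun n v => ?_
    simp only [LinearMap.comp_apply, AlgHom.toLinearMap_apply, coext_word', map_word, map_sum,
      map_mul, tmap_ι, Submodule.subtype_apply, coe_redBarOp, LinearMap.id_apply,
      coe_barGrading_sgn]
  have h2 : A.barOp ∘ₗ coext A.grading.shift LinearMap.id 1 A.barOp = 0 :=
    tco_ext fun n v => A.barOp_coext_word n v
  have h' := LinearMap.congr_fun h x
  simp only [LinearMap.comp_apply, AlgHom.toLinearMap_apply] at h'
  rw [coe_redBarOp, h']
  exact LinearMap.congr_fun h2 _

theorem barDiff_one : A.barDiff 1 = 0 := by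
  rw [barDiff, coext_one]
  have : A.redBarOp 1 = 0 := by
    refine Subtype.ext ?_
    rw [coe_redBarOp, map_one, ← word_zero (k := k) (fun _ => 0), barOp_word, m_zero]
    simp
  rw [this, map_zero]

end AInfinityAlgebra

/-! ### The symmetric coalgebra -/

section SymmetricCoalgebra

variable {k : Type u} [Field k] {V : Type v} [AddCommGroup V] [Module k V]

open TensorAlgebra

/-- The symmetry `v ⊗ w ↦ (-1)^{|v| |w|} w ⊗ v` of `V ⊗ V`, see `braid_tmul`; the first summand
treats the `w` of even degree, the second one the `w` of odd degree. -/
def braid (G : Grading k V) : V ⊗[k] V →ₗ[k] V ⊗[k] V :=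
  (TensorProduct.map (G.scale fun q => if Even q then 1 else 0) LinearMap.id +
    TensorProduct.map (G.scale fun q => if Even q then 0 else 1) (G.sgn 1)) ∘ₗ
    (TensorProduct.comm k V V).toLinearMap

theorem braid_tmul (G : Grading k V) {p q : ℤ} {v w : V} (hv : v ∈ G.gr p) (hw : w ∈ G.gr q) :
    braid G (v ⊗ₜ[k] w) = (-1 : k) ^ (p * q) • (w ⊗ₜ[k] v) := by
  simp only [braid, LinearMap.comp_apply, LinearEquiv.coe_coe, TensorProduct.comm_tmul,
    LinearMap.add_apply, TensorProduct.map_tmul, LinearMap.id_apply, Grading.scale_of_mem _ _ hw,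
    Grading.sgn_of_mem _ _ hv, one_mul]
  by_cases h : Even q
  · simp [h, Even.neg_one_zpow (h.mul_left p)]
  · have h' : (-1 : k) ^ (p * q) = (-1 : k) ^ p := by
      obtain ⟨j, rfl⟩ := Int.not_even_iff_odd.1 h
      rw [mul_add, mul_one, zpow_add₀ (by simp),
        Even.neg_one_zpow (((even_two_mul j)).mul_left p), one_mul]
    simp [h, h', TensorProduct.smul_tmul']

theorem braid_tmul_left (G : Grading k V) {p : ℤ} {v : V} (hv : v ∈ G.gr p) (w : V) :
    braid G (v ⊗ₜ[k] w) = G.sgn p w ⊗ₜ[k] v := by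
  have : braid G ∘ₗ TensorProduct.mk k V V v = (TensorProduct.mk k V V).flip v ∘ₗ G.sgn p := by
    refine G.linear_ext fun q w hw => ?_
    simp [braid_tmul G hv hw, Grading.sgn_of_mem _ _ hw, TensorProduct.smul_tmul']
  exact LinearMap.congr_fun this w

theorem braid_braid (G : Grading k V) (z : V ⊗[k] V) : braid G (braid G z) = z := by
  induction z using TensorProduct.induction_on with
  | zero => simp
  | add a b ha hb => rw [map_add, map_add, ha, hb]
  | tmul v w =>
    induction v using G.induction_gr with
    | h0 => simp
    | ha a b h h' => rw [TensorProduct.add_tmul, map_add, map_add, h, h']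
    | h p v hv =>
      induction w using G.induction_gr with
      | h0 => simp
      | ha a b h h' => rw [TensorProduct.tmul_add, map_add, map_add, h, h']
      | h q w hw =>
        rw [braid_tmul G hv hw, map_smul, braid_tmul G hw hv, smul_smul, mul_comm q p,
          ← zpow_add₀ (by simp), Even.neg_one_zpow ⟨_, rfl⟩, one_smul]

/-- Splitting off the first letter of a word, `v₁ ⊗ ⋯ ⊗ vₙ ↦ v₁ ⊗ (v₂ ⊗ ⋯ ⊗ vₙ)`. -/
def peel : TCo k V →ₗ[k] V ⊗[k] TCo k V := TensorProduct.map proj LinearMap.id ∘ₗ decon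

/-- Putting a letter in front of a word. -/
def glue : V ⊗[k] TCo k V →ₗ[k] TCo k V :=
  LinearMap.mul' k (TCo k V) ∘ₗ TensorProduct.map (ι k) LinearMap.id

theorem glue_tmul (v : V) (x : TCo k V) : glue (v ⊗ₜ[k] x) = ι k v * x := by simp [glue]

theorem peel_one : peel (1 : TCo k V) = 0 := by simp [peel, decon_one, proj_one]

theorem peel_ι_mul (v : V) (x : TCo k V) : peel (ι k v * x) = v ⊗ₜ[k] x := by
  have e : TensorProduct.map (proj : TCo k V →ₗ[k] V) LinearMap.id ∘ₗ
      TensorProduct.map (LinearMap.mulLeft k (ι k v)) LinearMap.id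
      = TensorProduct.mk k V (TCo k V) v ∘ₗ (TensorProduct.lid k (TCo k V)).toLinearMap ∘ₗ
        TensorProduct.map counit LinearMap.id := by
    ext x y
    simp [proj_ι_mul, TensorProduct.smul_tmul]
  have e' := LinearMap.congr_fun e (decon x)
  simp only [LinearMap.comp_apply, decon_counit] at e'
  simp [peel, decon_ι_mul, proj_one, e']

theorem peel_glue (z : V ⊗[k] TCo k V) : peel (glue z) = z := by
  have : (peel ∘ₗ glue : V ⊗[k] TCo k V →ₗ[k] V ⊗[k] TCo k V) = LinearMap.id :=
    TensorProduct.ext' fun v x => by simp [glue_tmul, peel_ι_mul]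
  exact LinearMap.congr_fun this z

theorem glue_peel (x : TCo k V) : x = counit x • 1 + glue (peel x) := by
  have : (LinearMap.id : TCo k V →ₗ[k] TCo k V)
      = (counit : TCo k V →ₗ[k] k).smulRight 1 + glue ∘ₗ peel := by
    refine tco_rec_ext ?_ fun v x _ => ?_
    · simp [counit_one, peel_one]
    · simp [counit_ι_mul, peel_ι_mul, glue_tmul]
  exact LinearMap.congr_fun this x

/-- `braid` on the first two factors of `V ⊗ (V ⊗ T^{co}(V))`. -/
def braidLeft (G : Grading k V) : V ⊗[k] (V ⊗[k] TCo k V) →ₗ[k] V ⊗[k] (V ⊗[k] TCo k V) :=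
  (TensorProduct.assoc k V V (TCo k V)).toLinearMap ∘ₗ
    TensorProduct.map (braid G) LinearMap.id ∘ₗ
    (TensorProduct.assoc k V V (TCo k V)).symm.toLinearMap

/-- The signed action on words of the transposition of the letters number `i` and `i + 1`
(counting from `0`), with the Koszul sign, see `swapAt_word`; words too short to have these
letters are fixed. -/
def swapAt (G : Grading k V) : ℕ → (TCo k V →ₗ[k] TCo k V)
  | 0 => LinearMap.id + glue ∘ₗ TensorProduct.map LinearMap.id glue ∘ₗ
      (braidLeft G - LinearMap.id) ∘ₗ TensorProduct.map LinearMap.id peel ∘ₗ peel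
  | i + 1 => (counit : TCo k V →ₗ[k] k).smulRight 1 +
      glue ∘ₗ TensorProduct.map LinearMap.id (swapAt G i) ∘ₗ peel

theorem swapAt_one (G : Grading k V) (i : ℕ) : swapAt G i (1 : TCo k V) = 1 := by
  cases i <;> simp [swapAt, peel_one, counit_one]

theorem swapAt_succ_ι_mul (G : Grading k V) (i : ℕ) (v : V) (x : TCo k V) :
    swapAt G (i + 1) (ι k v * x) = ι k v * swapAt G i x := by
  simp [swapAt, peel_ι_mul, counit_ι_mul, glue_tmul]

theorem swapAt_zero_ι (G : Grading k V) (v : V) : swapAt G 0 (ι k v) = ι k v := by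
  have := peel_ι_mul (k := k) v 1
  rw [mul_one] at this
  simp [swapAt, this, peel_one]

theorem swapAt_zero_ι_mul (G : Grading k V) {p q : ℤ} {v w : V} (hv : v ∈ G.gr p)
    (hw : w ∈ G.gr q) (x : TCo k V) :
    swapAt G 0 (ι k v * (ι k w * x)) = (-1 : k) ^ (p * q) • (ι k w * (ι k v * x)) := by
  simp [swapAt, peel_ι_mul, braidLeft, braid_tmul G hv hw, glue_tmul, TensorProduct.smul_tmul']

theorem swapAt_word (G : Grading k V) (i n : ℕ) (v : ℕ → V) {p q : ℤ}
    (hp : v i ∈ G.gr p) (hq : v (i + 1) ∈ G.gr q) :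
    swapAt G i (word k (i + 2 + n) v) =
      (-1 : k) ^ (p * q) • word k (i + 2 + n) (v ∘ Equiv.swap i (i + 1)) := by
  induction i generalizing v with
  | zero =>
    rw [show 0 + 2 + n = n + 1 + 1 by ring, word_succ, word_succ, swapAt_zero_ι_mul G hp hq,
      word_succ, word_succ]
    have h2 : word k n (fun j => (v ∘ Equiv.swap 0 (0 + 1)) (j + 1 + 1))
        = word k n fun j => v (j + 1 + 1) := by
      refine word_congr fun j _ => ?_
      simp only [Function.comp_apply]
      rw [Equiv.swap_apply_of_ne_of_ne] <;> omega
    rw [h2]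
    simp
  | succ i ih =>
    rw [show i + 1 + 2 + n = (i + 2 + n) + 1 by ring, word_succ, swapAt_succ_ι_mul,
      ih (fun j => v (j + 1)) hp hq, word_succ, mul_smul_comm]
    have h1 : (v ∘ Equiv.swap (i + 1) (i + 1 + 1)) 0 = v 0 := by
      simp only [Function.comp_apply]
      rw [Equiv.swap_apply_of_ne_of_ne] <;> omega
    have h2 : word k (i + 2 + n) (fun j => (v ∘ Equiv.swap (i + 1) (i + 1 + 1)) (j + 1))
        = word k (i + 2 + n) ((fun j => v (j + 1)) ∘ Equiv.swap i (i + 1)) := by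
      refine word_congr fun j _ => ?_
      simp only [Function.comp_apply, Equiv.swap_apply_def]
      split_ifs <;> first | rfl | omega
    rw [h1, h2]

theorem swapAt_word_of_le (G : Grading k V) (i n : ℕ) (v : ℕ → V) (h : n ≤ i + 1) :
    swapAt G i (word k n v) = word k n v := by
  induction i generalizing v n with
  | zero =>
    interval_cases n
    · simp [word_zero, swapAt_one]
    · simp [word_one, swapAt_zero_ι]
  | succ i ih =>
    cases n with
    | zero => simp [word_zero, swapAt_one]
    | succ n => rw [word_succ, swapAt_succ_ι_mul, ih _ _ (by omega)]

/-- The symmetric coalgebra `Sym^{co}(V)`, as the subspace of `T^{co}(V)` of the tensors invariant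
under the signed permutations of the letters (the adjacent transpositions generate). -/
def Sym (G : Grading k V) : Submodule k (TCo k V) :=
  ⨅ i, LinearMap.eqLocus (swapAt G i) LinearMap.id

theorem mem_Sym (G : Grading k V) {x : TCo k V} : x ∈ Sym G ↔ ∀ i, swapAt G i x = x := by
  simp [Sym, Submodule.mem_iInf]

theorem one_mem_Sym (G : Grading k V) : (1 : TCo k V) ∈ Sym G := by
  simp [mem_Sym, swapAt_one]

theorem ι_mem_Sym (G : Grading k V) (v : V) : ι k v ∈ Sym G := by
  rw [mem_Sym]
  intro i
  cases i with
  | zero => exact swapAt_zero_ι G v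
  | succ i =>
    have := swapAt_succ_ι_mul G i v 1
    rwa [mul_one, swapAt_one, mul_one] at this

end SymmetricCoalgebra

section SymmetricCoderivations

variable {k : Type u} [Field k] {V : Type v} [AddCommGroup V] [Module k V]

open TensorAlgebra

/-- Contraction of the first letter with a functional. -/
def contract (φ : V →ₗ[k] k) : V ⊗[k] TCo k V →ₗ[k] TCo k V :=
  (TensorProduct.lid k (TCo k V)).toLinearMap ∘ₗ TensorProduct.map φ LinearMap.id

theorem contract_tmul (φ : V →ₗ[k] k) (v : V) (x : TCo k V) :
    contract φ (v ⊗ₜ[k] x) = φ v • x := by simp [contract]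

/-- A tensor whose contractions all lie in `S` lies in `V ⊗ S`. -/
theorem mem_span_of_contract (G : Grading k V) (S : Submodule k (TCo k V))
    (z : V ⊗[k] TCo k V) (hz : ∀ φ : V →ₗ[k] k, contract φ z ∈ S) :
    z ∈ Submodule.span k {z | ∃ p, ∃ v ∈ G.gr p, ∃ y ∈ S, z = v ⊗ₜ[k] y} := by
  classical
  let B := G.internal.collectedBasis (fun p => Module.Free.chooseBasis k (G.gr p))
  obtain ⟨c, rfl⟩ := TensorProduct.eq_repr_basis_left B z
  refine Submodule.sum_mem _ fun i _ => Submodule.subset_span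
    ⟨i.1, B i, G.internal.collectedBasis_mem _ _, c i, ?_, rfl⟩
  have h := hz (B.coord i)
  rw [Finsupp.sum, map_sum] at h
  simp only [contract_tmul, Module.Basis.coord_apply, Module.Basis.repr_self] at h
  rw [Finset.sum_eq_single i] at h
  · simpa using h
  · intro j _ hj
    simp [Finsupp.single_eq_of_ne' hj]
  · intro hi
    rw [Finsupp.notMem_support_iff.1 hi, smul_zero]

/-- The tensors of weight at most `n`. -/
def lowWeight (k : Type u) [Field k] (V : Type v) [AddCommGroup V] [Module k V] :
    ℕ → Submodule k (TCo k V)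
  | 0 => LinearMap.ker peel
  | n + 1 => ⨅ φ : V →ₗ[k] k, (lowWeight k V n).comap (contract φ ∘ₗ peel)

theorem mem_lowWeight_succ (n : ℕ) (x : TCo k V) :
    x ∈ lowWeight k V (n + 1) ↔ ∀ φ : V →ₗ[k] k, contract φ (peel x) ∈ lowWeight k V n := by
  simp [lowWeight, Submodule.mem_iInf]

theorem lowWeight_mono : Monotone (lowWeight k V) := by
  refine monotone_nat_of_le_succ fun n => ?_
  induction n with
  | zero =>
    intro x hx
    rw [mem_lowWeight_succ]
    intro φ
    rw [show peel x = 0 from hx, map_zero]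
    exact zero_mem _
  | succ n ih =>
    intro x hx
    rw [mem_lowWeight_succ] at hx ⊢
    exact fun φ => ih (hx φ)

theorem exists_lowWeight (x : TCo k V) : ∃ n, x ∈ lowWeight k V n := by
  rw [← Submodule.mem_iSup_of_directed _ lowWeight_mono.directed_le]
  have : (⨆ n, lowWeight k V n).mkQ = 0 := by
    refine tco_rec_ext ?_ fun v x hx => ?_
    · rw [LinearMap.zero_apply, Submodule.mkQ_apply, Submodule.Quotient.mk_eq_zero]
      exact Submodule.mem_iSup_of_mem 0 peel_one
    · rw [LinearMap.zero_apply, Submodule.mkQ_apply, Submodule.Quotient.mk_eq_zero,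
        Submodule.mem_iSup_of_directed _ lowWeight_mono.directed_le] at hx ⊢
      obtain ⟨n, hn⟩ := hx
      refine ⟨n + 1, (mem_lowWeight_succ n _).2 fun φ => ?_⟩
      rw [peel_ι_mul, contract_tmul]
      exact Submodule.smul_mem _ _ hn
  have h := LinearMap.congr_fun this x
  rwa [LinearMap.zero_apply, Submodule.mkQ_apply, Submodule.Quotient.mk_eq_zero] at h

theorem peel_swapAt_succ (G : Grading k V) (i : ℕ) (x : TCo k V) :
    peel (swapAt G (i + 1) x) = TensorProduct.map LinearMap.id (swapAt G i) (peel x) := by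
  simp [swapAt, peel_one, peel_glue]

theorem contract_swapAt (G : Grading k V) (i : ℕ) (φ : V →ₗ[k] k) (z : V ⊗[k] TCo k V) :
    swapAt G i (contract φ z) = contract φ (TensorProduct.map LinearMap.id (swapAt G i) z) := by
  induction z using TensorProduct.induction_on with
  | zero => simp
  | add a b ha hb => simp only [map_add, ha, hb]
  | tmul v x => simp [contract_tmul]

/-- Induction over the weight for symmetric tensors: the first letter of a symmetric tensor can be
split off, with a symmetric rest. -/
theorem Sym_induction (G : Grading k V) {P : TCo k V → Prop}
    (h : ∀ x ∈ Sym G, peel x ∈ Submodule.span k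
      {z | ∃ p, ∃ v ∈ G.gr p, ∃ y, y ∈ Sym G ∧ P y ∧ z = v ⊗ₜ[k] y} → P x)
    (x : TCo k V) (hx : x ∈ Sym G) : P x := by
  have key : ∀ n, ∀ x ∈ Sym G, x ∈ lowWeight k V n → P x := by
    intro n
    induction n with
    | zero =>
      intro x hx hn
      refine h x hx ?_
      rw [show peel x = 0 from hn]
      exact zero_mem _
    | succ n ih =>
      intro x hx hn
      rw [mem_lowWeight_succ] at hn
      refine h x hx (Submodule.span_mono ?_ (mem_span_of_contract G (Sym G ⊓ lowWeight k V n)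
        (peel x) fun φ => ⟨?_, hn φ⟩))
      · rintro _ ⟨p, v, hv, y, hy, rfl⟩
        exact ⟨p, v, hv, y, hy.1, ih y hy.1 hy.2, rfl⟩
      · refine (mem_Sym G).2 fun i => ?_
        rw [contract_swapAt, ← peel_swapAt_succ, (mem_Sym G).1 hx]
  obtain ⟨n, hn⟩ := exists_lowWeight x
  exact key n x hx hn

/-- Two linear maps agree on the span of a set as soon as they agree on the set. -/
theorem eq_of_mem_span {M N : Type*} [AddCommGroup M] [Module k M] [AddCommGroup N] [Module k N]
    {s : Set M} {f g : M →ₗ[k] N} (h : ∀ m ∈ s, f m = g m) {z : M}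
    (hz : z ∈ Submodule.span k s) : f z = g z :=
  LinearMap.eqOn_span (f := f) (g := g) h hz

/-- Auxiliary: the part of `decon` whose left factor is not empty. -/
def deconPeel : V ⊗[k] TCo k V →ₗ[k] TCo k V ⊗[k] TCo k V :=
  TensorProduct.map glue LinearMap.id ∘ₗ
    (TensorProduct.assoc k V (TCo k V) (TCo k V)).symm.toLinearMap ∘ₗ
    TensorProduct.map LinearMap.id decon

theorem deconPeel_tmul (v : V) (x : TCo k V) : deconPeel (v ⊗ₜ[k] x) =
    TensorProduct.map (LinearMap.mulLeft k (ι k v)) LinearMap.id (decon x) := by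
  have : TensorProduct.map glue LinearMap.id ∘ₗ
      (TensorProduct.assoc k V (TCo k V) (TCo k V)).symm.toLinearMap ∘ₗ
      TensorProduct.mk k V (TCo k V ⊗[k] TCo k V) v
      = TensorProduct.map (LinearMap.mulLeft k (ι k v)) LinearMap.id :=
    TensorProduct.ext' fun a b => by simp [glue_tmul]
  exact LinearMap.congr_fun this (decon x)

theorem decon_eq (x : TCo k V) : decon x = 1 ⊗ₜ[k] x + deconPeel (peel x) := by
  have : (decon : TCo k V →ₗ[k] _) = TensorProduct.mk k (TCo k V) (TCo k V) 1 +
      deconPeel ∘ₗ peel := by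
    refine tco_rec_ext ?_ fun v x _ => ?_
    · simp [decon_one, peel_one]
    · simp [decon_ι_mul, peel_ι_mul, deconPeel_tmul]
  exact LinearMap.congr_fun this x

theorem decon_swapAt (G : Grading k V) (i : ℕ) (x : TCo k V) (hx : x ∈ Sym G) :
    TensorProduct.map LinearMap.id (swapAt G i) (decon x) = decon x := by
  refine Sym_induction G
    (P := fun x => TensorProduct.map LinearMap.id (swapAt G i) (decon x) = decon x)
    (fun x hx hz => ?_) x hx
  have e : TensorProduct.map LinearMap.id (swapAt G i) (deconPeel (peel x))
      = deconPeel (peel x) := by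
    refine eq_of_mem_span (f := TensorProduct.map LinearMap.id (swapAt G i) ∘ₗ deconPeel) ?_ hz
    rintro _ ⟨p, v, hv, y, hy, hP, rfl⟩
    have e2 : TensorProduct.map LinearMap.id (swapAt G i) ∘ₗ
        TensorProduct.map (LinearMap.mulLeft k (ι k v)) LinearMap.id
        = TensorProduct.map (LinearMap.mulLeft k (ι k v)) LinearMap.id ∘ₗ
        TensorProduct.map LinearMap.id (swapAt G i) :=
      TensorProduct.ext' fun a b => by simp
    have e3 := LinearMap.congr_fun e2 (decon y)
    simp only [LinearMap.comp_apply, hP] at e3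
    rw [LinearMap.comp_apply, deconPeel_tmul, e3]
  rw [decon_eq, map_add, e, TensorProduct.map_tmul, (mem_Sym G).1 hx]
  simp

theorem braidLeft_tmul_left (G : Grading k V) {p : ℤ} {v : V} (hv : v ∈ G.gr p)
    (z : V ⊗[k] TCo k V) :
    braidLeft G (v ⊗ₜ[k] z) =
      TensorProduct.map (G.sgn p) (TensorProduct.mk k V (TCo k V) v) z := by
  induction z using TensorProduct.induction_on with
  | zero => simp
  | add a b ha hb => rw [TensorProduct.tmul_add, map_add, map_add, ha, hb]
  | tmul w x => simp [braidLeft, braid_tmul_left G hv]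

theorem braidLeft_braidLeft (G : Grading k V) (z : V ⊗[k] (V ⊗[k] TCo k V)) :
    braidLeft G (braidLeft G z) = z := by
  have h : braid G ∘ₗ braid G = LinearMap.id := LinearMap.ext (braid_braid G)
  simp only [braidLeft, LinearMap.comp_apply, LinearEquiv.coe_coe, LinearEquiv.symm_apply_apply,
    TensorProduct.map_map, h, LinearMap.comp_id, TensorProduct.map_id, LinearMap.id_apply,
    LinearEquiv.apply_symm_apply]

/-- The first two letters of `x`. -/
def peelTwo : TCo k V →ₗ[k] V ⊗[k] (V ⊗[k] TCo k V) := TensorProduct.map LinearMap.id peel ∘ₗ peel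

theorem braidLeft_peelTwo (G : Grading k V) {x : TCo k V} (hx : swapAt G 0 x = x) :
    braidLeft G (peelTwo x) = peelTwo x := by
  have h : glue (TensorProduct.map LinearMap.id glue (braidLeft G (peelTwo x) - peelTwo x)) = 0 := by
    simpa [swapAt, peelTwo] using hx
  have h1 := congrArg peel h
  rw [peel_glue, map_zero] at h1
  have h2 := congrArg (TensorProduct.map LinearMap.id peel) h1
  have h3 : (peel : TCo k V →ₗ[k] _) ∘ₗ glue = LinearMap.id := LinearMap.ext peel_glue
  rw [TensorProduct.map_map, h3, map_zero, LinearMap.comp_id, TensorProduct.map_id,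
    LinearMap.id_apply, sub_eq_zero] at h2
  exact h2

theorem swapAt_zero_eq (G : Grading k V) {x : TCo k V}
    (h : braidLeft G (peelTwo x) = peelTwo x) : swapAt G 0 x = x := by
  have h' : braidLeft G (peelTwo x) - peelTwo x = 0 := sub_eq_zero.2 h
  have : swapAt G 0 x = x + glue (TensorProduct.map LinearMap.id glue
    (braidLeft G (peelTwo x) - peelTwo x)) := by simp [swapAt, peelTwo]
  rw [this, h', map_zero, map_zero, add_zero]

theorem braidLeft_sgn (G : Grading k V) (n : ℤ) (D : TCo k V →ₗ[k] TCo k V)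
    (z : V ⊗[k] (V ⊗[k] TCo k V)) :
    braidLeft G (TensorProduct.map (G.sgn n) (TensorProduct.map (G.sgn n) D) z) =
      TensorProduct.map (G.sgn n) (TensorProduct.map (G.sgn n) D) (braidLeft G z) := by
  induction z using TensorProduct.induction_on with
  | zero => simp
  | add a b ha hb => simp only [map_add, ha, hb]
  | tmul v z =>
    induction v using G.induction_gr with
    | h0 => simp
    | ha a b h h' => simp only [TensorProduct.add_tmul, map_add, h, h']
    | h p v hv =>
      have hs : G.sgn n v ∈ G.gr p := by
        rw [Grading.sgn_of_mem _ _ hv]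
        exact Submodule.smul_mem _ _ hv
      rw [TensorProduct.map_tmul, braidLeft_tmul_left G hs, braidLeft_tmul_left G hv,
        TensorProduct.map_map, TensorProduct.map_map]
      congr 2
      ext w
      simp [Grading.sgn_sgn, add_comm]

/-- Moving `α` past the next letter of a symmetric tensor. -/
theorem braidLeft_decon (G : Grading k V) (x : TCo k V) (hx : x ∈ Sym G) :
    ∀ (n : ℤ) (α : TCo k V →ₗ[k] V),
      (∀ (m : ℤ) (x : TCo k V), G.sgn m (α x) = (-1 : k) ^ (m * n) • α (tmap (G.sgn m) x)) →
      braidLeft G (TensorProduct.map α peel (decon x)) =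
        TensorProduct.map (G.sgn n) (TensorProduct.map α LinearMap.id ∘ₗ decon) (peel x) := by
  refine Sym_induction G (P := fun x => ∀ (n : ℤ) (α : TCo k V →ₗ[k] V),
      (∀ (m : ℤ) (x : TCo k V), G.sgn m (α x) = (-1 : k) ^ (m * n) • α (tmap (G.sgn m) x)) →
      braidLeft G (TensorProduct.map α peel (decon x)) =
        TensorProduct.map (G.sgn n) (TensorProduct.map α LinearMap.id ∘ₗ decon) (peel x))
    (fun x hx hz n α hα => ?_) x hx
  have h1 : ∀ z : V ⊗[k] TCo k V, braidLeft G (α 1 ⊗ₜ[k] z) = TensorProduct.map (G.sgn n)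
      (TensorProduct.mk k V (TCo k V) (α 1)) z := by
    intro z
    induction z using TensorProduct.induction_on with
    | zero => simp
    | add a b ha hb => rw [TensorProduct.tmul_add, map_add, map_add, ha, hb]
    | tmul v y =>
      induction v using G.induction_gr with
      | h0 => simp
      | ha a b h h' => simp only [TensorProduct.add_tmul, TensorProduct.tmul_add, map_add, h, h']
      | h p v hv =>
        have h := braidLeft_braidLeft G (v ⊗ₜ[k] (α 1 ⊗ₜ[k] y))
        rw [braidLeft_tmul_left G hv, TensorProduct.map_tmul, hα, map_one,
          ← TensorProduct.smul_tmul', map_smul] at h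
        rw [TensorProduct.map_tmul, Grading.sgn_of_mem _ _ hv, ← TensorProduct.smul_tmul',
          TensorProduct.mk_apply, ← h, smul_smul, mul_comm n p, ← zpow_add₀ (by simp),
          Even.neg_one_zpow ⟨_, rfl⟩, one_smul, TensorProduct.mk_apply]
  set θ : V ⊗[k] (V ⊗[k] TCo k V) →ₗ[k] V ⊗[k] (V ⊗[k] TCo k V) :=
    TensorProduct.map (G.sgn n) (TensorProduct.map α LinearMap.id ∘ₗ deconPeel) with hθ
  have h2 : braidLeft G (TensorProduct.map α peel (deconPeel (peel x)))
      = θ (braidLeft G (TensorProduct.map LinearMap.id peel (peel x))) := by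
    refine eq_of_mem_span (f := braidLeft G ∘ₗ TensorProduct.map α peel ∘ₗ deconPeel)
      (g := θ ∘ₗ braidLeft G ∘ₗ TensorProduct.map LinearMap.id peel) ?_ hz
    rintro _ ⟨p, v, hv, y, hy, hP, rfl⟩
    have hα' : ∀ (m : ℤ) (x : TCo k V), G.sgn m ((α ∘ₗ LinearMap.mulLeft k (ι k v)) x)
        = (-1 : k) ^ (m * (n + p)) • (α ∘ₗ LinearMap.mulLeft k (ι k v)) (tmap (G.sgn m) x) := by
      intro m x
      simp only [LinearMap.comp_apply, LinearMap.mulLeft_apply, hα, map_mul, tmap_ι,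
        Grading.sgn_of_mem _ _ hv, map_smul, smul_mul_assoc, smul_smul]
      rw [mul_add, zpow_add₀ (by simp)]
    have h3 := hP (n + p) _ hα'
    simp only [LinearMap.comp_apply, deconPeel_tmul, TensorProduct.map_map, LinearMap.comp_id,
      TensorProduct.map_tmul, LinearMap.id_apply] at h3 ⊢
    rw [h3, braidLeft_tmul_left G hv, hθ, TensorProduct.map_map]
    congr 2
    · ext w
      simp [Grading.sgn_sgn]
    · ext w
      simp [deconPeel_tmul, TensorProduct.map_map]
  have h4 := braidLeft_peelTwo G ((mem_Sym G).1 hx 0)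
  rw [peelTwo, LinearMap.comp_apply] at h4
  have h5 : (TensorProduct.map α LinearMap.id ∘ₗ decon : TCo k V →ₗ[k] _)
      = TensorProduct.mk k V (TCo k V) (α 1) +
        (TensorProduct.map α LinearMap.id ∘ₗ deconPeel) ∘ₗ peel := by
    ext1 y
    simp only [LinearMap.comp_apply, LinearMap.add_apply]
    rw [decon_eq y]
    simp
  rw [h5, TensorProduct.map_add_right, LinearMap.add_apply, ← h1, decon_eq, map_add, map_add, h2,
    h4, hθ, TensorProduct.map_map, TensorProduct.map_tmul, LinearMap.comp_id]

/-- Coderivations of `T^{co}(V)` preserve the symmetric tensors. -/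
theorem coext_mem_Sym (G : Grading k V) {n : ℤ} {α : TCo k V →ₗ[k] V}
    (hα : ∀ (m : ℤ) (x : TCo k V), G.sgn m (α x) = (-1 : k) ^ (m * n) • α (tmap (G.sgn m) x))
    {x : TCo k V} (hx : x ∈ Sym G) : coext G LinearMap.id n α x ∈ Sym G := by
  set D := coext G LinearMap.id n α with hD
  have hid : (tmap (LinearMap.id : V →ₗ[k] V)).toLinearMap = LinearMap.id :=
    tco_ext fun n v => by simp [map_word]
  have hrec : ∀ x, D x = glue (TensorProduct.map α LinearMap.id (decon x)) +
      glue (TensorProduct.map (G.sgn n) D (peel x)) := by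
    have hE : ∀ x : TCo k V, prefixExt LinearMap.id α x
        = glue (TensorProduct.map α LinearMap.id (decon x)) := by
      intro x
      rw [prefixExt, hid, glue, LinearMap.comp_apply, LinearMap.comp_apply, LinearMap.comp_apply,
        TensorProduct.map_map, LinearMap.comp_id]
    have : D = glue ∘ₗ TensorProduct.map α LinearMap.id ∘ₗ decon +
        glue ∘ₗ TensorProduct.map (G.sgn n) D ∘ₗ peel := by
      refine tco_rec_ext ?_ fun v x _ => ?_
      · simp [hD, coext_one, peel_one, decon_one, glue_tmul]
      · simp only [hD, coext_ι_mul, hE, LinearMap.add_apply, LinearMap.comp_apply, peel_ι_mul,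
          TensorProduct.map_tmul, glue_tmul, LinearMap.id_apply]
    exact fun x => LinearMap.congr_fun this x
  have hpeel : ∀ x, peel (D x) = TensorProduct.map α LinearMap.id (decon x) +
      TensorProduct.map (G.sgn n) D (peel x) := by
    intro x
    rw [hrec x, map_add, peel_glue, peel_glue]
  refine (mem_Sym G).2 ?_
  refine Sym_induction G (P := fun x => ∀ i, swapAt G i (D x) = D x) (fun x hx hz i => ?_) x hx
  cases i with
  | zero =>
    refine swapAt_zero_eq G ?_
    have hpp : peelTwo (D x) = TensorProduct.map α peel (decon x) +
        (TensorProduct.map (G.sgn n) (TensorProduct.map α LinearMap.id ∘ₗ decon) (peel x) +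
        TensorProduct.map (G.sgn n) (TensorProduct.map (G.sgn n) D) (peelTwo x)) := by
      have hc : peel ∘ₗ D = TensorProduct.map α LinearMap.id ∘ₗ decon +
          TensorProduct.map (G.sgn n) D ∘ₗ peel := LinearMap.ext hpeel
      have hp : ∀ y : TCo k V, peelTwo y = TensorProduct.map LinearMap.id peel (peel y) :=
        fun _ => rfl
      rw [hp, hp, hpeel, map_add, TensorProduct.map_map, TensorProduct.map_map, hc,
        TensorProduct.map_add_right, LinearMap.add_apply, TensorProduct.map_map]
      simp
    have h1 := braidLeft_decon G x hx n α hα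
    have h2 := braidLeft_peelTwo G ((mem_Sym G).1 hx 0)
    rw [hpp, map_add, map_add, braidLeft_sgn, h2, h1, ← h1, braidLeft_braidLeft]
    abel
  | succ i =>
    have h1 : swapAt G (i + 1) (D x) = glue (TensorProduct.map LinearMap.id (swapAt G i)
        (peel (D x))) := by
      have hc : counit (D x) = 0 := (coext_isCoderivation G n α).counit_eq_zero x
      simp [swapAt, hc]
    have h2 : D x = glue (peel (D x)) := by rw [hpeel, map_add, ← hrec]
    rw [h1]
    conv_rhs => rw [h2]
    congr 1
    rw [hpeel, map_add]
    congr 1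
    · have h3 := decon_swapAt G i x hx
      conv_rhs => rw [← h3]
      rw [TensorProduct.map_map, TensorProduct.map_map]
      simp
    · rw [TensorProduct.map_map]
      refine eq_of_mem_span (fun z hz => ?_) hz
      obtain ⟨p, v, hv, y, hy, hP, rfl⟩ := hz
      simp [hP i]

end SymmetricCoderivations

theorem AInfinityAlgebra.barDiff_mem_Sym {k : Type u} [Field k] (A : AInfinityAlgebra.{u, v} k)
    {x : TCo k A.augIdeal} (hx : x ∈ Sym A.barGrading) : A.barDiff x ∈ Sym A.barGrading :=
  coext_mem_Sym _ A.redBarOp_sgn hx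

section SymmetricCoproduct

variable {k : Type u} [Field k] {V : Type v} [AddCommGroup V] [Module k V]

open TensorAlgebra

theorem mem_range_of_fixed {M N I : Type*} [AddCommGroup M] [Module k M] [AddCommGroup N]
    [Module k N] (f : I → N →ₗ[k] N) (S : Submodule k N)
    (hS : ∀ x, x ∈ S ↔ ∀ i, f i x = x) (z : M ⊗[k] N)
    (h : ∀ i, TensorProduct.map LinearMap.id (f i) z = z) :
    z ∈ LinearMap.range (TensorProduct.map (LinearMap.id : M →ₗ[k] M) S.subtype) := by
  classical
  let B := Module.Free.chooseBasis k M
  have nat : ∀ (φ : M →ₗ[k] k) (g : N →ₗ[k] N) (z : M ⊗[k] N),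
      g (TensorProduct.lid k N (TensorProduct.map φ LinearMap.id z))
        = TensorProduct.lid k N (TensorProduct.map φ LinearMap.id
          (TensorProduct.map LinearMap.id g z)) := by
    intro φ g z
    induction z using TensorProduct.induction_on with
    | zero => simp
    | add a b ha hb => simp only [map_add, ha, hb]
    | tmul v x => simp
  obtain ⟨c, rfl⟩ := TensorProduct.eq_repr_basis_left B z
  refine Submodule.sum_mem _ fun j _ => ?_
  have hc : c j = TensorProduct.lid k N (TensorProduct.map (B.coord j) LinearMap.id
      (c.sum fun i n => B i ⊗ₜ[k] n)) := by
    rw [Finsupp.sum, map_sum, map_sum, Finset.sum_eq_single j]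
    · simp
    · intro i _ hi
      simp [Finsupp.single_eq_of_ne' hi]
    · intro hj
      rw [Finsupp.notMem_support_iff.1 hj]
      simp
  have hj : c j ∈ S := by
    rw [hS]
    intro i
    conv_lhs => rw [hc]
    rw [nat, h, ← hc]
  exact ⟨B j ⊗ₜ[k] ⟨c j, hj⟩, by simp⟩

theorem decon_swapAt_left (G : Grading k V) (x : TCo k V) (hx : x ∈ Sym G) :
    ∀ i, TensorProduct.map (swapAt G i) LinearMap.id (decon x) = decon x := by
  refine Sym_induction G
    (P := fun x => ∀ i, TensorProduct.map (swapAt G i) LinearMap.id (decon x) = decon x)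
    (fun x hx hz i => ?_) x hx
  have e : TensorProduct.map (swapAt G i) LinearMap.id (deconPeel (peel x))
      = deconPeel (peel x) := by
    cases i with
    | zero =>
      set K : V ⊗[k] (V ⊗[k] TCo k V) →ₗ[k] TCo k V ⊗[k] TCo k V :=
        TensorProduct.map glue LinearMap.id ∘ₗ
          (TensorProduct.assoc k V (TCo k V) (TCo k V)).symm.toLinearMap ∘ₗ
          TensorProduct.map LinearMap.id deconPeel with hK
      have hK1 : ∀ (v : V) (z : V ⊗[k] TCo k V), K (v ⊗ₜ[k] z) =
          TensorProduct.map (LinearMap.mulLeft k (ι k v)) LinearMap.id (deconPeel z) := by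
        intro v z
        have : TensorProduct.map glue LinearMap.id ∘ₗ
            (TensorProduct.assoc k V (TCo k V) (TCo k V)).symm.toLinearMap ∘ₗ
            TensorProduct.mk k V (TCo k V ⊗[k] TCo k V) v
            = TensorProduct.map (LinearMap.mulLeft k (ι k v)) LinearMap.id :=
          TensorProduct.ext' fun a b => by simp [glue_tmul]
        exact LinearMap.congr_fun this _
      have hK2 : ∀ z, deconPeel z = TensorProduct.map (ι k) LinearMap.id z +
          K (TensorProduct.map LinearMap.id peel z) := by
        intro z
        induction z using TensorProduct.induction_on with
        | zero => simp
        | add a b ha hb =>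
          simp only [map_add, ha, hb]
          abel
        | tmul v y =>
          rw [TensorProduct.map_tmul, TensorProduct.map_tmul, hK1, deconPeel_tmul, decon_eq]
          simp
      have hK3 : ∀ u, TensorProduct.map (swapAt G 0) LinearMap.id (K u) = K (braidLeft G u) := by
        intro u
        induction u using TensorProduct.induction_on with
        | zero => simp
        | add a b ha hb => simp only [map_add, ha, hb]
        | tmul v z =>
          induction z using TensorProduct.induction_on with
          | zero => simp
          | add a b ha hb => simp only [TensorProduct.tmul_add, map_add, ha, hb]
          | tmul w y =>
            induction v using G.induction_gr with
            | h0 => simp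
            | ha a b h h' => simp only [TensorProduct.add_tmul, map_add, h, h']
            | h p v hv =>
              induction w using G.induction_gr with
              | h0 => simp
              | ha a b h h' =>
                simp only [TensorProduct.add_tmul, TensorProduct.tmul_add, map_add, h, h']
              | h q w hw =>
                have hb : braidLeft G (v ⊗ₜ[k] (w ⊗ₜ[k] y))
                    = (-1 : k) ^ (p * q) • (w ⊗ₜ[k] (v ⊗ₜ[k] y)) := by
                  simp [braidLeft, braid_tmul G hv hw, TensorProduct.smul_tmul']
                rw [hb, map_smul, hK1, hK1, deconPeel_tmul, deconPeel_tmul]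
                have : ∀ t : TCo k V ⊗[k] TCo k V, TensorProduct.map (swapAt G 0) LinearMap.id
                    (TensorProduct.map (LinearMap.mulLeft k (ι k v)) LinearMap.id
                      (TensorProduct.map (LinearMap.mulLeft k (ι k w)) LinearMap.id t))
                    = (-1 : k) ^ (p * q) •
                      TensorProduct.map (LinearMap.mulLeft k (ι k w)) LinearMap.id
                      (TensorProduct.map (LinearMap.mulLeft k (ι k v)) LinearMap.id t) := by
                  intro t
                  induction t using TensorProduct.induction_on with
                  | zero => simp
                  | add a b ha hb => simp only [map_add, ha, hb, smul_add]
                  | tmul a b =>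
                    simp [swapAt_zero_ι_mul G hv hw, TensorProduct.smul_tmul']
                exact this _
      have h1 : (swapAt G 0) ∘ₗ ι k = ι k := LinearMap.ext (swapAt_zero_ι G)
      have h2 := braidLeft_peelTwo G ((mem_Sym G).1 hx 0)
      rw [peelTwo, LinearMap.comp_apply] at h2
      rw [hK2, map_add, hK3, h2, TensorProduct.map_map, h1, LinearMap.comp_id]
    | succ i =>
      refine eq_of_mem_span (f := TensorProduct.map (swapAt G (i + 1)) LinearMap.id ∘ₗ deconPeel)
        ?_ hz
      rintro _ ⟨p, v, hv, y, hy, hP, rfl⟩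
      have e2 : TensorProduct.map (swapAt G (i + 1)) LinearMap.id ∘ₗ
          TensorProduct.map (LinearMap.mulLeft k (ι k v)) (LinearMap.id : TCo k V →ₗ[k] TCo k V)
          = TensorProduct.map (LinearMap.mulLeft k (ι k v)) LinearMap.id ∘ₗ
          TensorProduct.map (swapAt G i) LinearMap.id :=
        TensorProduct.ext' fun a b => by simp [swapAt_succ_ι_mul]
      have e3 := LinearMap.congr_fun e2 (decon y)
      simp only [LinearMap.comp_apply, hP] at e3
      rw [LinearMap.comp_apply, deconPeel_tmul, e3]
  rw [decon_eq, map_add, e, TensorProduct.map_tmul, swapAt_one]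
  simp

theorem decon_mem_range (G : Grading k V) (x : Sym G) :
    decon (x : TCo k V) ∈ LinearMap.range (TensorProduct.map (Sym G).subtype (Sym G).subtype) := by
  obtain ⟨z, hz⟩ := mem_range_of_fixed (swapAt G) (Sym G) (fun _ => mem_Sym G)
    (decon (x : TCo k V)) fun i => decon_swapAt G i x x.2
  have hinj : Function.Injective (TensorProduct.map (LinearMap.id : TCo k V →ₗ[k] TCo k V)
      (Sym G).subtype) :=
    TensorProduct.map_injective_of_flat_flat _ _ Function.injective_id
      (Submodule.subtype_injective _)
  obtain ⟨y, hy⟩ := mem_range_of_fixed (swapAt G) (Sym G) (fun _ => mem_Sym G)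
    (TensorProduct.comm k _ _ z) fun i => by
      rw [TensorProduct.map_comm]
      congr 1
      apply hinj
      have h := decon_swapAt_left G x x.2 i
      rw [← hz, TensorProduct.map_map] at h
      rw [TensorProduct.map_map]
      exact h
  refine ⟨TensorProduct.comm k _ _ y, ?_⟩
  have h2 : z = TensorProduct.map (Sym G).subtype LinearMap.id (TensorProduct.comm k _ _ y) := by
    rw [TensorProduct.map_comm, hy]
    exact ((TensorProduct.comm k _ _).symm_apply_apply z).symm
  rw [← hz, h2, TensorProduct.map_map]
  rfl

theorem Sym_map_injective (G : Grading k V) :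
    Function.Injective (TensorProduct.map (Sym G).subtype (Sym G).subtype) :=
  TensorProduct.map_injective_of_flat_flat _ _ (Submodule.subtype_injective _)
    (Submodule.subtype_injective _)

/-- The coproduct of `Sym^{co}(V)`, the restriction of the deconcatenation coproduct. -/
def symDecon (G : Grading k V) : Sym G →ₗ[k] Sym G ⊗[k] Sym G :=
  (LinearEquiv.ofInjective _ (Sym_map_injective G)).symm.toLinearMap ∘ₗ
    (decon ∘ₗ (Sym G).subtype).codRestrict _ (decon_mem_range G)

theorem map_symDecon (G : Grading k V) (x : Sym G) :
    TensorProduct.map (Sym G).subtype (Sym G).subtype (symDecon G x) = decon (x : TCo k V) := by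
  have h := LinearEquiv.apply_symm_apply (LinearEquiv.ofInjective _ (Sym_map_injective G))
    ⟨decon (x : TCo k V), decon_mem_range G x⟩
  exact congrArg Subtype.val h

/-- The sign operator `x ↦ (-1)^{n |x|} x` preserves the symmetric tensors. -/
theorem tmap_sgn_mem_Sym (G : Grading k V) (n : ℤ) {x : TCo k V} (hx : x ∈ Sym G) :
    tmap (G.sgn n) x ∈ Sym G := by
  have key : ∀ i, (swapAt G i) ∘ₗ (tmap (G.sgn n)).toLinearMap
      = (tmap (G.sgn n)).toLinearMap ∘ₗ swapAt G i := by
    intro i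
    induction i with
    | zero =>
      refine tco_rec_ext (by simp [swapAt_one]) fun v x _ => ?_
      have : ∀ y : TCo k V, ∀ v, (swapAt G 0 ∘ₗ (tmap (G.sgn n)).toLinearMap) (ι k v * y)
          = ((tmap (G.sgn n)).toLinearMap ∘ₗ swapAt G 0) (ι k v * y) := by
        intro y v
        refine LinearMap.congr_fun (f := swapAt G 0 ∘ₗ (tmap (G.sgn n)).toLinearMap ∘ₗ
          LinearMap.mulLeft k (ι k v)) (g := (tmap (G.sgn n)).toLinearMap ∘ₗ swapAt G 0 ∘ₗ
          LinearMap.mulLeft k (ι k v)) (tco_rec_ext ?_ fun w z hz => ?_) y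
        · simp [tmap_ι, swapAt_zero_ι]
        · clear hz
          simp only [LinearMap.comp_apply, LinearMap.mulLeft_apply, AlgHom.toLinearMap_apply,
            map_mul, tmap_ι]
          induction v using G.induction_gr with
          | h0 => simp
          | ha a b h h' => simp only [add_mul, map_add, h, h']
          | h p v hv =>
            induction w using G.induction_gr with
            | h0 => simp
            | ha a b h h' => simp only [add_mul, mul_add, map_add, h, h']
            | h q w hw =>
              rw [Grading.sgn_of_mem _ _ hv, Grading.sgn_of_mem _ _ hw, swapAt_zero_ι_mul G hv hw,
                map_smul, map_smul]
              simp only [smul_mul_assoc, mul_smul_comm, map_smul, swapAt_zero_ι_mul G hv hw,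
                map_mul, tmap_ι, Grading.sgn_of_mem _ _ hv, Grading.sgn_of_mem _ _ hw, smul_smul]
              congr 1
              ring
      exact this x v
    | succ i ih =>
      refine tco_rec_ext (by simp [swapAt_one]) fun v x _ => ?_
      have h := LinearMap.congr_fun ih x
      simp only [LinearMap.comp_apply, AlgHom.toLinearMap_apply] at h ⊢
      rw [map_mul, tmap_ι, swapAt_succ_ι_mul, swapAt_succ_ι_mul, map_mul, tmap_ι, h]
  refine (mem_Sym G).2 fun i => ?_
  have h := LinearMap.congr_fun (key i) x
  simp only [LinearMap.comp_apply, AlgHom.toLinearMap_apply, (mem_Sym G).1 hx i] at h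
  exact h

/-- The sign operator `x ↦ (-1)^{n |x|} x` on `Sym^{co}(V)`. -/
def symSgn (G : Grading k V) (n : ℤ) : Sym G →ₗ[k] Sym G :=
  (tmap (G.sgn n)).toLinearMap.restrict fun _ hx => tmap_sgn_mem_Sym G n hx

end SymmetricCoproduct

/-! ### `L_∞`-algebras -/

section Degree

variable {k : Type u} [Field k] {V : Type v} [AddCommGroup V] [Module k V]

open TensorAlgebra

/-- The elements of degree `d` of `T^{co}(V)`: the span of the words of homogeneous letters whose
degrees add up to `d`. -/
def degree (G : Grading k V) (d : ℤ) : Submodule k (TCo k V) :=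
  Submodule.span k {x | ∃ (n : ℕ) (p : ℕ → ℤ) (v : ℕ → V), (∀ i < n, v i ∈ G.gr (p i)) ∧
    ∑ i ∈ Finset.range n, p i = d ∧ x = word k n v}

theorem word_mem_degree (G : Grading k V) {n : ℕ} {p : ℕ → ℤ} {v : ℕ → V}
    (h : ∀ i < n, v i ∈ G.gr (p i)) : word k n v ∈ degree G (∑ i ∈ Finset.range n, p i) :=
  Submodule.subset_span ⟨n, p, v, h, rfl, rfl⟩

theorem one_mem_degree (G : Grading k V) : (1 : TCo k V) ∈ degree G 0 := by
  simpa [word_zero] using word_mem_degree G (n := 0) (p := 0) (v := 0) (by simp)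

theorem ι_mem_degree (G : Grading k V) {d : ℤ} {v : V} (hv : v ∈ G.gr d) :
    ι k v ∈ degree G d := by
  simpa [word_one] using word_mem_degree G (n := 1) (p := fun _ => d) (v := fun _ => v)
    (fun _ _ => hv)

theorem mul_mem_degree (G : Grading k V) {d e : ℤ} {x y : TCo k V} (hx : x ∈ degree G d)
    (hy : y ∈ degree G e) : x * y ∈ degree G (d + e) := by
  have h := Submodule.mul_mem_mul hx hy
  rw [degree, degree, Submodule.span_mul_span] at h
  refine Submodule.span_le.2 ?_ h
  rintro _ ⟨_, ⟨m, p, v, hv, rfl, rfl⟩, _, ⟨n, q, w, hw, rfl, rfl⟩, rfl⟩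
  simp only [word_mul_word, SetLike.mem_coe]
  have h := word_mem_degree G (n := m + n) (p := fun i => if i < m then p i else q (i - m))
    (v := fun i => if i < m then v i else w (i - m)) fun i hi => by
      by_cases h : i < m
      · simpa [h] using hv i h
      · simpa [h] using hw (i - m) (by omega)
  convert h using 2
  rw [Finset.sum_range_add]
  congr 1
  · exact Finset.sum_congr rfl fun i hi => by simp [Finset.mem_range.1 hi]
  · exact Finset.sum_congr rfl fun i hi => by simp

theorem coext_mem_degree (G : Grading k V) {n : ℤ} {α : TCo k V →ₗ[k] V}
    (hα : ∀ d, ∀ x ∈ degree G d, α x ∈ G.gr (d + n)) {d : ℤ} {x : TCo k V} (hx : x ∈ degree G d) :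
    coext G LinearMap.id n α x ∈ degree G (d + n) := by
  refine (Submodule.span_le (p := (degree G (d + n)).comap (coext G LinearMap.id n α))).2 ?_ hx
  rintro _ ⟨N, p, v, hv, rfl, rfl⟩
  rw [SetLike.mem_coe, Submodule.mem_comap, coext_word']
  refine Submodule.sum_mem _ fun a ha => Submodule.sum_mem _ fun q hq => ?_
  obtain ⟨r, q'⟩ := a
  obtain ⟨s, t⟩ := q
  simp only [Finset.HasAntidiagonal.mem_antidiagonal] at ha hq
  subst hq
  subst ha
  have h1 := word_mem_degree G (n := r) (p := p) (v := fun i => G.sgn n (v i)) fun i hi => by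
    have := hv i (by omega)
    rw [Grading.sgn_of_mem _ _ this]
    exact Submodule.smul_mem _ _ this
  have h2 := hα _ _ (word_mem_degree G (n := s) (p := fun i => p (r + i))
    (v := fun i => v (r + i)) fun i hi => hv _ (by omega))
  have h3 := word_mem_degree G (n := t) (p := fun i => p (r + (s + i)))
    (v := fun i => v (r + (s + i))) fun i hi => hv _ (by omega)
  convert mul_mem_degree G h1 (mul_mem_degree G (ι_mem_degree G h2) h3) using 2
  · rw [Finset.sum_range_add, Finset.sum_range_add]
    ring
  · rfl
  · rfl

end Degree

/-- An `L_∞`-algebra structure on the graded vector space `L`: a codifferential `b` (a coderivation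
of degree `1` and square zero) of the symmetric coalgebra `Sym^{co}(sL)` that vanishes on `k`. -/
structure LInfinityAlgebra (k : Type u) [Field k] where
  carrier : Type v
  [addCommGroup : AddCommGroup carrier]
  [module : Module k carrier]
  grading : Grading k carrier
  b : Sym grading.shift →ₗ[k] Sym grading.shift
  b_degree : ∀ (d : ℤ) (x : Sym grading.shift), (x : TCo k carrier) ∈ degree grading.shift d →
    (b x : TCo k carrier) ∈ degree grading.shift (d + 1)
  b_coderivation : ∀ x, symDecon grading.shift (b x) =
    TensorProduct.map (symSgn grading.shift 1) b (symDecon grading.shift x) +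
    TensorProduct.map b LinearMap.id (symDecon grading.shift x)
  b_b : ∀ x, b (b x) = 0
  b_one : b ⟨1, one_mem_Sym grading.shift⟩ = 0

attribute [instance] LInfinityAlgebra.addCommGroup LInfinityAlgebra.module

namespace LInfinityAlgebra

variable {k : Type u} [Field k]

/-- The component `Sym^{co}(sL) → sL` of the codifferential. Its restriction to the symmetric
tensors of weight `n` is the `n`-ary operation of `L`. -/
def op (L : LInfinityAlgebra.{u, v} k) : Sym L.grading.shift →ₗ[k] L.carrier :=
  proj ∘ₗ (Sym L.grading.shift).subtype ∘ₗ L.b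

/-- The `n`-ary operation vanishes. -/
def OpVanishes (L : LInfinityAlgebra.{u, v} k) (n : ℕ) : Prop :=
  ∀ x : Sym L.grading.shift, (x : TCo k L.carrier) ∈ weight k L.carrier n → L.op x = 0

/-- The differential of `sL`, which is the unary operation. -/
def d (L : LInfinityAlgebra.{u, v} k) : L.carrier →ₗ[k] L.carrier where
  toFun x := L.op ⟨TensorAlgebra.ι k x, ι_mem_Sym _ x⟩
  map_add' x y := by
    rw [← map_add]
    congr 1
    exact Subtype.ext (map_add _ _ _)
  map_smul' c x := by
    rw [RingHom.id_apply, ← map_smul]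
    congr 1
    exact Subtype.ext (map_smul _ _ _)

/-- All the operations, not including the differential, vanish. -/
def IsCompletelyAbelian (L : LInfinityAlgebra.{u, v} k) : Prop := ∀ n, 2 ≤ n → L.OpVanishes n

/-- A morphism of `L_∞`-algebras: a morphism `Sym^{co}(sL) → Sym^{co}(sL')` of (coaugmented) dg
coalgebras. -/
structure Hom (L L' : LInfinityAlgebra.{u, v} k) where
  map : Sym L.grading.shift →ₗ[k] Sym L'.grading.shift
  map_degree : ∀ (d : ℤ) (x : Sym L.grading.shift),
    (x : TCo k L.carrier) ∈ degree L.grading.shift d →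
    (map x : TCo k L'.carrier) ∈ degree L'.grading.shift d
  map_decon : ∀ x, symDecon L'.grading.shift (map x) =
    TensorProduct.map map map (symDecon L.grading.shift x)
  map_counit : ∀ x, counit (map x : TCo k L'.carrier) = counit (x : TCo k L.carrier)
  map_one : map ⟨1, one_mem_Sym _⟩ = ⟨1, one_mem_Sym _⟩
  map_b : ∀ x, map (L.b x) = L'.b (map x)

/-- The weight one part `sL → sL'` of a morphism. -/
def Hom.linear {L L' : LInfinityAlgebra.{u, v} k} (f : Hom L L') (x : L.carrier) : L'.carrier :=
  proj (f.map ⟨TensorAlgebra.ι k x, ι_mem_Sym _ x⟩ : TCo k L'.carrier)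

/-- A morphism of `L_∞`-algebras is a quasi-isomorphism if its weight one part is a
quasi-isomorphism of complexes: it is injective and surjective on cohomology. -/
def Hom.IsQuasiIso {L L' : LInfinityAlgebra.{u, v} k} (f : Hom L L') : Prop :=
  (∀ x, L.d x = 0 → (∃ y, f.linear x = L'.d y) → ∃ z, x = L.d z) ∧
    ∀ y, L'.d y = 0 → ∃ x, L.d x = 0 ∧ ∃ z, y = f.linear x + L'.d z

/-- `L` is quasi-abelian if it admits a completely abelian model. -/
def IsQuasiAbelian (L : LInfinityAlgebra.{u, v} k) : Prop :=
  ∃ (L' : LInfinityAlgebra.{u, v} k) (f : Hom L' L), L'.IsCompletelyAbelian ∧ f.IsQuasiIso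

/-- `L` is formal if it is quasi-isomorphic to a graded Lie algebra, that is, to an
`L_∞`-algebra whose only operation is a binary one. (This graded Lie algebra is then isomorphic to
the cohomology of `L`.) -/
def IsFormal (L : LInfinityAlgebra.{u, v} k) : Prop :=
  ∃ (L' : LInfinityAlgebra.{u, v} k) (f : Hom L' L),
    (∀ n, n ≠ 2 → L'.OpVanishes n) ∧ f.IsQuasiIso

end LInfinityAlgebra

namespace AInfinityAlgebra

variable {k : Type u} [Field k] (A : AInfinityAlgebra.{u, v} k)

theorem redBarOp_degree (d : ℤ) (x : TCo k A.augIdeal) (hx : x ∈ degree A.barGrading d) :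
    A.redBarOp x ∈ A.barGrading.gr (d + 1) := by
  refine (Submodule.span_le (p := (A.barGrading.gr (d + 1)).comap A.redBarOp)).2 ?_ hx
  rintro _ ⟨n, p, v, hv, rfl, rfl⟩
  change (A.redBarOp (word k n v) : A.carrier) ∈ A.grading.gr _
  rw [coe_redBarOp, map_word, barOp_word]
  refine Submodule.neg_mem _ ?_
  have h := A.m_degree n (fun i => p i + 1)
    (fun i => A.grading.shift.sgn (n - 1 - i) (A.augIdeal.subtype (v i))) fun i => by
      have h1 : (v i : A.carrier) ∈ A.grading.shift.gr (p i) := hv i i.2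
      rw [Submodule.subtype_apply, Grading.sgn_of_mem _ _ h1]
      exact Submodule.smul_mem _ _ h1
  convert h using 2
  rw [Finset.sum_add_distrib, Fin.sum_univ_eq_sum_range (fun i => p i)]
  simp
  ring

/-- The associated `L_∞`-algebra `A^{Lie}`: the augmentation ideal `Ā`, where the codifferential of
`Sym^{co}(sĀ)` is the restriction of the differential of the bar construction. -/
abbrev lie : LInfinityAlgebra.{u, v} k where
  carrier := A.augIdeal
  grading := A.augGrading
  b := A.barDiff.restrict fun _ hx => A.barDiff_mem_Sym hx
  b_degree _ _ hx := coext_mem_degree A.barGrading A.redBarOp_degree hx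
  b_coderivation x := by
    apply Sym_map_injective
    rw [map_symDecon, map_add, TensorProduct.map_map, TensorProduct.map_map]
    have h := A.barDiff_isCoderivation x
    rw [← map_symDecon A.barGrading x, TensorProduct.map_map, TensorProduct.map_map] at h
    exact h
  b_b x := Subtype.ext (LinearMap.congr_fun A.barDiff_sq x)
  b_one := Subtype.ext A.barDiff_one

/-! ### Hochschild cohomology -/

/-- The reduced Hochschild cochains of degree `p`: the linear maps `BA → A` of degree `p`. -/
def cochains (p : ℤ) : Submodule k (TCo k A.augIdeal →ₗ[k] A.carrier) where
  carrier := {f | ∀ d, ∀ x ∈ degree A.barGrading d, f x ∈ A.grading.gr (d + p)}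
  add_mem' hf hg d x hx := Submodule.add_mem _ (hf d x hx) (hg d x hx)
  zero_mem' _ _ _ := Submodule.zero_mem _
  smul_mem' c _ hf d x hx := Submodule.smul_mem _ c (hf d x hx)

theorem coext_add {V W : Type*} [AddCommGroup V] [Module k V] [AddCommGroup W] [Module k W]
    (G : Grading k V) (g : V →ₗ[k] W) (n : ℤ) (α β : TCo k V →ₗ[k] W) :
    coext G g n (α + β) = coext G g n α + coext G g n β := by
  simp only [coext, prefixExt, LinearMap.comp_add, TensorProduct.map_add_left,
    TensorProduct.map_add_right, LinearMap.add_comp]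

theorem coext_smul {V W : Type*} [AddCommGroup V] [Module k V] [AddCommGroup W] [Module k W]
    (G : Grading k V) (g : V →ₗ[k] W) (n : ℤ) (c : k) (α : TCo k V →ₗ[k] W) :
    coext G g n (c • α) = c • coext G g n α := by
  simp only [coext, prefixExt, LinearMap.comp_smul, TensorProduct.map_smul_left,
    TensorProduct.map_smul_right, LinearMap.smul_comp]

/-- The Hochschild differential on cochains of degree `p`. Identify `f` with a map
`sf : BA → sA` of degree `p - 1`, and write `D_f = coext f : BA → T^{co}(sA)` for
`v₁ ⊗ ⋯ ⊗ vₙ ↦ ∑ ± v₁ ⊗ ⋯ ⊗ sf(⋯) ⊗ ⋯ ⊗ vₙ`; then the differential is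
`s ∂f = -(B ∘ D_f - (-1)^{p-1} sf ∘ b)`, where `B` assembles the `b_n` of `A`. Up to sign it sends
`f` to `∑ m_{r+1+t}(1^{⊗ r} ⊗ f ⊗ 1^{⊗ t})` and `∑ f(1^{⊗ r} ⊗ m_s ⊗ 1^{⊗ t})`. -/
def hochschildDiff (p : ℤ) :
    (TCo k A.augIdeal →ₗ[k] A.carrier) →ₗ[k] (TCo k A.augIdeal →ₗ[k] A.carrier) where
  toFun f := -(A.barOp ∘ₗ coext A.barGrading A.augIdeal.subtype (p - 1) f -
    (-1 : k) ^ (p - 1) • (f ∘ₗ A.barDiff))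
  map_add' f g := by
    rw [coext_add, LinearMap.comp_add, LinearMap.add_comp, smul_add]
    abel
  map_smul' c f := by
    rw [coext_smul, LinearMap.comp_smul, LinearMap.smul_comp, smul_comm _ c, ← smul_sub, ← smul_neg]
    rfl

theorem hochschildDiff_one (p : ℤ) (f : TCo k A.augIdeal →ₗ[k] A.carrier) :
    A.hochschildDiff p f 1 = A.d (f 1) := by
  have h : A.barOp (TensorAlgebra.ι k (f 1)) = - A.d (f 1) := by
    have h1 := word_one (k := k) (fun _ : ℕ => f 1)
    rw [← h1, barOp_word, d_apply]
    congr 2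
    ext i
    rw [Grading.sgn_even]
    simp
  change -(A.barOp (coext A.barGrading A.augIdeal.subtype (p - 1) f 1) -
    (-1 : k) ^ (p - 1) • f (A.barDiff 1)) = _
  rw [barDiff_one, coext_one, h]
  simp

/-- The Hochschild cocycles of degree `p`. -/
def cocycles (p : ℤ) : Submodule k (TCo k A.augIdeal →ₗ[k] A.carrier) :=
  A.cochains p ⊓ LinearMap.ker (A.hochschildDiff p)

/-- The Hochschild cohomology `HH^p(A,A)`: cocycles modulo coboundaries. -/
abbrev HH (p : ℤ) : Type (max u v) :=
  A.cocycles p ⧸ ((A.cochains (p - 1)).map (A.hochschildDiff (p - 1))).comap (A.cocycles p).subtype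

/-- The cocycles of degree `p` of the complex `A`. -/
def cyc (p : ℤ) : Submodule k A.carrier := A.grading.gr p ⊓ LinearMap.ker A.d

/-- The cohomology `H^p(A)` of the complex `A`. -/
abbrev H (p : ℤ) : Type v :=
  A.cyc p ⧸ ((A.grading.gr (p - 1)).map A.d).comap (A.cyc p).subtype

theorem eval_mem_cyc (p : ℤ) (f : TCo k A.augIdeal →ₗ[k] A.carrier) (hf : f ∈ A.cocycles p) :
    f 1 ∈ A.cyc p := by
  refine ⟨?_, ?_⟩
  · have := hf.1 0 1 (one_mem_degree _)
    rwa [zero_add] at this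
  · rw [SetLike.mem_coe, LinearMap.mem_ker, ← A.hochschildDiff_one p, LinearMap.mem_ker.1 hf.2]
    rfl

/-- The projection `Π : HH^p(A,A) → H^p(A)`, `[f] ↦ [f(1)]`, given by composing cochains with the
coaugmentation `k → BA`. -/
def projection (p : ℤ) : A.HH p →ₗ[k] A.H p :=
  Submodule.mapQ _ _ ((LinearMap.applyₗ (1 : TCo k A.augIdeal)).restrict (A.eval_mem_cyc p)) <| by
    rintro ⟨f, hf⟩ ⟨g, hg, hgf⟩
    refine ⟨g 1, ?_, ?_⟩
    · have := hg 0 1 (one_mem_degree _)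
      rwa [zero_add] at this
    · rw [← A.hochschildDiff_one (p - 1), hgf]
      rfl

/-- The projection `Π : HH^*(A,A) → H(A)` is surjective. For a minimal `A`, where `H(A) = A`, this
is the definition of `A` being `A_∞`-commutative. -/
def ProjectionSurjective : Prop := ∀ p, Function.Surjective (A.projection p)

/-- A minimal `A_∞`-algebra is `A_∞`-commutative if `Π : HH^*(A,A) → A` is surjective. -/
def IsAInfinityCommutative : Prop := A.IsMinimal ∧ A.ProjectionSurjective

end AInfinityAlgebra

/-! ### Dg algebras -/

/-- An augmented dg algebra over `k`. -/
structure DGAlgebra (k : Type u) [Field k] where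
  carrier : Type v
  [ring : Ring carrier]
  [algebra : Algebra k carrier]
  grading : Grading k carrier
  one_mem : (1 : carrier) ∈ grading.gr 0
  mul_mem : ∀ p q, ∀ a ∈ grading.gr p, ∀ b ∈ grading.gr q, a * b ∈ grading.gr (p + q)
  d : carrier →ₗ[k] carrier
  d_mem : ∀ p, ∀ a ∈ grading.gr p, d a ∈ grading.gr (p + 1)
  leibniz : ∀ p, ∀ a ∈ grading.gr p, ∀ b, d (a * b) = d a * b + (-1 : k) ^ p • (a * d b)
  d_d : ∀ a, d (d a) = 0
  aug : carrier →ₐ[k] k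
  aug_degree : ∀ p, p ≠ 0 → ∀ a ∈ grading.gr p, aug a = 0
  aug_d : ∀ a, aug (d a) = 0

attribute [instance] DGAlgebra.ring DGAlgebra.algebra

namespace DGAlgebra

variable {k : Type u} [Field k] (A : DGAlgebra.{u, v} k)

/-- The operations of a dg algebra, regarded as an `A_∞`-algebra. -/
def m : ∀ n : ℕ, MultilinearMap k (fun _ : Fin n => A.carrier) A.carrier
  | 1 => MultilinearMap.ofSubsingleton k A.carrier A.carrier (0 : Fin 1) A.d
  | 2 => MultilinearMap.mkPiAlgebraFin k 2 A.carrier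
  | _ => 0

theorem m_one_apply (a : Fin 1 → A.carrier) : A.m 1 a = A.d (a 0) := rfl

theorem m_two_apply (a : Fin 2 → A.carrier) : A.m 2 a = a 0 * a 1 := by
  simp [m, MultilinearMap.mkPiAlgebraFin_apply]

theorem m_eq_zero {n : ℕ} (h1 : n ≠ 1) (h2 : n ≠ 2) : A.m n = 0 := by
  match n, h1, h2 with
  | 0, _, _ => rfl
  | 1, h1, _ => exact absurd rfl h1
  | 2, _, h2 => exact absurd rfl h2
  | n + 3, _, _ => rfl

theorem d_one : A.d 1 = 0 := by
  have := A.leibniz 0 1 A.one_mem 1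
  simpa using this

theorem leibniz_sgn (a b : A.carrier) :
    A.d (a * b) = A.d a * b + A.grading.sgn 1 a * A.d b := by
  have : A.d ∘ₗ LinearMap.mulRight k b = LinearMap.mulRight k b ∘ₗ A.d +
      LinearMap.mulRight k (A.d b) ∘ₗ A.grading.sgn 1 := by
    refine A.grading.linear_ext fun p v hv => ?_
    simp [A.leibniz p v hv, Grading.sgn_of_mem _ _ hv]
  exact LinearMap.congr_fun this a

/-- The terms of the Stasheff identities. -/
def stasheffTerm (a : ℕ → A.carrier) (r s t : ℕ) : A.carrier :=
  A.m (r + 1 + t) fun i => if (i : ℕ) < r then A.grading.sgn (2 - s) (a i)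
    else if (i : ℕ) = r then A.m s (fun j => a (r + j)) else a (i + s - 1)

theorem stasheffTerm_eq_zero (a : ℕ → A.carrier) (r s t : ℕ)
    (h : (s ≠ 1 ∧ s ≠ 2) ∨ (r + 1 + t ≠ 1 ∧ r + 1 + t ≠ 2)) : A.stasheffTerm a r s t = 0 := by
  unfold stasheffTerm
  rcases h with ⟨h1, h2⟩ | ⟨h1, h2⟩
  · refine MultilinearMap.map_coord_zero _ (⟨r, by omega⟩ : Fin (r + 1 + t)) ?_
    simp [A.m_eq_zero h1 h2]
  · rw [A.m_eq_zero h1 h2]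
    rfl

theorem m_stasheff (n : ℕ) (a : ℕ → A.carrier) :
    ∑ p ∈ Finset.HasAntidiagonal.antidiagonal n, ∑ q ∈ Finset.HasAntidiagonal.antidiagonal p.2,
      (-1 : k) ^ (p.1 * q.1 + q.2) • A.stasheffTerm a p.1 q.1 q.2 = 0 := by
  have key := A.stasheffTerm_eq_zero a
  by_cases hn : n = 1 ∨ n = 2 ∨ n = 3
  · have e1 : A.stasheffTerm a 0 1 0 = 0 := A.d_d _
    have e2 : A.stasheffTerm a 0 1 1 = A.d (a 0) * a 1 := A.m_two_apply _
    have e3 : A.stasheffTerm a 1 1 0 = A.grading.sgn 1 (a 0) * A.d (a 1) := A.m_two_apply _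
    have e4 : A.stasheffTerm a 0 2 0 = A.d (a 0 * a 1) :=
      congrArg A.d (A.m_two_apply fun j => a (0 + j))
    have e5 : A.stasheffTerm a 0 2 1 = a 0 * a 1 * a 2 :=
      (A.m_two_apply _).trans (congrArg (· * a 2) (A.m_two_apply fun j => a (0 + j)))
    have e6 : A.stasheffTerm a 1 2 0 = a 0 * (a 1 * a 2) := by
      refine (A.m_two_apply _).trans ?_
      have h := A.m_two_apply fun j => a (1 + j)
      have h' : A.grading.sgn (2 - (2 : ℕ)) (a 0) = a 0 := Grading.sgn_even _ (by simp) _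
      calc _ = A.grading.sgn (2 - (2 : ℕ)) (a 0) * A.m 2 (fun j => a (1 + j)) := rfl
        _ = _ := by rw [h, h']; rfl
    rcases hn with rfl | rfl | rfl
    · simp only [Finset.Nat.sum_antidiagonal_succ, Finset.Nat.antidiagonal_zero,
        Finset.sum_singleton, zero_add, e1, key 0 0 1 (by omega), key 1 0 0 (by omega), smul_zero,
        add_zero]
    · simp only [Finset.Nat.sum_antidiagonal_succ, Finset.Nat.antidiagonal_zero,
        Finset.sum_singleton, zero_add, Nat.reduceAdd, e2, e3, e4, key 0 0 2 (by omega),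
        key 1 0 1 (by omega), key 2 0 0 (by omega), smul_zero, add_zero, A.leibniz_sgn]
      simp
    · simp only [Finset.Nat.sum_antidiagonal_succ, Finset.Nat.antidiagonal_zero,
        Finset.sum_singleton, zero_add, Nat.reduceAdd, e5, e6, key 0 0 3 (by omega),
        key 0 1 2 (by omega), key 0 3 0 (by omega), key 1 0 2 (by omega), key 1 1 1 (by omega),
        key 2 0 1 (by omega), key 2 1 0 (by omega), key 3 0 0 (by omega), smul_zero, add_zero]
      simp [mul_assoc]
  · refine Finset.sum_eq_zero fun p hp => Finset.sum_eq_zero fun q hq => ?_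
    simp only [Finset.HasAntidiagonal.mem_antidiagonal] at hp hq
    rw [key, smul_zero]
    omega

/-- A dg algebra as an `A_∞`-algebra: `m 1 = d`, `m 2` is the product, and the rest vanishes. -/
abbrev toAInfinity : AInfinityAlgebra.{u, v} k where
  carrier := A.carrier
  grading := A.grading
  m := A.m
  m_zero := rfl
  m_degree n p a ha := by
    by_cases h1 : n = 1
    · subst h1
      rw [m_one_apply]
      convert A.d_mem _ _ (ha 0) using 2
      simp
      ring
    · by_cases h2 : n = 2
      · subst h2
        rw [m_two_apply]
        convert A.mul_mem _ _ _ (ha 0) _ (ha 1) using 2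
        simp
      · rw [A.m_eq_zero h1 h2]
        exact Submodule.zero_mem _
  stasheff := A.m_stasheff
  one := 1
  one_mem := A.one_mem
  one_m a := by simp [m_two_apply]
  m_one a := by simp [m_two_apply]
  m_unit n h2 a := by
    rintro ⟨i, hi⟩
    by_cases h1 : n = 1
    · subst h1
      rw [m_one_apply, Subsingleton.elim 0 i, hi, d_one]
    · rw [A.m_eq_zero h1 h2]
      rfl
  aug := A.aug.toLinearMap
  aug_degree := A.aug_degree
  aug_one := map_one A.aug
  aug_m_two a b := by simp [m_two_apply]
  aug_m n h2 a := by
    by_cases h1 : n = 1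
    · subst h1
      exact A.aug_d _
    · rw [A.m_eq_zero h1 h2]
      exact map_zero _

end DGAlgebra

end

end AInf

/-! A Hochschild cocycle `f` of degree `p` is an infinitesimal symmetry of the symmetric coalgebra.
Composing `f` with the projection `A → Ā` along the unit gives a coderivation `hochCoder p f` of
`BA`, of degree `p - 1`, whose value at `1` is the letter `s f(1)` when `f(1)` lies in `Ā`. The part
of `f` with values in the line of the unit is lost. By strict unitality that part enters the cocycle
equation only through `b_2`, as the difference between splitting off the last letter and splitting
off the first letter of a word (`barOp_coext_unit`). This difference vanishes on symmetric tensors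
because `Sym^{co}` is graded cocommutative (`passLeft_decon`, `functional_decon`). Hence `hochCoder
p f` preserves symmetric tensors and graded-commutes with `b` on them (`barDiff_hochCoder`).

For a minimal `A_∞`-commutative `A`, every homogeneous `v` in `Ā` is `f(1)` for a cocycle `f`.
Suppose `b` vanishes on symmetric tensors of weight at most `n`, and let `y` be one. Then
`b_*(hochCoder p f y) = ± f(b y) = 0` after projection to `Ā`. Now `hochCoder p f y` is the signed
shuffle of `v` into `y`, of weight at most `n + 1`, plus symmetric tensors of weight at most `n`, on
which `b_*` vanishes by induction. So `b_*` vanishes on the shuffle of `v` and `y`. In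
characteristic zero such shuffles span the symmetric tensors of positive weight, since the shuffle
of the first letter of `x` into the rest is `x` times its weight (`wscale_eq_insert`). This is
`redBarOp_eq_zero`.

When the differential does not vanish, surjectivity of `Π` gives a graded space `H` of values of
cocycles that represents the cohomology of `Ā` (`exists_representatives`), together with a linear
family `D h` of the corresponding coderivations (`exists_coderivations`). The map `h₁ ⊗ ⋯ ⊗ hₙ ↦ (1
/ n!) D h₁ (⋯ (D hₙ 1))` is the exponential of this family. On `Sym^{co}(sH)` it is a morphism of
coalgebras (`decon_expFlow`). It takes values in the kernel of `b`, because `b 1 = 0` and the `D h`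
commute with `b` up to sign. Its weight one part is the inclusion of `H` into `Ā`, a
quasi-isomorphism. So `A^{Lie}` has a model all of whose operations vanish (`exists_trivial_model`),
which proves both quasi-abelianness and formality. -/

namespace AInf

noncomputable section

/-! ### Linear maps defined degree by degree -/

namespace Grading

variable {k : Type u} [Field k] {V : Type v} [AddCommGroup V] [Module k V]
variable {W : Type w} [AddCommGroup W] [Module k W]

/-- The linear map assembled from its restrictions to the homogeneous components. -/
def lift (G : Grading k V) (f : ∀ p, G.gr p →ₗ[k] W) : V →ₗ[k] W :=
  DirectSum.toModule k ℤ W f ∘ₗ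
    (LinearEquiv.ofBijective (DirectSum.coeLinearMap G.gr) G.internal).symm.toLinearMap

theorem lift_of_mem (G : Grading k V) (f : ∀ p, G.gr p →ₗ[k] W) {p : ℤ} {v : V}
    (hv : v ∈ G.gr p) : G.lift f v = f p ⟨v, hv⟩ := by
  have h : (LinearEquiv.ofBijective (DirectSum.coeLinearMap G.gr) G.internal).symm v
      = DirectSum.lof k ℤ (fun p => G.gr p) p ⟨v, hv⟩ := by
    rw [LinearEquiv.symm_apply_eq]
    exact (DirectSum.coeLinearMap_lof G.gr p ⟨v, hv⟩).symm
  simp only [lift, LinearMap.comp_apply, LinearEquiv.coe_coe, h, DirectSum.toModule_lof]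

end Grading

/-! ### Scaling by weight and the weight coderivation -/

section WeightScaling

variable {k : Type u} [Field k] {V : Type v} [AddCommGroup V] [Module k V]

open TensorAlgebra

/-- The endomorphism of `T^{co}(V)` acting on words of weight `n` as multiplication by `c n`. -/
def wscale (c : ℕ → k) : TCo k V →ₗ[k] TCo k V := ofFamily fun n => c n • TensorAlgebra.tprod k V n

theorem wscale_word (c : ℕ → k) (n : ℕ) (v : ℕ → V) :
    wscale c (word k n v) = c n • word k n v := by
  rw [wscale, ofFamily_word]
  rfl

theorem wscale_one (c : ℕ → k) : wscale c (1 : TCo k V) = c 0 • 1 := by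
  simpa [word_zero] using wscale_word c 0 (fun _ => (0 : V))

theorem wscale_ι_mul (c : ℕ → k) (v : V) (x : TCo k V) :
    wscale c (ι k v * x) = ι k v * wscale (fun n => c (n + 1)) x := by
  refine LinearMap.congr_fun (f := wscale c ∘ₗ LinearMap.mulLeft k (ι k v))
    (g := LinearMap.mulLeft k (ι k v) ∘ₗ wscale fun n => c (n + 1)) (tco_ext fun n u => ?_) x
  -- Words are indexed by sequences on `ℕ`, so `v` followed by `u` is encoded as one sequence with
  -- `v` in position `0`.
  have h := word_succ (k := k) n (fun i => if i = 0 then v else u (i - 1))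
  simp only [if_true, Nat.add_sub_cancel, Nat.add_eq_zero_iff, one_ne_zero, and_false,
    if_false] at h
  simp only [LinearMap.comp_apply, LinearMap.mulLeft_apply, wscale_word, ← h, mul_smul_comm]

theorem wscale_wscale (c c' : ℕ → k) (x : TCo k V) :
    wscale c (wscale c' x) = wscale (fun n => c n * c' n) x := by
  refine LinearMap.congr_fun (f := wscale c ∘ₗ wscale c') (tco_ext fun n u => ?_) x
  simp only [LinearMap.comp_apply, wscale_word, map_smul, smul_smul, mul_comm]

theorem counit_wscale (c : ℕ → k) (x : TCo k V) : counit (wscale c x) = c 0 * counit x := by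
  refine LinearMap.congr_fun (f := (counit : TCo k V →ₗ[k] k) ∘ₗ wscale c)
    (g := c 0 • counit) (tco_rec_ext ?_ fun v x _ => ?_) x
  · simp [wscale_one, counit_one]
  · simp [wscale_ι_mul, counit_ι_mul]

theorem peel_wscale (c : ℕ → k) (x : TCo k V) :
    peel (wscale c x) = TensorProduct.map LinearMap.id (wscale fun n => c (n + 1)) (peel x) := by
  refine LinearMap.congr_fun (f := peel ∘ₗ wscale c)
    (g := TensorProduct.map LinearMap.id (wscale fun n => c (n + 1)) ∘ₗ peel)
    (tco_rec_ext ?_ fun v x _ => ?_) x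
  · simp [wscale_one, peel_one]
  · simp [wscale_ι_mul, peel_ι_mul]

theorem wscale_glue (c : ℕ → k) (z : V ⊗[k] TCo k V) :
    wscale c (glue z) = glue (TensorProduct.map LinearMap.id (wscale fun n => c (n + 1)) z) := by
  refine LinearMap.congr_fun (f := wscale c ∘ₗ glue)
    (g := glue ∘ₗ TensorProduct.map LinearMap.id (wscale fun n => c (n + 1)))
    (TensorProduct.ext' fun v x => ?_) z
  simp [glue_tmul, wscale_ι_mul]

theorem braidLeft_map (G : Grading k V) (f : TCo k V →ₗ[k] TCo k V) (z : V ⊗[k] (V ⊗[k] TCo k V)) :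
    braidLeft G (TensorProduct.map LinearMap.id (TensorProduct.map LinearMap.id f) z) =
      TensorProduct.map LinearMap.id (TensorProduct.map LinearMap.id f) (braidLeft G z) := by
  induction z using TensorProduct.induction_on with
  | zero => simp
  | add a b ha hb => simp only [map_add, ha, hb]
  | tmul v z =>
    induction v using G.induction_gr with
    | h0 => simp
    | ha a b h h' => simp only [TensorProduct.add_tmul, map_add, h, h']
    | h p v hv =>
      rw [TensorProduct.map_tmul, LinearMap.id_apply, braidLeft_tmul_left G hv,
        braidLeft_tmul_left G hv, TensorProduct.map_map, TensorProduct.map_map]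
      rfl

/-- Exchanging two letters leaves the weight unchanged. As a consequence truncation and division by
the weight are available inside `Sym G`. -/
theorem swapAt_wscale (G : Grading k V) (i : ℕ) (c : ℕ → k) (x : TCo k V) :
    swapAt G i (wscale c x) = wscale c (swapAt G i x) := by
  induction i generalizing c x with
  | zero =>
    have h : peelTwo (wscale c x) = TensorProduct.map LinearMap.id
        (TensorProduct.map LinearMap.id (wscale fun n => c (n + 1 + 1))) (peelTwo x) := by
      have h' : peel ∘ₗ (wscale fun n => c (n + 1) : TCo k V →ₗ[k] TCo k V)
        = TensorProduct.map LinearMap.id (wscale fun n => c (n + 1 + 1)) ∘ₗ peel :=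
        LinearMap.ext (peel_wscale _)
      simp only [peelTwo, LinearMap.comp_apply, peel_wscale, TensorProduct.map_map, h',
        LinearMap.comp_id]
    have e : ∀ y : TCo k V, swapAt G 0 y = y + glue (TensorProduct.map LinearMap.id glue
        (braidLeft G (peelTwo y) - peelTwo y)) := fun y => by simp [swapAt, peelTwo]
    have h2 : (wscale fun n => c (n + 1)) ∘ₗ (glue : V ⊗[k] TCo k V →ₗ[k] _)
        = glue ∘ₗ TensorProduct.map LinearMap.id (wscale fun n => c (n + 1 + 1)) :=
      LinearMap.ext (wscale_glue _)
    rw [e, e, map_add, h, braidLeft_map, ← map_sub, wscale_glue, TensorProduct.map_map,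
      TensorProduct.map_map, h2]
  | succ i ih =>
    have h : swapAt G i ∘ₗ (wscale fun n => c (n + 1))
        = (wscale fun n => c (n + 1)) ∘ₗ swapAt G i := LinearMap.ext fun y => ih _ y
    simp only [swapAt, LinearMap.add_apply, LinearMap.comp_apply, LinearMap.smulRight_apply,
      map_add, map_smul, wscale_one, counit_wscale, peel_wscale, wscale_glue,
      TensorProduct.map_map, h, smul_smul, mul_comm]

theorem wscale_mem_Sym (G : Grading k V) (c : ℕ → k) {x : TCo k V} (hx : x ∈ Sym G) :
    wscale c x ∈ Sym G :=
  (mem_Sym G).2 fun i => by rw [swapAt_wscale, (mem_Sym G).1 hx]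

/-- Weights add under deconcatenation, so the operator multiplying by the weight is a coderivation
of degree zero. -/
theorem decon_wscale_add (x : TCo k V) :
    decon (wscale (fun n => (n : k)) x) =
      TensorProduct.map (wscale fun n => (n : k)) LinearMap.id (decon x) +
      TensorProduct.map LinearMap.id (wscale fun n => (n : k)) (decon x) := by
  refine LinearMap.congr_fun (f := decon ∘ₗ wscale fun n => (n : k))
    (g := TensorProduct.map (wscale fun n => (n : k)) LinearMap.id ∘ₗ decon +
      TensorProduct.map LinearMap.id (wscale fun n => (n : k)) ∘ₗ decon)
    (tco_ext fun n v => ?_) x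
  simp only [LinearMap.comp_apply, LinearMap.add_apply, wscale_word, map_smul, decon_word, map_sum,
    TensorProduct.map_tmul, LinearMap.id_apply, Finset.smul_sum, ← Finset.sum_add_distrib]
  refine Finset.sum_congr rfl fun p hp => ?_
  rw [← Finset.HasAntidiagonal.mem_antidiagonal.1 hp, TensorProduct.tmul_smul,
    ← TensorProduct.smul_tmul', ← add_smul, Nat.cast_add]

/-- A word of weight `n` can be cut in `n + 1` places, and gluing each cut back together returns the
word. Together with cocommutativity this gives `wscale_eq_insert`. -/
theorem mul_decon (x : TCo k V) :
    LinearMap.mul' k (TCo k V) (decon x) = x + wscale (fun n => (n : k)) x := by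
  refine LinearMap.congr_fun (f := LinearMap.mul' k (TCo k V) ∘ₗ decon)
    (g := LinearMap.id + wscale fun n => (n : k)) (tco_rec_ext ?_ fun v x h => ?_) x
  · simp [decon_one, wscale_one]
  · have e : LinearMap.mul' k (TCo k V) ∘ₗ
        TensorProduct.map (LinearMap.mulLeft k (ι k v)) LinearMap.id
        = LinearMap.mulLeft k (ι k v) ∘ₗ LinearMap.mul' k (TCo k V) :=
      TensorProduct.ext' fun a b => by simp [mul_assoc]
    have e' := LinearMap.congr_fun e (decon x)
    have hw : (wscale (fun n => ((n + 1 : ℕ) : k)) : TCo k V →ₗ[k] _)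
        = LinearMap.id + wscale fun n => (n : k) :=
      tco_ext fun n v => by simp [wscale_word, add_smul, add_comm]
    simp only [LinearMap.comp_apply, LinearMap.add_apply, LinearMap.id_apply,
      LinearMap.mulLeft_apply] at h e' ⊢
    rw [decon_ι_mul, map_add, e', h, wscale_ι_mul, hw, LinearMap.mul'_apply, one_mul,
      LinearMap.add_apply, LinearMap.id_apply]

/-- Every tensor is, up to a constant, in the image of the weight operator. -/
theorem eq_counit_add_wscale [CharZero k] (x : TCo k V) :
    x = counit x • 1 + wscale (fun n => (n : k)) (wscale (fun n => (n : k)⁻¹) x) := by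
  refine LinearMap.congr_fun (f := LinearMap.id) (g := (counit : TCo k V →ₗ[k] k).smulRight 1 +
    (wscale fun n => (n : k)) ∘ₗ wscale fun n => (n : k)⁻¹) (tco_ext fun n v => ?_) x
  simp only [LinearMap.id_apply, LinearMap.add_apply, LinearMap.smulRight_apply,
    LinearMap.comp_apply, wscale_word, map_smul, smul_smul]
  -- In weight zero both `0` and `0⁻¹ = 0` kill the second term and the counit supplies the word; in
  -- positive weight the counit vanishes and the two factors cancel.
  cases n with
  | zero => simp [word_zero, counit_one]
  | succ n =>
    rw [inv_mul_cancel₀ (by exact_mod_cast n.succ_ne_zero), word_succ, counit_ι_mul]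
    simp

end WeightScaling

/-! ### Graded cocommutativity of the symmetric coalgebra -/

section Cocommutativity

variable {k : Type u} [Field k] {V : Type v} [AddCommGroup V] [Module k V]

open TensorAlgebra

/-- The map `v ⊗ (x ⊗ y) ↦ (-1)^{|v| |x|} x ⊗ (v ⊗ y)`. -/
def passLeft (G : Grading k V) :
    V ⊗[k] (TCo k V ⊗[k] TCo k V) →ₗ[k] TCo k V ⊗[k] (V ⊗[k] TCo k V) :=
  -- The Koszul sign depends on the degree of the moving letter `v`, so the map is assembled from
  -- the homogeneous components of the first factor.
  TensorProduct.lift (G.lift (W := TCo k V ⊗[k] TCo k V →ₗ[k] TCo k V ⊗[k] (V ⊗[k] TCo k V)) fun p =>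
    TensorProduct.mapBilinear _ _ _ _ _ (tmap (G.sgn p)).toLinearMap ∘ₗ
      TensorProduct.mk k V (TCo k V) ∘ₗ (G.gr p).subtype)

theorem passLeft_tmul (G : Grading k V) {p : ℤ} {v : V} (hv : v ∈ G.gr p)
    (z : TCo k V ⊗[k] TCo k V) : passLeft G (v ⊗ₜ[k] z) =
      TensorProduct.map (tmap (G.sgn p)).toLinearMap (TensorProduct.mk k V (TCo k V) v) z := by
  rw [passLeft, TensorProduct.lift.tmul, Grading.lift_of_mem _ _ hv]
  rfl

/-- Graded cocommutativity of `Sym^{co}(V)`: moving the first letter of a symmetric tensor to the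
front of the second factor of its coproduct. -/
theorem passLeft_decon (G : Grading k V) (x : TCo k V) (hx : x ∈ Sym G) :
    passLeft G (TensorProduct.map LinearMap.id decon (peel x)) =
      TensorProduct.map LinearMap.id peel (decon x) := by
  refine Sym_induction G (P := fun x => passLeft G (TensorProduct.map LinearMap.id decon (peel x)) =
      TensorProduct.map LinearMap.id peel (decon x)) (fun x hx hz => ?_) x hx
  -- `θ (w ⊗ (v ⊗ y))` keeps `w` as the first letter of the left factor and moves `v` past the rest
  -- of that factor. Both sides of the claim are `1 ⊗ peel x` plus a value of `θ`: at `braidLeft G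
  -- (peelTwo x)` on the left, at `peelTwo x` on the right.
  set θ : V ⊗[k] (V ⊗[k] TCo k V) →ₗ[k] TCo k V ⊗[k] (V ⊗[k] TCo k V) :=
    TensorProduct.map glue LinearMap.id ∘ₗ
      (TensorProduct.assoc k V (TCo k V) (V ⊗[k] TCo k V)).symm.toLinearMap ∘ₗ
      TensorProduct.map LinearMap.id (passLeft G ∘ₗ TensorProduct.map LinearMap.id decon) with hθ
  have hθ1 : ∀ (w : V) (z : V ⊗[k] TCo k V), θ (w ⊗ₜ[k] z) =
      TensorProduct.map (LinearMap.mulLeft k (ι k w)) LinearMap.id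
        (passLeft G (TensorProduct.map LinearMap.id decon z)) := by
    intro w z
    have : TensorProduct.map glue LinearMap.id ∘ₗ
        (TensorProduct.assoc k V (TCo k V) (V ⊗[k] TCo k V)).symm.toLinearMap ∘ₗ
        TensorProduct.mk k V _ w
        = TensorProduct.map (LinearMap.mulLeft k (ι k w)) LinearMap.id :=
      TensorProduct.ext' fun a b => by simp [glue_tmul]
    exact LinearMap.congr_fun this _
  -- the part in which a letter is moved past the first letter of the rest
  have h1 : ∀ u : V ⊗[k] (V ⊗[k] TCo k V),
      passLeft G (TensorProduct.map LinearMap.id deconPeel u) = θ (braidLeft G u) := by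
    intro u
    induction u using TensorProduct.induction_on with
    | zero => simp
    | add a b ha hb => simp only [map_add, ha, hb]
    | tmul v z =>
      induction v using G.induction_gr with
      | h0 => simp
      | ha a b h h' => simp only [TensorProduct.add_tmul, map_add, h, h']
      | h p v hv =>
        rw [braidLeft_tmul_left G hv, TensorProduct.map_tmul, LinearMap.id_apply,
          passLeft_tmul G hv]
        induction z using TensorProduct.induction_on with
        | zero => simp
        | add a b ha hb => simp only [map_add, ha, hb]
        | tmul w y =>
          rw [TensorProduct.map_tmul, hθ1, TensorProduct.mk_apply, TensorProduct.map_tmul,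
            LinearMap.id_apply, passLeft_tmul G hv, deconPeel_tmul, TensorProduct.map_map, TensorProduct.map_map]
          congr 2
          ext a
          simp [tmap_ι]
  have h2 : passLeft G (TensorProduct.map LinearMap.id (TensorProduct.mk k _ _ 1) (peel x))
      = TensorProduct.mk k _ _ 1 (peel x) := by
    generalize peel x = z
    induction z using TensorProduct.induction_on with
    | zero => simp
    | add a b ha hb => simp only [map_add, ha, hb]
    | tmul v y =>
      induction v using G.induction_gr with
      | h0 => simp
      | ha a b h h' => simp only [TensorProduct.add_tmul, map_add, h, h']
      | h p v hv => simp [passLeft_tmul G hv]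
  have h3 : (decon : TCo k V →ₗ[k] _) = TensorProduct.mk k (TCo k V) (TCo k V) 1 +
      deconPeel ∘ₗ peel := LinearMap.ext decon_eq
  -- The induction hypothesis enters here, for the symmetric rest `y` after the first letter.
  have h4 : θ (peelTwo x) = TensorProduct.map LinearMap.id peel (deconPeel (peel x)) := by
    rw [peelTwo, LinearMap.comp_apply]
    refine eq_of_mem_span (f := θ ∘ₗ TensorProduct.map LinearMap.id peel)
      (g := TensorProduct.map LinearMap.id peel ∘ₗ deconPeel) ?_ hz
    rintro _ ⟨p, v, hv, y, hy, hP, rfl⟩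
    change θ (TensorProduct.map LinearMap.id peel (v ⊗ₜ[k] y)) =
      TensorProduct.map LinearMap.id peel (deconPeel (v ⊗ₜ[k] y))
    rw [TensorProduct.map_tmul, LinearMap.id_apply, hθ1, hP, deconPeel_tmul,
      TensorProduct.map_map, TensorProduct.map_map]
    simp
  have h5 : TensorProduct.map LinearMap.id (deconPeel ∘ₗ peel) (peel x)
      = TensorProduct.map LinearMap.id deconPeel (peelTwo x) := by
    rw [peelTwo, LinearMap.comp_apply, TensorProduct.map_map, LinearMap.id_comp]
  -- Invariance of `x` under the transposition of its first two letters makes the two values of `θ`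
  -- equal.
  rw [decon_eq x, map_add, ← h4, ← braidLeft_peelTwo G ((mem_Sym G).1 hx 0), ← h1, h3,
    TensorProduct.map_add_right, LinearMap.add_apply, map_add, h2, h5]
  simp

/-- Either `α` is applied to a prefix, possibly empty, or it first passes the leading letter and
picks up its sign. This recursion on the first letter is what `Sym_induction` needs. -/
theorem coext_eq (G : Grading k V) (n : ℤ) (α : TCo k V →ₗ[k] V) (x : TCo k V) :
    coext G LinearMap.id n α x = glue (TensorProduct.map α LinearMap.id (decon x)) +
      glue (TensorProduct.map (G.sgn n) (coext G LinearMap.id n α) (peel x)) := by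
  have hid : (tmap (LinearMap.id : V →ₗ[k] V)).toLinearMap = LinearMap.id :=
    tco_ext fun n v => by simp [map_word]
  have hE : ∀ x : TCo k V, prefixExt LinearMap.id α x
      = glue (TensorProduct.map α LinearMap.id (decon x)) := by
    intro x
    rw [prefixExt, hid, glue, LinearMap.comp_apply, LinearMap.comp_apply, LinearMap.comp_apply,
      TensorProduct.map_map, LinearMap.comp_id]
  refine LinearMap.congr_fun (f := coext G LinearMap.id n α)
    (g := glue ∘ₗ TensorProduct.map α LinearMap.id ∘ₗ decon +
      glue ∘ₗ TensorProduct.map (G.sgn n) (coext G LinearMap.id n α) ∘ₗ peel)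
    (tco_rec_ext ?_ fun v x _ => ?_) x
  · simp [coext_one, peel_one, decon_one, glue_tmul]
  · simp only [coext_ι_mul, hE, LinearMap.add_apply, LinearMap.comp_apply, peel_ι_mul,
      TensorProduct.map_tmul, glue_tmul, LinearMap.id_apply]

/-- A coextension vanishes on symmetric tensors if its component does. -/
theorem coext_eq_zero_of_Sym (G : Grading k V) (n : ℤ) {α : TCo k V →ₗ[k] V}
    (hα : ∀ x ∈ Sym G, α x = 0) {x : TCo k V} (hx : x ∈ Sym G) :
    coext G LinearMap.id n α x = 0 := by
  refine Sym_induction G (P := fun x => coext G LinearMap.id n α x = 0) (fun x hx hz => ?_) x hx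
  -- The coproduct of `x` lies in `Sym G ⊗ Sym G`, so `α` only ever sees symmetric prefixes.
  have h1 : TensorProduct.map α LinearMap.id (decon x) = 0 := by
    obtain ⟨z, hz⟩ := decon_mem_range G ⟨x, hx⟩
    have h0 : α ∘ₗ (Sym G).subtype = 0 := LinearMap.ext fun y => hα y y.2
    rw [show decon x = _ from hz.symm, TensorProduct.map_map, h0, TensorProduct.map_zero_left,
      LinearMap.zero_apply]
  have h2 : TensorProduct.map (G.sgn n) (coext G LinearMap.id n α) (peel x) = 0 := by
    refine eq_of_mem_span (g := 0) ?_ hz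
    rintro _ ⟨p, v, hv, y, hy, hP, rfl⟩
    rw [TensorProduct.map_tmul, hP, TensorProduct.tmul_zero, LinearMap.zero_apply]
  rw [coext_eq, h1, h2, map_zero, add_zero]

end Cocommutativity

/-! ### Homogeneous maps, Koszul signs, and splitting off the last letter -/

section DegreeInduction

variable {k : Type u} [Field k] {V : Type v} [AddCommGroup V] [Module k V]
variable {W : Type w} [AddCommGroup W] [Module k W]

open TensorAlgebra

theorem iSup_degree (G : Grading k V) : ⨆ d, degree G d = ⊤ := by
  have : (⨆ d, degree G d).mkQ = 0 := by
    refine tco_rec_ext ?_ fun v x hx => ?_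
    · rw [LinearMap.zero_apply, Submodule.mkQ_apply, Submodule.Quotient.mk_eq_zero]
      exact Submodule.mem_iSup_of_mem 0 (one_mem_degree G)
    · rw [LinearMap.zero_apply, Submodule.mkQ_apply, Submodule.Quotient.mk_eq_zero] at hx ⊢
      induction v using G.induction_gr with
      | h0 => simp
      | ha a b h h' => rw [map_add, add_mul]; exact add_mem h h'
      | h p v hv =>
        refine (iSup_le fun d y hy => ?_ : ⨆ d, degree G d ≤
          (⨆ d, degree G d).comap (LinearMap.mulLeft k (ι k v))) hx
        exact Submodule.mem_iSup_of_mem (p + d) (mul_mem_degree G (ι_mem_degree G hv) hy)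
  rw [← Submodule.ker_mkQ (⨆ d, degree G d), this, LinearMap.ker_zero]

theorem degree_ext (G : Grading k V) {f g : TCo k V →ₗ[k] W}
    (h : ∀ d, ∀ x ∈ degree G d, f x = g x) : f = g := by
  refine LinearMap.ext fun x => ?_
  have hx : x ∈ ⨆ d, degree G d := iSup_degree G ▸ Submodule.mem_top
  exact (iSup_le fun d y hy => h d y hy : ⨆ d, degree G d ≤ LinearMap.eqLocus f g) hx

theorem tmap_sgn_of_mem (G : Grading k V) (m : ℤ) {d : ℤ} {x : TCo k V} (hx : x ∈ degree G d) :
    tmap (G.sgn m) x = (-1 : k) ^ (m * d) • x := by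
  refine (Submodule.span_le (p := LinearMap.eqLocus (tmap (G.sgn m)).toLinearMap
    ((-1 : k) ^ (m * d) • LinearMap.id))).2 ?_ hx
  rintro _ ⟨n, p, v, hv, rfl, rfl⟩
  rw [SetLike.mem_coe, LinearMap.mem_eqLocus, AlgHom.toLinearMap_apply, LinearMap.smul_apply,
    LinearMap.id_apply, map_word]
  clear hx
  induction n generalizing p v with
  | zero => simp [word_zero]
  | succ n ih =>
    rw [word_succ, word_succ, ih (fun i => p (i + 1)) (fun i => v (i + 1))
      fun i hi => hv (i + 1) (by omega), Grading.sgn_of_mem _ _ (hv 0 (by omega)),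
      Finset.sum_range_succ', map_smul, smul_mul_smul_comm, ← zpow_add₀ (by simp)]
    congr 2
    ring

/-- Homogeneous maps commute with the sign operators up to the Koszul sign. -/
theorem sgn_apply_of_degree (G : Grading k V) (G' : Grading k W) {n : ℤ} {α : TCo k V →ₗ[k] W}
    (hα : ∀ d, ∀ x ∈ degree G d, α x ∈ G'.gr (d + n)) (m : ℤ) (x : TCo k V) :
    G'.sgn m (α x) = (-1 : k) ^ (m * n) • α (tmap (G.sgn m) x) := by
  refine LinearMap.congr_fun (f := G'.sgn m ∘ₗ α)
    (g := (-1 : k) ^ (m * n) • (α ∘ₗ (tmap (G.sgn m)).toLinearMap))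
    (degree_ext G fun d x hx => ?_) x
  simp only [LinearMap.comp_apply, LinearMap.smul_apply, AlgHom.toLinearMap_apply,
    Grading.sgn_of_mem _ _ (hα d x hx), tmap_sgn_of_mem G m hx, map_smul, smul_smul]
  rw [← zpow_add₀ (by simp)]
  congr 2
  ring

theorem proj_word (n : ℕ) (v : ℕ → V) :
    proj (word k n v) = if n = 1 then v 0 else 0 := by
  rcases n with - | - | n
  · simp [word_zero, proj_one]
  · simp [word_one, proj_ι]
  · rw [word_succ, proj_ι_mul, word_succ, counit_ι_mul]
    simp

/-- Factoring `proj` through `peel` is what makes `passLeft_decon` applicable to `proj` in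
`functional_decon`. -/
theorem proj_eq (x : TCo k V) :
    proj x = TensorProduct.rid k V (TensorProduct.map LinearMap.id counit (peel x)) := by
  refine LinearMap.congr_fun (g := (TensorProduct.rid k V).toLinearMap ∘ₗ
    TensorProduct.map LinearMap.id counit ∘ₗ peel) (tco_rec_ext ?_ fun v x _ => ?_) x
  · simp [proj_one, peel_one]
  · simp [proj_ι_mul, peel_ι_mul]

/-- Cocommutativity: splitting off the last letter of a symmetric tensor instead of the first. -/
theorem functional_decon (G : Grading k V) {p : ℤ} {φ : TCo k V →ₗ[k] k}
    (hφ : ∀ (m : ℤ) (x : TCo k V), φ (tmap (G.sgn m) x) = (-1 : k) ^ (m * p) * φ x)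
    {x : TCo k V} (hx : x ∈ Sym G) :
    TensorProduct.lid k V (TensorProduct.map φ proj (decon x)) =
      TensorProduct.rid k V (TensorProduct.map (G.sgn p) φ (peel x)) := by
  have h0 : (proj : TCo k V →ₗ[k] V) = ((TensorProduct.rid k V).toLinearMap ∘ₗ
      TensorProduct.map LinearMap.id counit) ∘ₗ peel := LinearMap.ext proj_eq
  have h1 : TensorProduct.map φ proj (decon x) = TensorProduct.map φ
      ((TensorProduct.rid k V).toLinearMap ∘ₗ TensorProduct.map LinearMap.id counit)
      (passLeft G (TensorProduct.map LinearMap.id decon (peel x))) := by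
    rw [passLeft_decon G x hx, TensorProduct.map_map, ← h0, LinearMap.comp_id]
  rw [h1]
  generalize peel x = z
  induction z using TensorProduct.induction_on with
  | zero => simp
  | add a b ha hb => simp only [map_add, ha, hb]
  | tmul v y =>
    induction v using G.induction_gr with
    | h0 => simp
    | ha a b h h' => simp only [TensorProduct.add_tmul, map_add, h, h']
    | h q v hv =>
      rw [TensorProduct.map_tmul, LinearMap.id_apply, passLeft_tmul G hv, TensorProduct.map_map]
      -- Once `v` heads the second factor, the counit allows nothing after it: only the term where
      -- `v` has become the last letter survives, with `φ` evaluated on all of `y`.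
      have e : TensorProduct.map (φ ∘ₗ (tmap (G.sgn q)).toLinearMap)
          (((TensorProduct.rid k V).toLinearMap ∘ₗ TensorProduct.map LinearMap.id counit) ∘ₗ
            TensorProduct.mk k V (TCo k V) v)
          = TensorProduct.map (φ ∘ₗ (tmap (G.sgn q)).toLinearMap)
            (LinearMap.toSpanSingleton k V v) ∘ₗ TensorProduct.map LinearMap.id counit :=
        TensorProduct.ext' fun a b => by simp
      rw [e, LinearMap.comp_apply, decon_counit', TensorProduct.map_tmul, TensorProduct.map_tmul,
        LinearMap.comp_apply, AlgHom.toLinearMap_apply, hφ, Grading.sgn_of_mem _ _ hv]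
      simp [smul_smul, mul_comm]

/-- Used for the inclusion of `Ā` into `A`: it compares the coderivation of `BA` with the
coextension that appears in `hochschildDiff`. -/
theorem tmap_coext (G : Grading k V) (g : V →ₗ[k] W) (n : ℤ) (α : TCo k V →ₗ[k] V) (x : TCo k V) :
    tmap g (coext G LinearMap.id n α x) = coext G g n (g ∘ₗ α) x := by
  refine LinearMap.congr_fun (f := (tmap g).toLinearMap ∘ₗ coext G LinearMap.id n α)
    (tco_ext fun N v => ?_) x
  simp only [LinearMap.comp_apply, AlgHom.toLinearMap_apply, coext_word', map_word, map_sum,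
    map_mul, tmap_ι, LinearMap.id_apply]

end DegreeInduction

/-! ### Hochschild cocycles as coderivations commuting with the codifferential -/

namespace AInfinityAlgebra

variable {k : Type u} [Field k] (A : AInfinityAlgebra.{u, v} k)

open TensorAlgebra

/-- The projection `A → Ā` along the unit. -/
def redProj : A.carrier →ₗ[k] A.augIdeal :=
  (LinearMap.id - A.aug.smulRight A.one).codRestrict A.augIdeal fun a => by simp [A.aug_one]

theorem coe_redProj (a : A.carrier) : (A.redProj a : A.carrier) = a - A.aug a • A.one := rfl

theorem redProj_coe (a : A.augIdeal) : A.redProj a = a :=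
  Subtype.ext (by rw [coe_redProj, LinearMap.mem_ker.1 a.2, zero_smul, sub_zero])

theorem redProj_mem {q : ℤ} {a : A.carrier} (ha : a ∈ A.grading.gr q) :
    A.redProj a ∈ A.augGrading.gr q := by
  change (A.redProj a : A.carrier) ∈ A.grading.gr q
  rw [coe_redProj]
  by_cases hq : q = 0
  · subst hq
    exact sub_mem ha (Submodule.smul_mem _ _ A.one_mem)
  · rw [A.aug_degree q hq a ha, zero_smul, sub_zero]
    exact ha

/-- Strict unitality transported through suspension: the Koszul sign operator only rescales the
unit, so `m_unit` still applies. -/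
theorem barOp_word_one {n : ℕ} (hn : n ≠ 2) (a : ℕ → A.carrier) {i : ℕ} (hi : i < n)
    (h : a i = A.one) : A.barOp (word k n a) = 0 := by
  have h1 : A.one ∈ A.grading.shift.gr (-1) := by
    rw [Grading.mem_shift]
    exact A.one_mem
  -- The suspended unit has degree `-1`, so in position `i` it is multiplied by this sign. Pulling
  -- it out leaves the bare unit required by `m_unit`.
  set c : Fin n → k := fun j => if (j : ℕ) = i then (-1) ^ (((n : ℤ) - 1 - i) * -1) else 1
  have e : (fun j : Fin n => A.grading.shift.sgn ((n : ℤ) - 1 - j) (a j))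
      = fun j => c j • if (j : ℕ) = i then A.one else
        A.grading.shift.sgn ((n : ℤ) - 1 - j) (a j) := by
    ext j
    by_cases hj : (j : ℕ) = i
    · simp only [c, hj, if_true, h, Grading.sgn_of_mem _ _ h1]
    · simp only [c, hj, if_false, one_smul]
  rw [barOp_word, e, MultilinearMap.map_smul_univ, A.m_unit n hn _ ⟨⟨i, hi⟩, if_pos rfl⟩,
    smul_zero, neg_zero]

theorem barOp_unit_mul (w : A.carrier) : A.barOp (ι k A.one * ι k w) = w := by
  have h1 : A.one ∈ A.grading.shift.gr (-1) := by
    rw [Grading.mem_shift]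
    exact A.one_mem
  have h := A.barOp_word 2 fun i => if i = 0 then A.one else w
  have e : (fun i : Fin 2 => A.grading.shift.sgn (((2 : ℕ) : ℤ) - 1 - i)
      (if (i : ℕ) = 0 then A.one else w))
      -- The sign `-1` from the odd suspended unit in the first slot cancels the minus sign in `b_2
      -- = -s m_2 (s⁻¹ ⊗ s⁻¹)`.
      = fun i => (![-1, 1] : Fin 2 → k) i • (![A.one, w] : Fin 2 → A.carrier) i := by
    ext i
    fin_cases i
    · simp [Grading.sgn_of_mem _ _ h1]
    · simp [Grading.sgn_even]
  rw [e, MultilinearMap.map_smul_univ, A.one_m] at h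
  simpa [word_succ, word_zero] using h

theorem barOp_mul_unit (w : A.carrier) :
    A.barOp (ι k w * ι k A.one) = - A.grading.shift.sgn 1 w := by
  have h := A.barOp_word 2 fun i => if i = 0 then w else A.one
  have e : (fun i : Fin 2 => A.grading.shift.sgn (((2 : ℕ) : ℤ) - 1 - i)
      (if (i : ℕ) = 0 then w else A.one)) = ![A.grading.shift.sgn 1 w, A.one] := by
    ext i
    fin_cases i
    · simp
    · simp [Grading.sgn_even]
  rw [e, A.m_one] at h
  simpa [word_succ, word_zero] using h

/-- Only `b_2` sees the inserted unit, so exactly one letter remains outside the subword fed to `φ`: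
the last one, giving the first term, or the first one, giving the second. The sign `sgn (p - 1)` for
passing `s f` combines with the `sgn 1` of `barOp_mul_unit` into `sgn p`. The result is a
commutator-like expression that cocommutativity kills. -/
theorem barOp_coext_unit (p : ℤ) (φ : TCo k A.augIdeal →ₗ[k] k) (x : TCo k A.augIdeal) :
    A.barOp (coext A.barGrading A.augIdeal.subtype (p - 1) (φ.smulRight A.one) x) =
      ((TensorProduct.lid k _ (TensorProduct.map φ proj (decon x)) -
        TensorProduct.rid k _ (TensorProduct.map (A.barGrading.sgn p) φ (peel x)) : A.augIdeal) :
        A.carrier) := by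
  refine LinearMap.congr_fun (f := A.barOp ∘ₗ coext A.barGrading A.augIdeal.subtype (p - 1)
    (φ.smulRight A.one)) (g := A.augIdeal.subtype ∘ₗ ((TensorProduct.lid k _).toLinearMap ∘ₗ
      TensorProduct.map φ proj ∘ₗ decon - (TensorProduct.rid k _).toLinearMap ∘ₗ
      TensorProduct.map (A.barGrading.sgn p) φ ∘ₗ peel)) (tco_ext fun N v => ?_) x
  -- `g r s t` is the term with `r` letters before the inserted unit, `s` letters fed to `φ`, and
  -- `t` letters after. It vanishes unless `r + t = 1`.
  set g : ℕ → ℕ → ℕ → A.carrier := fun r s t => φ (word k s fun i => v (r + i)) •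
    A.barOp (word k r (fun i => (A.barGrading.sgn (p - 1) (v i) : A.carrier)) *
      (ι k A.one * word k t fun i => (v (r + (s + i)) : A.carrier))) with hg
  have hg0 : ∀ r s t, r + t ≠ 1 → g r s t = 0 := by
    intro r s t h
    have h1 := word_one (k := k) (fun _ : ℕ => A.one)
    simp only [hg]
    rw [← h1, word_mul_word, word_mul_word, A.barOp_word_one (by omega) _ (i := r) (by omega)
      (by simp), smul_zero]
  have hL : A.barOp (coext A.barGrading A.augIdeal.subtype (p - 1) (φ.smulRight A.one)
      (word k N v)) = ∑ q ∈ Finset.HasAntidiagonal.antidiagonal N,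
        ∑ q' ∈ Finset.HasAntidiagonal.antidiagonal q.2, g q.1 q'.1 q'.2 := by
    simp only [coext_word', map_sum, LinearMap.smulRight_apply, map_smul, smul_mul_assoc,
      mul_smul_comm, hg, Submodule.subtype_apply]
  simp only [LinearMap.comp_apply, LinearMap.sub_apply, LinearEquiv.coe_coe]
  rw [hL]
  cases N with
  | zero =>
    simp [hg0, word_zero, decon_one, proj_one, peel_one]
  | succ M =>
    -- With `N = M + 1` the surviving triples are `(r, s, t) = (0, M, 1)` and `(1, M, 0)`. The pair
    -- `(0, M)` selects `r = 1`, because the sum over `r > 0` has been shifted by one.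
    rw [Finset.Nat.sum_antidiagonal_succ, Finset.sum_eq_single (M, 1), Finset.sum_eq_single (0, M),
      Finset.sum_eq_single (M, 0)]
    · rw [decon_word, map_sum, map_sum, Finset.sum_eq_single (M, 1), word_succ (n := M), peel_ι_mul]
      · simp [hg, word_zero, word_one, proj_ι, barOp_unit_mul, barOp_mul_unit,
          coe_barGrading_sgn, Grading.sgn_sgn, sub_eq_add_neg, add_comm]
      · rintro ⟨a, b⟩ hab hne
        rw [Finset.HasAntidiagonal.mem_antidiagonal] at hab
        have : b ≠ 1 := by
          rintro rfl
          exact hne (by simp at hab; simp [hab])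
        simp [proj_word, this]
      · simp
    · rintro ⟨a, b⟩ hab hne
      rw [Finset.HasAntidiagonal.mem_antidiagonal] at hab
      refine hg0 _ _ _ fun h => hne ?_
      simp only [Prod.mk.injEq] at *
      omega
    · simp
    · rintro ⟨a, b⟩ hab hne
      rw [Finset.HasAntidiagonal.mem_antidiagonal] at hab
      refine Finset.sum_eq_zero fun q hq => hg0 _ _ _ fun h => hne ?_
      simp only [Prod.mk.injEq] at *
      omega
    · simp
    · rintro ⟨a, b⟩ hab hne
      rw [Finset.HasAntidiagonal.mem_antidiagonal] at hab
      refine hg0 _ _ _ fun h => hne ?_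
      simp only [Prod.mk.injEq] at *
      omega
    · simp

/-- The coderivation of `BA` determined by a Hochschild cochain, with values projected to `Ā`. -/
def hochCoder (p : ℤ) (f : TCo k A.augIdeal →ₗ[k] A.carrier) :
    TCo k A.augIdeal →ₗ[k] TCo k A.augIdeal :=
  coext A.barGrading LinearMap.id (p - 1) (A.redProj ∘ₗ f)

variable {A}

theorem redProj_comp_degree {p : ℤ} {f : TCo k A.augIdeal →ₗ[k] A.carrier} (hf : f ∈ A.cochains p)
    (d : ℤ) (x : TCo k A.augIdeal) (hx : x ∈ degree A.barGrading d) :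
    (A.redProj ∘ₗ f) x ∈ A.barGrading.gr (d + (p - 1)) := by
  have h := A.redProj_mem (hf d x hx)
  rw [barGrading, Grading.mem_shift, add_assoc, sub_add_cancel]
  exact h

theorem redProj_comp_sgn {p : ℤ} {f : TCo k A.augIdeal →ₗ[k] A.carrier} (hf : f ∈ A.cochains p)
    (m : ℤ) (x : TCo k A.augIdeal) : A.barGrading.sgn m ((A.redProj ∘ₗ f) x) =
      (-1 : k) ^ (m * (p - 1)) • (A.redProj ∘ₗ f) (tmap (A.barGrading.sgn m) x) :=
  sgn_apply_of_degree _ _ (redProj_comp_degree hf) m x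

/-- The augmentation lives in degree zero and so ignores the sign operators; this gives the
functional `A.aug ∘ₗ f` the parity `p` required by `functional_decon`. -/
theorem aug_comp_sgn {p : ℤ} {f : TCo k A.augIdeal →ₗ[k] A.carrier} (hf : f ∈ A.cochains p)
    (m : ℤ) (x : TCo k A.augIdeal) : (A.aug ∘ₗ f) (tmap (A.barGrading.sgn m) x) =
      (-1 : k) ^ (m * p) * (A.aug ∘ₗ f) x := by
  have h := sgn_apply_of_degree A.barGrading A.grading hf m x
  have h' := congrArg A.aug h
  rw [aug_sgn, map_smul, smul_eq_mul] at h'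
  rw [LinearMap.comp_apply, LinearMap.comp_apply, h', ← mul_assoc, ← zpow_add₀ (by simp),
    Even.neg_one_zpow ⟨_, rfl⟩, one_mul]

/-- The cocycle equation for `f`, projected to `Ā`. Replacing `f` by its reduced part inside the bar
operations costs nothing on symmetric tensors, because the contribution of the unit component
cancels there. -/
theorem redBarOp_hochCoder {p : ℤ} {f : TCo k A.augIdeal →ₗ[k] A.carrier} (hf : f ∈ A.cocycles p)
    {x : TCo k A.augIdeal} (hx : x ∈ Sym A.barGrading) :
    A.redBarOp (A.hochCoder p f x) = (-1 : k) ^ (p - 1) • A.redProj (f (A.barDiff x)) := by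
  have h0 : A.barOp (coext A.barGrading A.augIdeal.subtype (p - 1) f x)
      = (-1 : k) ^ (p - 1) • f (A.barDiff x) := by
    have h := LinearMap.congr_fun (LinearMap.mem_ker.1 hf.2) x
    exact sub_eq_zero.1 (neg_eq_zero.1 h)
  -- The splitting `A = Ā ⊕ k · 1` applied to the values of `f`.
  have h1 : f = A.augIdeal.subtype ∘ₗ (A.redProj ∘ₗ f) + (A.aug ∘ₗ f).smulRight A.one := by
    ext1 y
    simp [coe_redProj]
  have h2 := A.barOp_coext_unit p (A.aug ∘ₗ f) x
  -- Here the symmetry of `x` is used: splitting off the last letter or the first gives the same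
  -- result, so the unit part drops out.
  rw [functional_decon A.barGrading (aug_comp_sgn hf.1) hx, sub_self, Submodule.coe_zero] at h2
  have h3 : A.barOp (coext A.barGrading A.augIdeal.subtype (p - 1) f x)
      = A.redBarOp (A.hochCoder p f x) := by
    rw [coe_redBarOp, hochCoder, tmap_coext]
    conv_lhs => rw [h1, coext_add, LinearMap.add_apply, map_add, h2, add_zero]
  have h4 := congrArg A.redProj (h3.symm.trans h0)
  rwa [redProj_coe, map_smul] at h4

theorem hochCoder_mem_Sym {p : ℤ} {f : TCo k A.augIdeal →ₗ[k] A.carrier} (hf : f ∈ A.cochains p)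
    {x : TCo k A.augIdeal} (hx : x ∈ Sym A.barGrading) :
    A.hochCoder p f x ∈ Sym A.barGrading :=
  coext_mem_Sym _ (redProj_comp_sgn hf) hx

/-- The coderivation determined by a Hochschild cocycle commutes with the codifferential on
symmetric tensors. -/
theorem barDiff_hochCoder {p : ℤ} {f : TCo k A.augIdeal →ₗ[k] A.carrier} (hf : f ∈ A.cocycles p)
    {x : TCo k A.augIdeal} (hx : x ∈ Sym A.barGrading) :
    A.barDiff (A.hochCoder p f x) = (-1 : k) ^ (p - 1) • A.hochCoder p f (A.barDiff x) := by
  -- The graded commutator of `b` and `hochCoder p f` is a coderivation, hence the coextension of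
  -- its component in `Ā`; on `Sym` it suffices that this component vanishes there, which is
  -- `redBarOp_hochCoder`.
  have hE := A.barDiff_isCoderivation.commutator
    (coext_isCoderivation A.barGrading (p - 1) (A.redProj ∘ₗ f)) A.barDiff_sgnComm
    (coext_sgnComm A.barGrading (redProj_comp_sgn hf.1))
  have h := LinearMap.congr_fun hE.eq_coext x
  rw [coext_eq_zero_of_Sym _ _ (fun y hy => ?_) hx, one_mul] at h
  · exact sub_eq_zero.1 h
  · have h1 := redBarOp_hochCoder hf hy
    have h2 : proj (A.barDiff (A.hochCoder p f y)) = A.redBarOp (A.hochCoder p f y) :=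
      proj_coext _ _ _ _
    have h3 : proj (A.hochCoder p f (A.barDiff y)) = A.redProj (f (A.barDiff y)) :=
      proj_coext _ _ _ _
    rw [one_mul]
    change proj (A.barDiff (A.hochCoder p f y) -
      (-1 : k) ^ (p - 1) • A.hochCoder p f (A.barDiff y)) = 0
    rw [map_sub, map_smul, h2, h3, h1, sub_self]

/-- Surjectivity of `Π` read on representatives: the value of a cocycle at `1` can be prescribed up
to a boundary. The boundary is zero when `A` is minimal and has to be carried along otherwise. -/
theorem exists_cocycle (hA : A.ProjectionSurjective) {p : ℤ} {a : A.carrier} (ha : a ∈ A.cyc p) :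
    ∃ f ∈ A.cocycles p, ∃ c ∈ A.grading.gr (p - 1), a = f 1 + A.d c := by
  obtain ⟨g, hg⟩ := hA p (Submodule.Quotient.mk ⟨a, ha⟩)
  obtain ⟨⟨f, hf⟩, rfl⟩ := Submodule.Quotient.mk_surjective _ g
  have h := (Submodule.Quotient.eq _).1 (hg.symm : Submodule.Quotient.mk _ =
    Submodule.Quotient.mk (⟨f 1, A.eval_mem_cyc p f hf⟩ : A.cyc p))
  obtain ⟨c, hc, hca⟩ := h
  exact ⟨f, hf, c, hc, by
    rw [hca]
    exact (add_sub_cancel (f 1) a).symm⟩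

end AInfinityAlgebra

/-! ### Weight filtration and shuffling a letter into a symmetric tensor -/

section Insertion

variable {k : Type u} [Field k] {V : Type v} [AddCommGroup V] [Module k V]

open TensorAlgebra

/-- The tensors of weight at most `n`, as the span of words. -/
def wordsUpTo (k : Type u) [Field k] (V : Type v) [AddCommGroup V] [Module k V] (n : ℕ) :
    Submodule k (TCo k V) := Submodule.span k {x | ∃ m ≤ n, ∃ v : ℕ → V, x = word k m v}

theorem word_mem_wordsUpTo {m n : ℕ} (h : m ≤ n) (v : ℕ → V) : word k m v ∈ wordsUpTo k V n :=
  Submodule.subset_span ⟨m, h, v, rfl⟩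

theorem wordsUpTo_le {n : ℕ} {S : Submodule k (TCo k V)} (h : ∀ m ≤ n, ∀ v, word k m v ∈ S) :
    wordsUpTo k V n ≤ S := by
  refine Submodule.span_le.2 ?_
  rintro _ ⟨m, hm, v, rfl⟩
  exact h m hm v

theorem wscale_mem_wordsUpTo (c : ℕ → k) {n : ℕ} {x : TCo k V} (hx : x ∈ wordsUpTo k V n) :
    wscale c x ∈ wordsUpTo k V n :=
  (wordsUpTo_le fun m hm v => by
    rw [Submodule.mem_comap, wscale_word]
    exact Submodule.smul_mem _ _ (word_mem_wordsUpTo hm v) :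
    wordsUpTo k V n ≤ (wordsUpTo k V n).comap (wscale c)) hx

/-- The projection onto the tensors of weight at most `n`. -/
def truncate (k : Type u) [Field k] (V : Type v) [AddCommGroup V] [Module k V] (n : ℕ) :
    TCo k V →ₗ[k] TCo k V := wscale fun m => if m ≤ n then 1 else 0

theorem truncate_mem (n : ℕ) (x : TCo k V) : truncate k V n x ∈ wordsUpTo k V n := by
  have h : (wordsUpTo k V n).mkQ ∘ₗ truncate k V n = 0 := tco_ext fun m v => by
    rw [LinearMap.comp_apply, LinearMap.zero_apply, Submodule.mkQ_apply,
      Submodule.Quotient.mk_eq_zero, truncate, wscale_word]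
    split_ifs with hm
    · rw [one_smul]
      exact word_mem_wordsUpTo hm v
    · rw [zero_smul]
      exact zero_mem _
  have := LinearMap.congr_fun h x
  rwa [LinearMap.comp_apply, LinearMap.zero_apply, Submodule.mkQ_apply,
    Submodule.Quotient.mk_eq_zero] at this

/-- Contracting the first letter with a functional preserves symmetry and lowers the weight by one,
so `mem_span_of_contract` applies to the intersection of both conditions. -/
theorem peel_mem_span (G : Grading k V) {n : ℕ} {x : TCo k V} (hx : x ∈ Sym G)
    (hn : x ∈ wordsUpTo k V (n + 1)) : peel x ∈ Submodule.span k
      {z | ∃ p, ∃ v ∈ G.gr p, ∃ y ∈ Sym G ⊓ wordsUpTo k V n, z = v ⊗ₜ[k] y} := by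
  refine mem_span_of_contract G _ _ fun φ => ⟨(mem_Sym G).2 fun i => ?_, ?_⟩
  · rw [contract_swapAt, ← peel_swapAt_succ, (mem_Sym G).1 hx]
  · refine (wordsUpTo_le fun m hm v => ?_ : wordsUpTo k V (n + 1) ≤
      (wordsUpTo k V n).comap (contract φ ∘ₗ peel)) hn
    rw [Submodule.mem_comap, LinearMap.comp_apply]
    cases m with
    | zero => simp [word_zero, peel_one]
    | succ m =>
      rw [word_succ, peel_ι_mul, contract_tmul]
      exact Submodule.smul_mem _ _ (word_mem_wordsUpTo (by omega) _)

/-- The only way for a coderivation to lengthen a word is to insert `α 1` at an empty subword, which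
`hα` excludes. -/
theorem coext_mem_wordsUpTo (G : Grading k V) (e : ℤ) {α : TCo k V →ₗ[k] V} (hα : α 1 = 0) {n : ℕ}
    {x : TCo k V} (hx : x ∈ wordsUpTo k V n) :
    coext G LinearMap.id e α x ∈ wordsUpTo k V n := by
  refine (wordsUpTo_le fun m hm v => ?_ : wordsUpTo k V n ≤
    (wordsUpTo k V n).comap (coext G LinearMap.id e α)) hx
  rw [Submodule.mem_comap, coext_word']
  refine Submodule.sum_mem _ fun p hp => Submodule.sum_mem _ fun q hq => ?_
  rw [Finset.HasAntidiagonal.mem_antidiagonal] at hp hq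
  by_cases hs : q.1 = 0
  · simp [hs, word_zero, hα]
  · have h1 := word_one (k := k) (fun _ : ℕ => α (word k q.1 fun i => v (p.1 + i)))
    rw [← h1, word_mul_word, word_mul_word]
    exact word_mem_wordsUpTo (by omega) _

/-- Every subword of a word of weight at most `n` again has weight at most `n`, so the higher
components of `α` play no role. -/
theorem coext_comp_truncate (G : Grading k V) (e : ℤ) (α : TCo k V →ₗ[k] V) {n : ℕ}
    {x : TCo k V} (hx : x ∈ wordsUpTo k V n) :
    coext G LinearMap.id e (α ∘ₗ truncate k V n) x = coext G LinearMap.id e α x := by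
  refine (wordsUpTo_le fun m hm v => ?_ : wordsUpTo k V n ≤
    LinearMap.eqLocus (coext G LinearMap.id e (α ∘ₗ truncate k V n))
      (coext G LinearMap.id e α)) hx
  rw [LinearMap.mem_eqLocus, coext_word', coext_word']
  refine Finset.sum_congr rfl fun p hp => Finset.sum_congr rfl fun q hq => ?_
  rw [Finset.HasAntidiagonal.mem_antidiagonal] at hp hq
  rw [LinearMap.comp_apply, truncate, wscale_word, if_pos (by omega), one_smul]

/-- The signed shuffle product of a letter and a word: `insert (v ⊗ x)` is the sum of all the ways
to insert `v` into `x`. -/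
def insert (G : Grading k V) : V ⊗[k] TCo k V →ₗ[k] TCo k V :=
  LinearMap.mul' k (TCo k V) ∘ₗ TensorProduct.map LinearMap.id glue ∘ₗ passLeft G ∘ₗ
    TensorProduct.map LinearMap.id decon

theorem prefixExt_counit (v : V) (x : TCo k V) :
    prefixExt LinearMap.id (counit.smulRight v) x = ι k v * x := by
  have hid : (tmap (LinearMap.id : V →ₗ[k] V)).toLinearMap = LinearMap.id :=
    tco_ext fun n v => by simp [map_word]
  have e : TensorProduct.map (ι k ∘ₗ (counit : TCo k V →ₗ[k] k).smulRight v)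
      (LinearMap.id : TCo k V →ₗ[k] TCo k V)
      = TensorProduct.map (LinearMap.toSpanSingleton k _ (ι k v)) LinearMap.id ∘ₗ
        TensorProduct.map counit LinearMap.id :=
    TensorProduct.ext' fun a b => by simp
  rw [prefixExt, hid, e, LinearMap.comp_apply, LinearMap.comp_apply, LinearMap.comp_apply,
    decon_counit]
  simp

/-- The component `counit.smulRight v` is supported on the empty subword, so its coderivation
inserts `v` at every place. This identifies shuffling with `v` as the weight-raising part of the
coderivation of a cochain whose value at `1` is `v`. -/
theorem insert_tmul (G : Grading k V) {p : ℤ} {v : V} (hv : v ∈ G.gr p) (x : TCo k V) :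
    insert G (v ⊗ₜ[k] x) = coext G LinearMap.id p (counit.smulRight v) x := by
  have h : prefixExt LinearMap.id ((counit : TCo k V →ₗ[k] k).smulRight v)
      = LinearMap.mulLeft k (ι k v) := LinearMap.ext (prefixExt_counit v)
  have h' : (glue : V ⊗[k] TCo k V →ₗ[k] _) ∘ₗ TensorProduct.mk k V (TCo k V) v
      = LinearMap.mulLeft k (ι k v) := LinearMap.ext (glue_tmul v)
  rw [insert, LinearMap.comp_apply, LinearMap.comp_apply, LinearMap.comp_apply,
    TensorProduct.map_tmul, LinearMap.id_apply, passLeft_tmul G hv, TensorProduct.map_map, h',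
    LinearMap.id_comp, coext, h]
  rfl

/-- A symmetric tensor of weight `n`, multiplied by `n`, is the shuffle product of its first letter
and the rest. -/
theorem wscale_eq_insert (G : Grading k V) {x : TCo k V} (hx : x ∈ Sym G) :
    wscale (fun n => (n : k)) x = insert G (peel x) := by
  -- Split the second factor of the coproduct into its constant part and its first letter with the
  -- rest. Multiplying the factors back, the constant part contributes `x`; by `mul_decon` the
  -- remainder is `x` times its weight, and by cocommutativity it is the insertion of the first
  -- letter.
  have e : (LinearMap.id : TCo k V →ₗ[k] TCo k V)
      = LinearMap.toSpanSingleton k _ 1 ∘ₗ counit + glue ∘ₗ peel :=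
    LinearMap.ext fun y => glue_peel y
  have h := mul_decon x
  have h2 : decon x = TensorProduct.map LinearMap.id LinearMap.id (decon x) := by
    rw [TensorProduct.map_id, LinearMap.id_apply]
  have h3 : TensorProduct.map (LinearMap.id : TCo k V →ₗ[k] TCo k V)
      (LinearMap.toSpanSingleton k (TCo k V) 1 ∘ₗ counit) (decon x) = x ⊗ₜ[k] 1 := by
    have := congrArg (TensorProduct.map (LinearMap.id : TCo k V →ₗ[k] TCo k V)
      (LinearMap.toSpanSingleton k (TCo k V) 1)) (decon_counit' x)
    rw [TensorProduct.map_map, LinearMap.comp_id] at this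
    rw [this]
    simp
  rw [h2, e, TensorProduct.map_add_right, LinearMap.add_apply, ← e, h3, map_add,
    LinearMap.mul'_apply, mul_one] at h
  rw [insert, LinearMap.comp_apply, LinearMap.comp_apply, LinearMap.comp_apply,
    passLeft_decon G x hx, TensorProduct.map_map, LinearMap.id_comp]
  exact (add_left_cancel h).symm

end Insertion

/-! ### Vanishing of all operations in the minimal case -/

namespace AInfinityAlgebra

variable {k : Type u} [Field k] {A : AInfinityAlgebra.{u, v} k}

open TensorAlgebra

theorem proj_barDiff (x : TCo k A.augIdeal) : proj (A.barDiff x) = A.redBarOp x :=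
  proj_coext _ _ _ _

theorem redBarOp_one : A.redBarOp 1 = 0 := by
  rw [← proj_barDiff, barDiff_one, map_zero]

/-- If every homogeneous element of `Ā` is the value of a Hochschild cocycle, then the components of
the codifferential vanish on symmetric tensors. -/
theorem redBarOp_eq_zero [CharZero k]
    (hA : ∀ p, ∀ a : A.augIdeal, a ∈ A.augGrading.gr p → ∃ f ∈ A.cocycles p, f 1 = a) (n : ℕ) :
    ∀ x ∈ Sym A.barGrading, x ∈ wordsUpTo k A.augIdeal n → A.redBarOp x = 0 := by
  induction n with
  | zero =>
    intro x _ hx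
    refine (wordsUpTo_le fun m hm v => ?_ : wordsUpTo k A.augIdeal 0 ≤
      LinearMap.ker A.redBarOp) hx
    rw [Nat.le_zero.1 hm, word_zero, LinearMap.mem_ker, redBarOp_one]
  | succ n ih =>
    intro x hx hn
    -- On weight at most `n` the component of `b` may be truncated; the truncated component vanishes
    -- on all of `Sym` by induction, and so does its coextension.
    have hb : ∀ y ∈ Sym A.barGrading, y ∈ wordsUpTo k A.augIdeal n → A.barDiff y = 0 := by
      intro y hy hyn
      rw [barDiff, ← coext_comp_truncate _ _ _ hyn]
      refine coext_eq_zero_of_Sym _ _ (fun z hz => ?_) hy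
      rw [LinearMap.comp_apply]
      exact ih (truncate k A.augIdeal n z) (wscale_mem_Sym _ _ hz) (truncate_mem n z)
    -- Characteristic zero enters here: up to a constant, `x` is the weight operator applied to a
    -- symmetric tensor, hence a sum of shuffles of a letter with symmetric tensors of weight at
    -- most `n`.
    rw [eq_counit_add_wscale x, map_add, map_smul, redBarOp_one, smul_zero, zero_add,
      wscale_eq_insert _ (wscale_mem_Sym _ _ hx)]
    refine eq_of_mem_span (f := A.redBarOp ∘ₗ insert A.barGrading) (g := 0) ?_
      (peel_mem_span _ (wscale_mem_Sym _ _ hx) (wscale_mem_wordsUpTo _ hn))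
    rintro _ ⟨q, v, hv, y, ⟨hy, hyn⟩, rfl⟩
    rw [LinearMap.comp_apply, LinearMap.zero_apply, insert_tmul _ hv]
    -- Degree `q` in `sĀ` is degree `q + 1` in `Ā`; the resulting coderivation has degree `q` again.
    obtain ⟨f, hf, hfv⟩ := hA (q + 1) v hv
    set c : TCo k A.augIdeal →ₗ[k] A.augIdeal := counit.smulRight v
    -- The first summand shuffles `v` into `y`. In the second, the component vanishes at `1`, so the
    -- weight stays at most `n` and the induction hypothesis applies once symmetry is known.
    have hD : A.hochCoder (q + 1) f y = coext A.barGrading LinearMap.id q c y +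
        coext A.barGrading LinearMap.id q (A.redProj ∘ₗ f - c) y := by
      rw [← LinearMap.add_apply, ← coext_add, add_sub_cancel, hochCoder, add_sub_cancel_right]
    have hc : coext A.barGrading LinearMap.id q c y ∈ Sym A.barGrading := by
      refine coext_mem_Sym _ (fun m z => ?_) hy
      have := LinearMap.congr_fun (counit_tmap (A.barGrading.sgn m)) z
      simp only [LinearMap.comp_apply, AlgHom.toLinearMap_apply] at this
      simp only [c, LinearMap.smulRight_apply, map_smul, this, Grading.sgn_of_mem _ _ hv]
      rw [smul_comm]
    have h1 : A.redBarOp (A.hochCoder (q + 1) f y) = 0 := by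
      rw [redBarOp_hochCoder hf hy, hb y hy hyn, map_zero, map_zero, smul_zero]
    have h2 : A.redBarOp (coext A.barGrading LinearMap.id q (A.redProj ∘ₗ f - c) y) = 0 := by
      refine ih _ ?_ (coext_mem_wordsUpTo _ _ ?_ hyn)
      -- Symmetry of the remainder is inherited as a difference of two symmetric tensors.
      · rw [← sub_eq_iff_eq_add'.2 hD]
        exact sub_mem (hochCoder_mem_Sym hf.1 hy) hc
      · simp [c, hfv, redProj_coe, counit_one]
    rwa [hD, map_add, h2, add_zero] at h1

theorem lie_isCompletelyAbelian [CharZero k] (hA : A.IsAInfinityCommutative) :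
    A.lie.IsCompletelyAbelian := by
  intro n _ x hx
  refine (proj_barDiff (x : TCo k A.augIdeal)).trans
    (redBarOp_eq_zero (A := A) (fun p a ha => ?_) n (x : TCo k A.augIdeal) x.2 ?_)
  · have hd : A.d = 0 := hA.1
    -- Minimality makes every element a cycle and removes the boundary `A.d c`, so `f 1` is `a`
    -- exactly.
    obtain ⟨f, hf, c, -, hfc⟩ := exists_cocycle hA.2 (p := p) (a := (a : A.carrier))
      ⟨ha, by simp [hd]⟩
    exact ⟨f, hf, by rw [hfc, hd]; simp⟩
  · refine (Submodule.span_le.2 ?_ : weight k A.augIdeal n ≤ wordsUpTo k A.augIdeal n) hx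
    rintro _ ⟨v, rfl⟩
    exact word_mem_wordsUpTo le_rfl v

end AInfinityAlgebra

/-! ### Homogeneous components and graded subspaces -/

namespace Grading

variable {k : Type u} [Field k] {V : Type v} [AddCommGroup V] [Module k V]

/-- The projection to the homogeneous component of degree `p`. -/
def component (G : Grading k V) (p : ℤ) : V →ₗ[k] V := G.scale fun q => if q = p then 1 else 0

theorem component_of_mem (G : Grading k V) (p : ℤ) {q : ℤ} {v : V} (hv : v ∈ G.gr q) :
    G.component p v = if q = p then v else 0 := by
  rw [component, scale_of_mem _ _ hv, ite_smul, one_smul, zero_smul]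

theorem component_mem (G : Grading k V) (p : ℤ) (v : V) : G.component p v ∈ G.gr p := by
  induction v using G.induction_gr with
  | h0 => rw [map_zero]; exact zero_mem _
  | ha x y hx hy => rw [map_add]; exact add_mem hx hy
  | h q v hv =>
    rw [component_of_mem _ _ hv]
    split_ifs with h
    · exact h ▸ hv
    · exact zero_mem _

/-- Stating the decomposition for every larger finite set of degrees lets two elements share one
set, which the additive step of the induction requires. -/
theorem eq_sum_component (G : Grading k V) (v : V) :
    ∃ s : Finset ℤ, ∀ t, s ⊆ t → v = ∑ p ∈ t, G.component p v := by
  classical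
  induction v using G.induction_gr with
  | h0 => exact ⟨∅, by simp⟩
  | ha x y hx hy =>
    obtain ⟨s, hs⟩ := hx
    obtain ⟨s', hs'⟩ := hy
    refine ⟨s ∪ s', fun t ht => ?_⟩
    simp only [map_add, Finset.sum_add_distrib]
    rw [← hs t (Finset.union_subset_left ht), ← hs' t (Finset.union_subset_right ht)]
  | h q v hv =>
    refine ⟨{q}, fun t ht => ?_⟩
    simp only [component_of_mem _ _ hv]
    rw [Finset.sum_ite_eq, if_pos (ht (Finset.mem_singleton_self q))]

theorem mem_iSup_of_component (G : Grading k V) {S : ℤ → Submodule k V} {v : V}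
    (h : ∀ p, G.component p v ∈ S p) : v ∈ ⨆ p, S p := by
  obtain ⟨s, hs⟩ := G.eq_sum_component v
  rw [hs s subset_rfl]
  exact Submodule.sum_mem _ fun p _ => Submodule.mem_iSup_of_mem p (h p)

theorem component_mem_of_mem_iSup (G : Grading k V) {C : ℤ → Submodule k V}
    (hC : ∀ p, C p ≤ G.gr p) {v : V} (hv : v ∈ ⨆ p, C p) (p : ℤ) : G.component p v ∈ C p := by
  refine (iSup_le fun q x hx => ?_ : ⨆ p, C p ≤ (C p).comap (G.component p)) hv
  rw [Submodule.mem_comap, component_of_mem _ _ (hC q hx)]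
  split_ifs with h
  · exact h ▸ hx
  · exact zero_mem _

/-- The grading of the sum of subspaces of the homogeneous components. -/
def ofComponents (G : Grading k V) (C : ℤ → Submodule k V) (hC : ∀ p, C p ≤ G.gr p) :
    Grading k (⨆ p, C p : Submodule k V) where
  gr p := (C p).comap (⨆ p, C p).subtype
  internal := by
    have h := (DirectSum.isInternal_submodule_iff_iSupIndep_and_iSup_eq_top _).1 G.internal
    refine (DirectSum.isInternal_submodule_iff_iSupIndep_and_iSup_eq_top _).2 ⟨?_, ?_⟩
    · intro p
      rw [Submodule.disjoint_def]
      intro x hx hx'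
      have h1 := Submodule.disjoint_def.1 (h.1 p) (x : V) (hC p hx)
      refine Subtype.ext (h1 ?_)
      have h2 := Submodule.mem_map_of_mem (f := (⨆ p, C p).subtype) hx'
      simp only [Submodule.map_iSup] at h2
      exact (iSup₂_mono fun j _ => (Submodule.map_comap_le _ _).trans (hC j) :
        (⨆ j, ⨆ (_ : j ≠ p), Submodule.map (⨆ p, C p).subtype
          ((C j).comap (⨆ p, C p).subtype)) ≤ _) h2
    · refine Submodule.map_injective_of_injective (⨆ p, C p).injective_subtype ?_
      rw [Submodule.map_iSup, Submodule.map_subtype_top]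
      refine iSup_congr fun p => ?_
      rw [Submodule.map_comap_subtype]
      exact inf_eq_right.2 (le_iSup C p)

end Grading

/-! ### The exponential of a family of coderivations -/

section Flow

variable {k : Type u} [Field k] {V : Type v} [AddCommGroup V] [Module k V]
variable {H : Type w} [AddCommGroup H] [Module k H]

open TensorAlgebra

/-- Iterated application of a family of endomorphisms of `T^{co}(V)` to `1`:
`h₁ ⊗ ⋯ ⊗ hₙ ↦ D h₁ (⋯ (D hₙ 1))`. -/
def flow (D : H →ₗ[k] Module.End k (TCo k V)) : TCo k H →ₗ[k] TCo k V :=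
  LinearMap.applyₗ 1 ∘ₗ (TensorAlgebra.lift k D).toLinearMap

theorem flow_one (D : H →ₗ[k] Module.End k (TCo k V)) : flow D 1 = 1 := by simp [flow]

theorem flow_ι_mul (D : H →ₗ[k] Module.End k (TCo k V)) (h : H) (x : TCo k H) :
    flow D (ι k h * x) = D h (flow D x) := by simp [flow]

/-- The exponential of a family of endomorphisms of `T^{co}(V)`, applied to `1`:
`h₁ ⊗ ⋯ ⊗ hₙ ↦ (1 / n!) D h₁ (⋯ (D hₙ 1))`. -/
def expFlow (D : H →ₗ[k] Module.End k (TCo k V)) : TCo k H →ₗ[k] TCo k V :=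
  flow D ∘ₗ wscale fun n => ((n.factorial : ℕ) : k)⁻¹

theorem expFlow_one (D : H →ₗ[k] Module.End k (TCo k V)) : expFlow D 1 = 1 := by
  simp [expFlow, wscale_one, flow_one]

theorem expFlow_ι (D : H →ₗ[k] Module.End k (TCo k V)) (h : H) : expFlow D (ι k h) = D h 1 := by
  have e := flow_ι_mul D h 1
  have e' := wscale_ι_mul (fun n => ((n.factorial : ℕ) : k)⁻¹) h 1
  rw [mul_one, flow_one] at e
  rw [mul_one, wscale_one, mul_smul_comm, mul_one] at e'
  rw [expFlow, LinearMap.comp_apply, e', map_smul, e]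
  simp

/-- Auxiliary: `h ⊗ x ↦ D h (exp x)`. -/
def flowStep (D : H →ₗ[k] Module.End k (TCo k V)) : H ⊗[k] TCo k H →ₗ[k] TCo k V :=
  TensorProduct.lift (LinearMap.lcomp k (TCo k V) (expFlow D) ∘ₗ D)

theorem flowStep_tmul (D : H →ₗ[k] Module.End k (TCo k V)) (h : H) (x : TCo k H) :
    flowStep D (h ⊗ₜ[k] x) = D h (expFlow D x) := by
  simp [flowStep]

/-- The differential equation of the exponential, from `(n + 1) / (n + 1)! = 1 / n!`: applying the
weight operator first is the same as peeling off the first letter and acting by it after the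
exponential of the rest. -/
theorem expFlow_wscale [CharZero k] (D : H →ₗ[k] Module.End k (TCo k V)) (x : TCo k H) :
    expFlow D (wscale (fun n => (n : k)) x) = flowStep D (peel x) := by
  refine LinearMap.congr_fun (f := expFlow D ∘ₗ wscale fun n => (n : k))
    (g := flowStep D ∘ₗ peel) (tco_rec_ext ?_ fun v x _ => ?_) x
  · simp [wscale_one, peel_one]
  · rw [LinearMap.comp_apply, LinearMap.comp_apply, peel_ι_mul, flowStep_tmul, expFlow,
      LinearMap.comp_apply, LinearMap.comp_apply, wscale_wscale, wscale_ι_mul, flow_ι_mul]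
    congr 3
    refine congrArg wscale (funext fun n => ?_)
    have h1 : ((n : k) + 1) ≠ 0 := by exact_mod_cast n.succ_ne_zero
    rw [Nat.factorial_succ]
    push_cast
    field_simp

/-- Applied to the space of symmetric tensors killed by `b`, which contains `1` and is stable under
the coderivations of cocycles. -/
theorem flow_mem (D : H →ₗ[k] Module.End k (TCo k V)) {S : Submodule k (TCo k V)} (h1 : 1 ∈ S)
    (hS : ∀ h, ∀ x ∈ S, D h x ∈ S) (x : TCo k H) : flow D x ∈ S := by
  have : S.mkQ ∘ₗ flow D = 0 := by
    refine tco_rec_ext ?_ fun v y hy => ?_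
    · simpa [flow_one] using h1
    · simp only [LinearMap.comp_apply, LinearMap.zero_apply, Submodule.mkQ_apply,
        Submodule.Quotient.mk_eq_zero, flow_ι_mul] at hy ⊢
      exact hS v _ hy
  have h := LinearMap.congr_fun this x
  rwa [LinearMap.comp_apply, LinearMap.zero_apply, Submodule.mkQ_apply,
    Submodule.Quotient.mk_eq_zero] at h

theorem expFlow_mem (D : H →ₗ[k] Module.End k (TCo k V)) {S : Submodule k (TCo k V)} (h1 : 1 ∈ S)
    (hS : ∀ h, ∀ x ∈ S, D h x ∈ S) (x : TCo k H) : expFlow D x ∈ S := flow_mem D h1 hS _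

theorem counit_expFlow (D : H →ₗ[k] Module.End k (TCo k V)) (hD : ∀ h x, counit (D h x) = 0)
    (x : TCo k H) : counit (expFlow D x) = counit x := by
  have : counit ∘ₗ flow D = counit := by
    refine tco_rec_ext ?_ fun v y _ => ?_
    · simp [flow_one, counit_one]
    · simp [flow_ι_mul, hD, counit_ι_mul]
  have h := LinearMap.congr_fun this (wscale (fun n => ((n.factorial : ℕ) : k)⁻¹) x)
  rw [LinearMap.comp_apply, counit_wscale] at h
  simpa [expFlow] using h

theorem expFlow_mem_degree (G : Grading k V) (G' : Grading k H)
    (D : H →ₗ[k] Module.End k (TCo k V))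
    (hD : ∀ p, ∀ h ∈ G'.gr p, ∀ d, ∀ x ∈ degree G d, D h x ∈ degree G (d + p))
    {d : ℤ} {x : TCo k H} (hx : x ∈ degree G' d) : expFlow D x ∈ degree G d := by
  refine (Submodule.span_le (p := (degree G d).comap (expFlow D))).2 ?_ hx
  rintro _ ⟨n, p, v, hv, rfl, rfl⟩
  rw [SetLike.mem_coe, Submodule.mem_comap, expFlow, LinearMap.comp_apply, wscale_word, map_smul]
  refine Submodule.smul_mem _ _ ?_
  clear hx
  induction n generalizing p v with
  | zero => simpa [word_zero, flow_one] using one_mem_degree G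
  | succ n ih =>
    rw [word_succ, flow_ι_mul, Finset.sum_range_succ']
    exact hD _ _ (hv 0 (by omega)) _ _
      (ih (fun i => p (i + 1)) (fun i => v (i + 1)) fun i hi => hv (i + 1) (by omega))

/-- The exponential has degree zero, so it introduces no sign of its own. This matches the sign in
the co-Leibniz rule of `D v` with the one in `passLeft`. -/
theorem tmap_sgn_expFlow (G : Grading k V) (G' : Grading k H)
    (D : H →ₗ[k] Module.End k (TCo k V)) (hD : ∀ p, ∀ h ∈ G'.gr p, SgnComm G p (D h)) (m : ℤ)
    (x : TCo k H) : tmap (G.sgn m) (expFlow D x) = expFlow D (tmap (G'.sgn m) x) := by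
  have h1 : (tmap (G.sgn m)).toLinearMap ∘ₗ flow D = flow D ∘ₗ (tmap (G'.sgn m)).toLinearMap := by
    refine tco_rec_ext ?_ fun v y hy => ?_
    · simp [flow_one]
    · simp only [LinearMap.comp_apply, AlgHom.toLinearMap_apply, map_mul, tmap_ι,
        flow_ι_mul] at hy ⊢
      induction v using G'.induction_gr with
      | h0 => simp
      | ha a b h h' => simp only [map_add, LinearMap.add_apply, h, h']
      | h p v hv =>
        rw [hD p v hv, hy, Grading.sgn_of_mem _ _ hv, map_smul, LinearMap.smul_apply]
  have h2 : (tmap (G'.sgn m)).toLinearMap ∘ₗ wscale (fun n => ((n.factorial : ℕ) : k)⁻¹)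
      = wscale (fun n => ((n.factorial : ℕ) : k)⁻¹) ∘ₗ (tmap (G'.sgn m)).toLinearMap :=
    tco_ext fun n v => by simp [wscale_word, map_word]
  have h3 := LinearMap.congr_fun h1 (wscale (fun n => ((n.factorial : ℕ) : k)⁻¹) x)
  have h4 := LinearMap.congr_fun h2 x
  simp only [LinearMap.comp_apply, AlgHom.toLinearMap_apply] at h3 h4
  rw [expFlow, LinearMap.comp_apply, LinearMap.comp_apply, h3, h4]

/-- The exponential of a family of coderivations is compatible with the coproducts on symmetric
tensors. -/
theorem decon_expFlow [CharZero k] (G : Grading k V) (G' : Grading k H)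
    (D : H →ₗ[k] Module.End k (TCo k V)) (hD : ∀ p, ∀ h ∈ G'.gr p, IsCoderivation G p (D h))
    (hD' : ∀ p, ∀ h ∈ G'.gr p, SgnComm G p (D h)) {x : TCo k H} (hx : x ∈ Sym G') :
    decon (expFlow D x) = TensorProduct.map (expFlow D) (expFlow D) (decon x) := by
  set F := expFlow D with hF
  have hone : decon (F 1) = TensorProduct.map F F (decon 1) := by
    rw [hF, expFlow_one, decon_one, decon_one, TensorProduct.map_tmul, expFlow_one]
  -- Co-Leibniz rule for `D v` applied to `F y`: `v` acts either on the left factor, becoming its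
  -- first letter, or on the right factor after passing the left one with a sign.
  have key : ∀ (p : ℤ) (v : H), v ∈ G'.gr p → ∀ y, decon (F y) = TensorProduct.map F F (decon y) →
      decon (flowStep D (v ⊗ₜ[k] y)) =
        TensorProduct.map (flowStep D ∘ₗ peel) F (deconPeel (v ⊗ₜ[k] y)) +
        TensorProduct.map F (flowStep D)
          (passLeft G' (TensorProduct.map LinearMap.id decon (v ⊗ₜ[k] y))) := by
    intro p v hv y hy
    have e1 : (tmap (G.sgn p)).toLinearMap ∘ₗ F = F ∘ₗ (tmap (G'.sgn p)).toLinearMap :=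
      LinearMap.ext fun z => tmap_sgn_expFlow G G' D hD' p z
    have e2 : flowStep D ∘ₗ TensorProduct.mk k H (TCo k H) v = D v ∘ₗ F :=
      LinearMap.ext fun z => flowStep_tmul D v z
    have e3 : (flowStep D ∘ₗ peel) ∘ₗ LinearMap.mulLeft k (ι k v) = D v ∘ₗ F :=
      LinearMap.ext fun z => by simp [peel_ι_mul, flowStep_tmul, hF]
    rw [flowStep_tmul, ← hF, hD p v hv, hy, TensorProduct.map_tmul, LinearMap.id_apply,
      passLeft_tmul _ hv, deconPeel_tmul, TensorProduct.map_map, TensorProduct.map_map,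
      TensorProduct.map_map, TensorProduct.map_map, e1, e2, e3, LinearMap.id_comp,
      LinearMap.comp_id, add_comm]
  -- The induction will apply the hypothesis to rescaled rests, with the factor `1 / (n + 1)` in
  -- weight `n`, so the claim is strengthened to all rescalings of `x`.
  suffices h : ∀ c : ℕ → k,
      decon (F (wscale c x)) = TensorProduct.map F F (decon (wscale c x)) by
    have h1 := h fun _ => 1
    have h2 : wscale (fun _ => (1 : k)) = (LinearMap.id : TCo k H →ₗ[k] TCo k H) :=
      tco_ext fun n v => by simp [wscale_word]
    rwa [h2, LinearMap.id_apply] at h1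
  refine Sym_induction G' (P := fun x => ∀ c : ℕ → k,
      decon (F (wscale c x)) = TensorProduct.map F F (decon (wscale c x)))
    (fun x hx hz c => ?_) x hx
  -- Dividing by the weight first, so that the weight operator, and with it the differential
  -- equation `expFlow_wscale`, can be applied to `X`.
  set X := wscale (fun n => (n : k)⁻¹) (wscale c x) with hX
  have hXs : X ∈ Sym G' := wscale_mem_Sym _ _ (wscale_mem_Sym _ _ hx)
  have h1 : decon (flowStep D (peel X)) =
      TensorProduct.map (flowStep D ∘ₗ peel) F (deconPeel (peel X)) +
        TensorProduct.map F (flowStep D)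
          (passLeft G' (TensorProduct.map LinearMap.id decon (peel X))) := by
    rw [hX, peel_wscale, peel_wscale, TensorProduct.map_map, LinearMap.id_comp]
    set M : TCo k H →ₗ[k] TCo k H := (wscale fun n => ((n + 1 : ℕ) : k)⁻¹) ∘ₗ
      wscale fun n => c (n + 1) with hM
    refine eq_of_mem_span (f := decon ∘ₗ flowStep D ∘ₗ TensorProduct.map LinearMap.id M)
      (g := (TensorProduct.map (flowStep D ∘ₗ peel) F ∘ₗ deconPeel +
        TensorProduct.map F (flowStep D) ∘ₗ passLeft G' ∘ₗ TensorProduct.map LinearMap.id decon) ∘ₗ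
        TensorProduct.map LinearMap.id M) ?_ hz
    rintro _ ⟨p, v, hv, y, hy, hP, rfl⟩
    have h3 : decon (F (M y)) = TensorProduct.map F F (decon (M y)) := by
      rw [hM, LinearMap.comp_apply, wscale_wscale]
      exact hP _
    exact key p v hv (M y) h3
  have e4 : F ∘ₗ wscale (fun n => (n : k)) = flowStep D ∘ₗ peel :=
    LinearMap.ext fun z => expFlow_wscale D z
  -- The two terms of `key` are the weight operator on the left and on the right factor of `decon
  -- X`, the latter by cocommutativity. Since the weight operator is a coderivation, their sum is
  -- the coproduct of `X` times its weight.
  have e5 : TensorProduct.map (F ∘ₗ wscale fun n => (n : k)) F (decon X)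
      = TensorProduct.map (flowStep D ∘ₗ peel) F (deconPeel (peel X)) := by
    rw [e4, decon_eq X, map_add, TensorProduct.map_tmul, LinearMap.comp_apply, peel_one, map_zero,
      TensorProduct.zero_tmul, zero_add]
  have e6 : TensorProduct.map F (F ∘ₗ wscale fun n => (n : k)) (decon X)
      = TensorProduct.map F (flowStep D)
          (passLeft G' (TensorProduct.map LinearMap.id decon (peel X))) := by
    rw [e4, passLeft_decon G' X hXs, TensorProduct.map_map, LinearMap.comp_id]
  have h2 : decon (F (wscale (fun n => (n : k)) X)) =
      TensorProduct.map F F (decon (wscale (fun n => (n : k)) X)) := by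
    rw [hF, expFlow_wscale, ← hF, h1, decon_wscale_add, map_add, TensorProduct.map_map,
      TensorProduct.map_map, LinearMap.comp_id, e5, e6]
  rw [eq_counit_add_wscale (wscale c x), ← hX]
  simp only [map_add, map_smul, h2, hone]

end Flow

/-! ### Models with vanishing operations -/

theorem exists_relative_complement {k : Type u} [Field k] {V : Type v} [AddCommGroup V] [Module k V]
    (E B : Submodule k V) : ∃ C ≤ E, Disjoint C B ∧ E ≤ C ⊔ B := by
  -- A complement of `E ⊓ B` in all of `V`, cut down to `E` afterwards; the cut still works because
  -- the other summand of an element of `E` lies in `E`.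
  obtain ⟨C, hC⟩ := Submodule.exists_isCompl (E ⊓ B)
  refine ⟨C ⊓ E, inf_le_right, ?_, ?_⟩
  · rw [disjoint_iff, inf_assoc, inf_comm]
    exact hC.inf_eq_bot
  · intro x hx
    obtain ⟨b, hb, c, hc, rfl⟩ := Submodule.mem_sup.1
      (hC.sup_eq_top ▸ Submodule.mem_top : x ∈ E ⊓ B ⊔ C)
    rw [add_comm]
    exact Submodule.add_mem_sup ⟨hc, (Submodule.add_mem_iff_right E hb.1).1 hx⟩ hb.2

/-- A graded vector space as an `L_∞`-algebra all of whose operations vanish. -/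
abbrev trivialLInfinity {k : Type u} [Field k] (V : Type v) [AddCommGroup V] [Module k V]
    (G : Grading k V) : LInfinityAlgebra.{u, v} k where
  carrier := V
  grading := G
  b := 0
  b_degree _ _ _ := zero_mem _
  b_coderivation x := by simp
  b_b _ := rfl
  b_one := rfl

/-- The exponential of a family of coderivations of `L` whose values at `1` span a graded vector
space of flat directions, as a morphism of `L_∞`-algebras. -/
def expFlowHom {k : Type u} [Field k] [CharZero k] (L : LInfinityAlgebra.{u, v} k) {H : Type v}
    [AddCommGroup H] [Module k H] (G : Grading k H) (D : H →ₗ[k] Module.End k (TCo k L.carrier))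
    (hcoder : ∀ p, ∀ x ∈ G.shift.gr p, IsCoderivation L.grading.shift p (D x))
    (hsgn : ∀ p, ∀ x ∈ G.shift.gr p, SgnComm L.grading.shift p (D x))
    (hdeg : ∀ p, ∀ h ∈ G.shift.gr p, ∀ d, ∀ x ∈ degree L.grading.shift d,
      D h x ∈ degree L.grading.shift (d + p))
    (hSym : ∀ x, expFlow D x ∈ Sym L.grading.shift)
    (hb : ∀ x, L.b ⟨expFlow D x, hSym x⟩ = 0) :
    LInfinityAlgebra.Hom (trivialLInfinity H G) L where
  map := (expFlow D).restrict fun x _ => hSym x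
  map_degree _ _ hx := expFlow_mem_degree L.grading.shift G.shift D hdeg hx
  map_decon x := by
    apply Sym_map_injective
    rw [map_symDecon, TensorProduct.map_map]
    refine (decon_expFlow L.grading.shift G.shift D hcoder hsgn x.2).trans ?_
    rw [← map_symDecon G.shift x, TensorProduct.map_map]
    rfl
  map_counit x := by
    refine counit_expFlow D (fun h y => ?_) x.1
    induction h using G.shift.induction_gr with
    | h0 => simp
    | ha a b ha hb => rw [map_add, LinearMap.add_apply, map_add, ha, hb, add_zero]
    | h p z hz => exact (hcoder p z hz).counit_eq_zero y
  map_one := Subtype.ext (expFlow_one D)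
  map_b x := (map_zero _).trans (hb x.1).symm

/-! ### Representing the cohomology by cocycle values and the resulting quasi-isomorphism -/

namespace AInfinityAlgebra

variable {k : Type u} [Field k] {A : AInfinityAlgebra.{u, v} k}

open TensorAlgebra

theorem aug_d (a : A.carrier) : A.aug (A.d a) = 0 := A.aug_m 1 (by norm_num) _

theorem d_one : A.d A.one = 0 := A.m_unit 1 (by norm_num) _ ⟨0, rfl⟩

theorem d_mem {p : ℤ} {a : A.carrier} (ha : a ∈ A.grading.gr p) : A.d a ∈ A.grading.gr (p + 1) := by
  have h := A.m_degree 1 (fun _ => p) (fun _ => a) fun _ => ha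
  rw [d_apply]
  convert h using 2
  simp
  ring

/-- The differential of `Ā`. -/
def redD (A : AInfinityAlgebra.{u, v} k) : A.augIdeal →ₗ[k] A.augIdeal :=
  (A.d ∘ₗ A.augIdeal.subtype).codRestrict A.augIdeal fun _ => LinearMap.mem_ker.2 (aug_d _)

theorem coe_redD (a : A.augIdeal) : (A.redD a : A.carrier) = A.d a := rfl

/-- The unit is a cycle, so boundaries in `A` are already boundaries of elements of `Ā`. -/
theorem redD_redProj (a : A.carrier) : (A.redD (A.redProj a) : A.carrier) = A.d a := by
  rw [coe_redD, coe_redProj, map_sub, map_smul, d_one, smul_zero, sub_zero]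

theorem component_redD (p : ℤ) (a : A.augIdeal) :
    A.augGrading.component (p + 1) (A.redD a) = A.redD (A.augGrading.component p a) := by
  refine LinearMap.congr_fun (f := A.augGrading.component (p + 1) ∘ₗ A.redD)
    (g := A.redD ∘ₗ A.augGrading.component p) (A.augGrading.linear_ext fun q v hv => ?_) a
  have h : A.redD v ∈ A.augGrading.gr (q + 1) := A.d_mem hv
  rw [LinearMap.comp_apply, LinearMap.comp_apply, Grading.component_of_mem _ _ hv,
    Grading.component_of_mem _ _ h]
  by_cases hq : q = p
  · simp [hq]
  · simp [hq]

theorem redBarOp_ι (a : A.augIdeal) : A.redBarOp (ι k a) = -A.redD a := by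
  refine Subtype.ext ?_
  have h1 := word_one (k := k) (fun _ : ℕ => (a : A.carrier))
  rw [coe_redBarOp, tmap_ι, Submodule.subtype_apply, ← h1, barOp_word, Submodule.coe_neg, coe_redD,
    d_apply]
  congr 2
  ext i
  rw [Grading.sgn_even]
  simp

/-- The sign comes from `b_1 = -s m_1 s⁻¹`; it is the reason for the negated primitives in
`exists_trivial_model`. -/
theorem lie_d (a : A.augIdeal) : A.lie.d a = -A.redD a :=
  (proj_barDiff (ι k a)).trans (redBarOp_ι a)

/-- If `Π` is surjective, then the cohomology of `Ā` can be represented by a graded subspace of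
values of Hochschild cocycles. -/
theorem exists_representatives (hA : A.ProjectionSurjective) :
    ∃ C : ℤ → Submodule k A.augIdeal, (∀ p, C p ≤ A.augGrading.gr p) ∧
      (∀ p, ∀ a ∈ C p, ∃ f ∈ A.cocycles p, f 1 = a) ∧
      (∀ a ∈ ⨆ p, C p, ∀ y, a = A.redD y → a = 0) ∧
      (∀ y, A.redD y = 0 → ∃ x ∈ ⨆ p, C p, ∃ z, y = x + A.redD z) := by
  set E : ℤ → Submodule k A.augIdeal := fun p => A.augGrading.gr p ⊓
    ((A.cocycles p).map (LinearMap.applyₗ (1 : TCo k A.augIdeal))).comap A.augIdeal.subtype with hE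
  set B : ℤ → Submodule k A.augIdeal := fun p => A.augGrading.gr p ⊓ LinearMap.range A.redD with hB
  -- In each degree, `E p` holds the values of cocycles that lie in `Ā` and `B p` the boundaries. `C
  -- p` meets the boundaries trivially and together with them covers `E p`.
  choose C hCE hCB hEC using fun p => exists_relative_complement (E p) (B p)
  have hC : ∀ p, C p ≤ A.augGrading.gr p := fun p => (hCE p).trans inf_le_left
  refine ⟨C, hC, fun p a ha => ?_, fun a ha y hy => ?_, fun y hy => ?_⟩
  · obtain ⟨f, hf, hfa⟩ := (hCE p ha).2
    exact ⟨f, hf, hfa⟩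
  · have h : a ∈ ⨆ p : ℤ, (⊥ : Submodule k A.augIdeal) := by
      refine A.augGrading.mem_iSup_of_component fun p => ?_
      have h1 := A.augGrading.component_mem_of_mem_iSup hC ha p
      refine (Submodule.mem_bot k).2 (Submodule.disjoint_def.1 (hCB p) _ h1 ⟨hC p h1, ?_⟩)
      rw [hy]
      refine ⟨A.augGrading.component (p - 1) y, ?_⟩
      rw [← component_redD, sub_add_cancel]
    simpa using h
  · have h : y ∈ ⨆ p, C p ⊔ B p := by
      refine A.augGrading.mem_iSup_of_component fun p => ?_
      set a := A.augGrading.component p y with ha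
      have hap : a ∈ A.augGrading.gr p := A.augGrading.component_mem p y
      have had : A.redD a = 0 := by rw [ha, ← component_redD, hy, map_zero]
      obtain ⟨f, hf, c, hc, hfc⟩ := exists_cocycle hA (p := p) (a := (a : A.carrier))
        ⟨hap, LinearMap.mem_ker.2 (by rw [← coe_redD, had, Submodule.coe_zero])⟩
      have hb : A.redD (A.redProj c) ∈ B p := by
        refine ⟨?_, A.redProj c, rfl⟩
        have := A.d_mem hc
        rw [sub_add_cancel, ← redD_redProj] at this
        exact this
      -- Each component of a cycle is a cycle; after subtracting the boundary from `exists_cocycle`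
      -- it is exactly the value of a cocycle.
      have he : a - A.redD (A.redProj c) ∈ E p := by
        refine ⟨sub_mem hap hb.1, f, hf, ?_⟩
        rw [Submodule.subtype_apply, Submodule.coe_sub, redD_redProj, hfc, add_sub_cancel_right]
        rfl
      rw [← sub_add_cancel a (A.redD (A.redProj c))]
      exact add_mem (hEC p he) (Submodule.mem_sup_right hb)
    rw [iSup_sup_eq] at h
    obtain ⟨x, hx, b, hb, rfl⟩ := Submodule.mem_sup.1 h
    obtain ⟨z, rfl⟩ := (iSup_le fun p => inf_le_right : ⨆ p, B p ≤ LinearMap.range A.redD) hb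
    exact ⟨x, hx, z, rfl⟩

/-- A linear choice of Hochschild cocycles with prescribed values. -/
theorem exists_linear_section {p : ℤ} {H : Type w} [AddCommGroup H] [Module k H]
    (j : H →ₗ[k] A.augIdeal) (h : ∀ x, ∃ f ∈ A.cocycles p, f 1 = j x) :
    ∃ s : H →ₗ[k] A.cocycles p, ∀ x, (s x : TCo k A.augIdeal →ₗ[k] A.carrier) 1 = j x := by
  set ev : A.cocycles p →ₗ[k] A.carrier :=
    LinearMap.applyₗ (1 : TCo k A.augIdeal) ∘ₗ (A.cocycles p).subtype with hev
  -- Over a field `H` is projective, so evaluation at `1` can be lifted linearly; linearity in `h`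
  -- is needed to form the family `D h`.
  obtain ⟨s, hs⟩ := Module.projective_lifting_property ev.rangeRestrict
    ((A.augIdeal.subtype ∘ₗ j).codRestrict (LinearMap.range ev) fun x => by
      obtain ⟨f, hf, hfx⟩ := h x
      exact ⟨⟨f, hf⟩, hfx⟩) ev.surjective_rangeRestrict
  exact ⟨s, fun x => congrArg Subtype.val (LinearMap.congr_fun hs x)⟩

theorem hochCoder_mem_degree {p : ℤ} {f : TCo k A.augIdeal →ₗ[k] A.carrier}
    (hf : f ∈ A.cochains p) {d : ℤ} {x : TCo k A.augIdeal} (hx : x ∈ degree A.barGrading d) :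
    A.hochCoder p f x ∈ degree A.barGrading (d + (p - 1)) :=
  coext_mem_degree _ (redProj_comp_degree hf) hx

/-- A graded subspace of values of Hochschild cocycles acts on `BA` by coderivations. -/
theorem exists_coderivations {H : Type v} [AddCommGroup H] [Module k H] (G : Grading k H)
    (j : H →ₗ[k] A.augIdeal) (h : ∀ p, ∀ x ∈ G.gr p, ∃ f ∈ A.cocycles p, f 1 = j x) :
    ∃ D : H →ₗ[k] Module.End k (TCo k A.augIdeal), ∀ p, ∀ x ∈ G.gr p, ∃ f ∈ A.cocycles p,
      f 1 = j x ∧ D x = A.hochCoder p f := by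
  choose s hs using fun p => exists_linear_section (p := p) (j ∘ₗ (G.gr p).subtype)
    fun x => h p x x.2
  refine ⟨G.lift (W := Module.End k (TCo k A.augIdeal)) fun p =>
    { toFun := fun x => A.hochCoder p (s p x)
      map_add' := fun x y => by
        rw [map_add, hochCoder, Submodule.coe_add, LinearMap.comp_add, coext_add]
        rfl
      map_smul' := fun c x => by
        rw [map_smul, hochCoder, Submodule.coe_smul, LinearMap.comp_smul, coext_smul]
        rfl }, fun p x hx => ⟨s p ⟨x, hx⟩, (s p ⟨x, hx⟩).2, hs p _, ?_⟩⟩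
  rw [Grading.lift_of_mem _ _ hx]
  rfl

/-- If `Π` is surjective, then there is a quasi-isomorphism to `A^{Lie}` from a graded vector space
with vanishing operations. -/
theorem exists_trivial_model [CharZero k] (hA : A.ProjectionSurjective) :
    ∃ (H : Type v) (_ : AddCommGroup H) (_ : Module k H) (G : Grading k H)
      (F : LInfinityAlgebra.Hom (trivialLInfinity H G) A.lie), F.IsQuasiIso := by
  obtain ⟨C, hC, hC1, hC2, hC3⟩ := exists_representatives hA
  set G := A.augGrading.ofComponents C hC with hG
  obtain ⟨D, hD⟩ := exists_coderivations (A := A) G (⨆ p, C p).subtype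
    fun p x hx => hC1 p x hx
  -- the same, in terms of the degrees of the suspension
  have hD' : ∀ p, ∀ x ∈ G.shift.gr p, ∃ f ∈ A.cocycles (p + 1),
      f 1 = (x : A.augIdeal) ∧ D x = A.hochCoder (p + 1) f := fun p x hx => hD (p + 1) x hx
  have hcoder : ∀ p, ∀ x ∈ G.shift.gr p, IsCoderivation A.barGrading p (D x) := by
    intro p x hx
    obtain ⟨f, hf, -, h⟩ := hD' p x hx
    have := coext_isCoderivation A.barGrading (p + 1 - 1) (A.redProj ∘ₗ f)
    rw [h, hochCoder]
    rwa [add_sub_cancel_right] at this ⊢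
  have hsgn : ∀ p, ∀ x ∈ G.shift.gr p, SgnComm A.barGrading p (D x) := by
    intro p x hx
    obtain ⟨f, hf, -, h⟩ := hD' p x hx
    have := coext_sgnComm A.barGrading (redProj_comp_sgn hf.1)
    rw [h, hochCoder]
    rwa [add_sub_cancel_right] at this ⊢
  have hdeg : ∀ p, ∀ h ∈ G.shift.gr p, ∀ d, ∀ x ∈ degree A.barGrading d,
      D h x ∈ degree A.barGrading (d + p) := by
    intro p x hx d y hy
    obtain ⟨f, hf, -, h⟩ := hD' p x hx
    have := hochCoder_mem_degree hf.1 hy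
    rwa [add_sub_cancel_right, ← h] at this
  -- Since each `D h` with `h` homogeneous commutes with `b` on `Sym` up to sign, it preserves the
  -- kernel of `b` there.
  have hker : ∀ h, ∀ y ∈ Sym A.barGrading ⊓ LinearMap.ker A.barDiff,
      D h y ∈ Sym A.barGrading ⊓ LinearMap.ker A.barDiff := by
    intro h y hy
    induction h using G.induction_gr with
    | h0 => rw [map_zero]; exact zero_mem _
    | ha a b ha hb => rw [map_add]; exact add_mem ha hb
    | h p x hx =>
      obtain ⟨f, hf, -, h⟩ := hD p x hx
      rw [h]
      refine ⟨hochCoder_mem_Sym hf.1 hy.1, ?_⟩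
      rw [SetLike.mem_coe, LinearMap.mem_ker, barDiff_hochCoder hf hy.1, LinearMap.mem_ker.1 hy.2,
        map_zero, smul_zero]
  have hF : ∀ x, expFlow D x ∈ Sym A.barGrading ⊓ LinearMap.ker A.barDiff :=
    expFlow_mem D ⟨one_mem_Sym _, A.barDiff_one⟩ hker
  have hlin : ∀ h, proj (D h 1) = (h : A.augIdeal) := by
    intro h
    induction h using G.induction_gr with
    | h0 => simp
    | ha a b ha hb => rw [map_add, LinearMap.add_apply, map_add, ha, hb, Submodule.coe_add]
    | h p x hx =>
      obtain ⟨f, hf, h1, h⟩ := hD p x hx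
      rw [h, hochCoder, proj_coext, LinearMap.comp_apply, h1]
      exact A.redProj_coe _
  set F : LInfinityAlgebra.Hom (trivialLInfinity (⨆ p, C p : Submodule k A.augIdeal) G) A.lie :=
    expFlowHom A.lie G D hcoder hsgn hdeg (fun x => (hF x).1) fun x => Subtype.ext (hF x).2
  have hFlin : ∀ x : (⨆ p, C p : Submodule k A.augIdeal), F.linear x = (x : A.augIdeal) := by
    intro x
    have h : proj (expFlow D (ι k x)) = (x : A.augIdeal) := by rw [expFlow_ι, hlin]
    exact h
  refine ⟨_, _, _, G, F, ?_, ?_⟩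
  -- The source has zero differential, so injectivity on cohomology says that a representative which
  -- is a boundary in `Ā` is zero.
  · rintro x - ⟨y, hy⟩
    refine ⟨0, ?_⟩
    rw [map_zero]
    refine Subtype.ext (hC2 _ x.2 (-y) ?_)
    rw [map_neg, ← lie_d, ← hy]
    exact (hFlin x).symm
  · intro y hy
    obtain ⟨x, hx, z, rfl⟩ := hC3 y (neg_eq_zero.1 ((lie_d y).symm.trans hy))
    refine ⟨⟨x, hx⟩, map_zero (proj ∘ₗ (Sym G.shift).subtype), -z, ?_⟩
    rw [map_neg, lie_d, neg_neg]
    exact congrArg (· + A.redD z) (hFlin ⟨x, hx⟩).symm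

/-- One model serves twice: with all operations zero it is completely abelian, and it is also a
graded Lie algebra with zero bracket. -/
theorem lie_isQuasiAbelian_and_isFormal [CharZero k] (hA : A.ProjectionSurjective) :
    A.lie.IsQuasiAbelian ∧ A.lie.IsFormal := by
  obtain ⟨H, _, _, G, F, hF⟩ := exists_trivial_model hA
  have h : ∀ n, (trivialLInfinity H G).OpVanishes n := fun n x _ =>
    map_zero (proj ∘ₗ (Sym G.shift).subtype)
  exact ⟨⟨_, F, fun n _ => h n, hF⟩, ⟨_, F, fun n _ => h n, hF⟩⟩

end AInfinityAlgebra

end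

end AInf

theorem mainTheorem8 (k : Type u) [Field k] [CharZero k] :
    (∀ A : AInf.AInfinityAlgebra.{u, v} k, A.IsAInfinityCommutative →
      A.lie.IsCompletelyAbelian) ∧
    (∀ A : AInf.DGAlgebra.{u, v} k, A.toAInfinity.ProjectionSurjective →
      A.toAInfinity.lie.IsQuasiAbelian ∧ A.toAInfinity.lie.IsFormal) :=
  ⟨fun _ hA => AInf.AInfinityAlgebra.lie_isCompletelyAbelian hA,
    fun _ hA => AInf.AInfinityAlgebra.lie_isQuasiAbelian_and_isFormal hA⟩
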